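/- Setting. Let $d\ge1$. A dyadic grid $\mathcal D$ on $\mathbb R^d$ is a family of (half-open) axis-parallel cubes with side lengths $\ell(Q)\in\{2^k:k\in\mathbb Z\}$ such that for each $k\in\mathbb Z$ the cubes of side $2^k$ partition $\mathbb R^d$ and each $Q\in\mathcal D$ is the union of its $2^d$ children (the cubes of $\mathcal D$ of side $\ell(Q)/2$ contained in $Q$). A generalized Haar function on $R\in\mathcal D$ is a linear combination of the indicators of the children of $R$. A generalized Haar shift of complexity type $(m,n)$, $m,n\in\{0,1,2,\dots\}$, is $$\mathbb S f=\sum_{Q\in\mathcal D}\mathbb S_Qf,\qquad \mathbb S_Qf(x)=\sum_{Q',R'}\frac{\langle f,h^{Q'}_{R'}\rangle}{|Q|}k^{R'}_{Q'}(x)=\frac1{|Q|}\int_Q s_Q(x,y)f(y)\,dy,$$ the inner sum being over $Q',R'\in\mathcal D$ with $Q',R'\subseteq Q$, $\ell(Q')=2^{-m}\ell(Q)$, $\ell(R')=2^{-n}\ell(Q)$, where $h^{Q'}_{R'}$ and $k^{R'}_{Q'}$ are generalized Haar functions on $R'$ and $Q'$ with $\|h^{Q'}_{R'}\|_\infty,\|k^{R'}_{Q'}\|_\infty\le1$.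 Its complexity is $\kappa=\max(m,n,1)$. Its truncations are $\mathbb S_{\epsilon,\upsilon}f=\sum_{Q\in\mathcal D,\ \epsilon\le\ell(Q)\le\upsilon}\mathbb S_Qf$, and its maximal truncation is $\mathbb S_\natural f=\sup_{0<\epsilon\le\upsilon<\infty}|\mathbb S_{\epsilon,\upsilon}f|$. It is $L^2$-bounded with norm at most $B$ if for every $f\in L^2(\mathbb R^d)$ the truncations $\mathbb S_{2^{-N},2^N}f$ converge in $L^2$ as $N\to\infty$ to a function $\mathbb Sf$ with $\|\mathbb Sf\|_2\le B\|f\|_2$. A linearization $\mathbb L$ of $\mathbb S_\natural$ is given by measurable functions $\epsilon,\upsilon:\mathbb R^d\to(0,\infty)$ and $\vartheta:\mathbb R^d\to[0,2\pi)$ through $\mathbb Lf(x)=e^{i\vartheta(x)}\mathbb S_{\epsilon(x),\upsilon(x)}f(x)$. Its adjoint is $$\mathbb L^*\nu(y)=\lim_{N\to\infty}\ \sum_{\substack{Q\in\mathcal D\\ 2^{-N}\le\ell(Q)\le2^N}}\frac1{|Q|}\int_Q s_Q(x,y)\,\mathbf 1_{\{\epsilon(x)\le\ell(Q)\le\upsilon(x)\}}\,e^{i\vartheta(x)}\,\nu(dx).$$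 For $1<p<\infty$ let $p'=p/(p-1)$. A weight $w$ (measurable, positive almost everywhere) is in $A_p$ if, with $\sigma=w^{1-p'}$, $$\|w\|_{A_p}=\sup_Q\frac{w(Q)}{|Q|}\Big(\frac{\sigma(Q)}{|Q|}\Big)^{p-1}<\infty,$$ the supremum being over all axis-parallel cubes of $\mathbb R^d$; here $w(E)=\int_E w\,dx$ and $\sigma(E)=\int_E\sigma\,dx$. Lemma 10.1. Let $d\ge1$, $1<p<\infty$ and $B\ge0$. There is a constant $C=C(d,p,B)$ such that the following holds for every dyadic grid $\mathcal D$, every generalized Haar shift $\mathbb S$ on $\mathcal D$ of complexity $\kappa$ that is $L^2$-bounded with norm at most $B$, every $w\in A_p$ with $\sigma=w^{1-p'}$, every linearization $\mathbb L$ of $\mathbb S_\natural$, every measurable $\varphi:\mathbb R^d\to\mathbb C$ with $\|\varphi\|_\infty\le1$, and every $Q\in\mathcal D$. The limit defining $\mathbb L^*(w\varphi\mathbf 1_Q)$ exists almost everywhere, $$\big\|\mathbf 1_Q\,\mathbb L^*(w\varphi\mathbf 1_Q)\big\|_{L^{p'}(\sigma)}\le C\,\kappa\,\|w\|_{A_p}\,w(Q)^{1/p'},$$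 and $$\Big\|\sup_{R\in\mathcal D,\ R\subseteq Q}\mathbf 1_R\,\frac1{w(R)}\int_R\big|\mathbb L^*(\mathbf 1_R\varphi w)(y)\big|\,\sigma(dy)\Big\|_{L^p(w)}\le C\,\kappa\,\|w\|_{A_p}^{1/(p-1)}\,\sigma(Q)^{1/p}.$$ -/

import Mathlib

open MeasureTheory Filter Topology
open scoped ENNReal NNReal

noncomputable section

namespace HaarShift

/-- A (half-open) cube in `ℝ^d` with sides parallel to the axes, given by its lower corner and its
side length. -/
@[ext]
structure Cube (d : ℕ) where
  corner : Fin d → ℝ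
  side : ℝ
  side_pos : 0 < side

/-- The points of the cube. -/
def Cube.toSet {d : ℕ} (Q : Cube d) : Set (Fin d → ℝ) :=
  {x | ∀ i, Q.corner i ≤ x i ∧ x i < Q.corner i + Q.side}

/-- The volume `|Q| = ℓ(Q)^d`. -/
def Cube.vol {d : ℕ} (Q : Cube d) : ℝ := Q.side ^ d

/-- The cubes of the family `𝒟` that lie in `Q` and have side length `2^{-j} ℓ(Q)`. For `j = 1` and
`𝒟` a dyadic grid these are the children of `Q`. -/
def descendants {d : ℕ} (𝒟 : Set (Cube d)) (j : ℕ) (Q : Cube d) : Set (Cube d) :=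
  {Q' | Q' ∈ 𝒟 ∧ Q'.side = Q.side / 2 ^ j ∧ Q'.toSet ⊆ Q.toSet}

/-- A dyadic grid: a family of cubes whose side lengths are integer powers of `2`, such that for
each integer `k` the cubes of side length `2^k` partition `ℝ^d`, and such that each cube is the
union of its children (the volumes then force that there are `2^d` of them). -/
structure DyadicGrid (d : ℕ) where
  cubes : Set (Cube d)
  side_eq : ∀ Q ∈ cubes, ∃ k : ℤ, Q.side = (2 : ℝ) ^ k
  partition : ∀ (k : ℤ) (x : Fin d → ℝ),
    ∃! Q : Cube d, Q ∈ cubes ∧ Q.side = (2 : ℝ) ^ k ∧ x ∈ Q.toSet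
  children : ∀ Q ∈ cubes, Q.toSet = ⋃ Q' ∈ descendants cubes 1 Q, Q'.toSet

/-- `h = ∑_{Q' ∈ Child(R)} c_{Q'} 1_{Q'}`: a generalized Haar function associated to `R`. -/
def IsGeneralizedHaar {d : ℕ} (D : DyadicGrid d) (R : Cube d) (h : (Fin d → ℝ) → ℂ) : Prop :=
  ∃ c : Cube d → ℂ,
    (∀ Q' ∈ descendants D.cubes 1 R, ∀ x ∈ Q'.toSet, h x = c Q') ∧ ∀ x ∉ R.toSet, h x = 0

/-- The data of a generalized Haar shift of complexity type `(m, n)`. For `Q'`, `R'` contained in a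
common `Q ∈ 𝒟` with `ℓ(Q') = 2^{-m} ℓ(Q)` and `ℓ(R') = 2^{-n} ℓ(Q)`, the function `h Q' R'` is
`h^{Q'}_{R'}`, a generalized Haar function on `R'`, and `k R' Q'` is `k^{R'}_{Q'}`, one on `Q'`;
both are bounded by `1`. -/
structure GeneralizedShift {d : ℕ} (D : DyadicGrid d) (m n : ℕ) where
  h : Cube d → Cube d → (Fin d → ℝ) → ℂ
  k : Cube d → Cube d → (Fin d → ℝ) → ℂ
  h_haar : ∀ Q ∈ D.cubes, ∀ Q' ∈ descendants D.cubes m Q, ∀ R' ∈ descendants D.cubes n Q,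
    IsGeneralizedHaar D R' (h Q' R')
  k_haar : ∀ Q ∈ D.cubes, ∀ Q' ∈ descendants D.cubes m Q, ∀ R' ∈ descendants D.cubes n Q,
    IsGeneralizedHaar D Q' (k R' Q')
  h_le : ∀ Q ∈ D.cubes, ∀ Q' ∈ descendants D.cubes m Q, ∀ R' ∈ descendants D.cubes n Q,
    ∀ x, ‖h Q' R' x‖ ≤ 1
  k_le : ∀ Q ∈ D.cubes, ∀ Q' ∈ descendants D.cubes m Q, ∀ R' ∈ descendants D.cubes n Q,
    ∀ x, ‖k R' Q' x‖ ≤ 1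

/-- The complexity `κ = max(m, n, 1)` of a shift of complexity type `(m, n)`. -/
def complexity (m n : ℕ) : ℕ := max (max m n) 1

namespace GeneralizedShift

variable {d : ℕ} {D : DyadicGrid d} {m n : ℕ}

/-- The kernel `s_Q(x, y) = ∑ k^{R'}_{Q'}(x) conj (h^{Q'}_{R'}(y))`, the (finite) sum being over
`Q', R' ⊆ Q` in the grid with `ℓ(Q') = 2^{-m} ℓ(Q)`, `ℓ(R') = 2^{-n} ℓ(Q)`. -/
def kernel (S : GeneralizedShift D m n) (Q : Cube d) (x y : Fin d → ℝ) : ℂ :=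
  ∑ᶠ (Q' : Cube d) (_ : Q' ∈ descendants D.cubes m Q), ∑ᶠ (R' : Cube d)
    (_ : R' ∈ descendants D.cubes n Q), S.k R' Q' x * (starRingEnd ℂ) (S.h Q' R' y)

/-- `S_Q f(x) = |Q|⁻¹ ∫ s_Q(x, y) f(y) dy = ∑ |Q|⁻¹ ⟨f, h^{Q'}_{R'}⟩ k^{R'}_{Q'}(x)`. -/
def component (S : GeneralizedShift D m n) (Q : Cube d) (f : (Fin d → ℝ) → ℂ)
    (x : Fin d → ℝ) : ℂ :=
  (Q.vol : ℂ)⁻¹ * ∫ y, S.kernel Q x y * f y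

/-- The truncation `S_{ε,υ} f = ∑_{Q ∈ 𝒟, ε ≤ ℓ(Q) ≤ υ} S_Q f`; at each point only finitely many
terms are nonzero if `ε > 0`. -/
def truncation (S : GeneralizedShift D m n) (ε υ : ℝ) (f : (Fin d → ℝ) → ℂ)
    (x : Fin d → ℝ) : ℂ :=
  ∑ᶠ (Q : Cube d) (_ : Q ∈ D.cubes ∧ ε ≤ Q.side ∧ Q.side ≤ υ), S.component Q f x

/-- The operator `S f = ∑_Q S_Q f` (the sum being the limit in `L²` of the truncations) is bounded
on `L²(ℝ^d)` with norm at most `B`. -/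
def L2Bounded (S : GeneralizedShift D m n) (B : ℝ≥0) : Prop :=
  ∀ f : (Fin d → ℝ) → ℂ, MemLp f 2 volume → ∃ g : (Fin d → ℝ) → ℂ, MemLp g 2 volume ∧
    Tendsto (fun N : ℕ => eLpNorm
      (fun x => S.truncation ((2 : ℝ) ^ (-(N : ℤ))) ((2 : ℝ) ^ (N : ℤ)) f x - g x) 2 volume)
      atTop (𝓝 0) ∧
    eLpNorm g 2 volume ≤ B * eLpNorm f 2 volume

end GeneralizedShift

/-- The measurable selections `ε(x), υ(x) ∈ (0, ∞)` and `ϑ(x) ∈ [0, 2π)` that define a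
linearization of the maximal truncations. -/
structure Linearization (d : ℕ) where
  ε : (Fin d → ℝ) → ℝ
  υ : (Fin d → ℝ) → ℝ
  ϑ : (Fin d → ℝ) → ℝ
  ε_meas : AEMeasurable ε volume
  υ_meas : AEMeasurable υ volume
  ϑ_meas : AEMeasurable ϑ volume
  ε_pos : ∀ x, 0 < ε x
  υ_pos : ∀ x, 0 < υ x
  ϑ_mem : ∀ x, ϑ x ∈ Set.Ico 0 (2 * Real.pi)

namespace Linearization

variable {d : ℕ} {D : DyadicGrid d} {m n : ℕ}

/-- The linearization `𝕃 f(x) = e^{iϑ(x)} S_{ε(x),υ(x)} f(x)` of the maximal truncations of `S`. -/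
def apply (L : Linearization d) (S : GeneralizedShift D m n) (f : (Fin d → ℝ) → ℂ)
    (x : Fin d → ℝ) : ℂ :=
  Complex.exp (L.ϑ x * Complex.I) * S.truncation (L.ε x) (L.υ x) f x

/-- The `Q`-th term of the adjoint `𝕃*` applied to the measure `ν = g dx`:
`S_Q^*(1_{ε(·) ≤ ℓ(Q) ≤ υ(·)} e^{iϑ(·)} ν)(y)
  = |Q|⁻¹ ∫_Q s_Q(x, y) 1_{ε(x) ≤ ℓ(Q) ≤ υ(x)} e^{iϑ(x)} g(x) dx`. -/
def adjointTerm (L : Linearization d) (S : GeneralizedShift D m n) (Q : Cube d)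
    (g : (Fin d → ℝ) → ℂ) (y : Fin d → ℝ) : ℂ :=
  (Q.vol : ℂ)⁻¹ * ∫ x in Q.toSet, S.kernel Q x y *
    (Set.indicator {x | L.ε x ≤ Q.side ∧ Q.side ≤ L.υ x}
      (fun x => Complex.exp (L.ϑ x * Complex.I) * g x) x)

/-- Partial sums of `𝕃* ν = ∑_{Q ∈ 𝒟} S_Q^*(…)`: the sum over the cubes with
`2^{-N} ≤ ℓ(Q) ≤ 2^N`. At each point only the `2N + 1` cubes that contain it contribute. -/
def adjointPartial (L : Linearization d) (S : GeneralizedShift D m n) (N : ℕ)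
    (g : (Fin d → ℝ) → ℂ) (y : Fin d → ℝ) : ℂ :=
  ∑ᶠ (Q : Cube d)
    (_ : Q ∈ D.cubes ∧ (2 : ℝ) ^ (-(N : ℤ)) ≤ Q.side ∧ Q.side ≤ (2 : ℝ) ^ (N : ℤ)),
    L.adjointTerm S Q g y

/-- The series that defines `𝕃* ν(y)`, summed along the scales, converges. -/
def AdjointConverges (L : Linearization d) (S : GeneralizedShift D m n)
    (g : (Fin d → ℝ) → ℂ) (y : Fin d → ℝ) : Prop :=
  ∃ l : ℂ, Tendsto (fun N : ℕ => L.adjointPartial S N g y) atTop (𝓝 l)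

/-- The adjoint `𝕃* ν(y)` for `ν = g dx` (meaningful where the series converges). -/
def adjoint (L : Linearization d) (S : GeneralizedShift D m n)
    (g : (Fin d → ℝ) → ℂ) (y : Fin d → ℝ) : ℂ :=
  limUnder atTop (fun N : ℕ => L.adjointPartial S N g y)

end Linearization

/-- The measure with density `w` (also denoted by `w`). -/
def weightMeasure {d : ℕ} (w : (Fin d → ℝ) → ℝ) : Measure (Fin d → ℝ) :=
  volume.withDensity (fun x => ENNReal.ofReal (w x))

/-- The dual weight `σ = w^{1-p'}`, `p' = p/(p-1)`. -/
def dualWeight {d : ℕ} (w : (Fin d → ℝ) → ℝ) (p : ℝ) : (Fin d → ℝ) → ℝ :=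
  fun x => w x ^ (1 - p.conjExponent)

/-- The Muckenhoupt characteristic
`‖w‖_{A_p} = sup_Q (w(Q)/|Q|) (σ(Q)/|Q|)^{p-1}`, over all cubes `Q` of `ℝ^d`. -/
def apConst {d : ℕ} (w : (Fin d → ℝ) → ℝ) (p : ℝ) : ℝ≥0∞ :=
  ⨆ Q : Cube d, (weightMeasure w Q.toSet / volume Q.toSet) *
    (weightMeasure (dualWeight w p) Q.toSet / volume Q.toSet) ^ (p - 1)

/-- `w ∈ A_p`. -/
structure IsApWeight {d : ℕ} (w : (Fin d → ℝ) → ℝ) (p : ℝ) : Prop where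
  meas : AEMeasurable w volume
  pos : ∀ᵐ x ∂(volume : Measure (Fin d → ℝ)), 0 < w x
  finite : apConst w p < ∞

/-- The function `1_R φ w`. -/
def testFun {d : ℕ} (R : Cube d) (φ : (Fin d → ℝ) → ℂ) (w : (Fin d → ℝ) → ℝ) :
    (Fin d → ℝ) → ℂ :=
  Set.indicator R.toSet (fun x => φ x * (w x : ℂ))

/-- The function
`x ↦ sup_{R ∈ 𝒟, R ⊆ Q} 1_R(x) w(R)⁻¹ ∫_R |𝕃*(1_R φ w)(y)| σ(dy)`
of the nonstandard testing condition. -/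
def nonstandardTesting {d : ℕ} {D : DyadicGrid d} {m n : ℕ} (S : GeneralizedShift D m n)
    (L : Linearization d) (p : ℝ) (w : (Fin d → ℝ) → ℝ) (φ : (Fin d → ℝ) → ℂ) (Q : Cube d)
    (x : Fin d → ℝ) : ℝ≥0∞ :=
  ⨆ (R : Cube d) (_ : R ∈ D.cubes ∧ R.toSet ⊆ Q.toSet), Set.indicator R.toSet
    (fun _ => (weightMeasure w R.toSet)⁻¹ *
      ∫⁻ y in R.toSet, ‖L.adjoint S (testFun R φ w) y‖ₑ ∂(weightMeasure (dualWeight w p))) x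

end HaarShift

end

noncomputable section

namespace HaarShift

variable {d : ℕ}

/-! The theorem reduces to positive sparse operators, through a domination that is linear in
$\kappa$. Group the shift by scales: at scale $k$ the kernel lives on pairs of points in a common
cube of side $2^k$, has size at most $2^{-kd}$, and is constant on products of cubes $\kappa+1$
generations smaller (`LocalKernel`). Given $f$ and a cube $R$, stop at the maximal subcubes $P$
where the average of $|f|$ jumps by a factor 8, or where the sum over scales from $\kappa+1$
generations above $P$ up to $R$, which is constant on $P$, exceeds a multiple of $\kappa$ times the
average over $R$. A Calderón–Zygmund decomposition shows that these cubes cover at most half of $R$: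
the good part is treated by the $L^2$ bound and Cotlar's inequality (`cotlar_of_bounded`), and each
bad piece has mean zero and is felt at only $\kappa$ scales outside its cube. Iteration gives
$|\sum_i\mathbb S_if|\lesssim\kappa\sum_P\langle|f|\rangle_P\mathbf 1_P$ with a sparse family
(`isSparse_stopCubes`, `enorm_sum_le_sparseSum`).

Let $U$ be a finite partial sum of $\mathbb L^*g$ with $|g|\le w$ carried by $R$. Pairing $U$ with
$f=\overline{\operatorname{sgn}U}\,|U|^r\sigma\mathbf 1_R$ moves the operator to $f$, where the
sparse bound applies (`exists_sparse_adjoint_le`). The family depends on $U$, but the later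
estimates are uniform over sparse families. With $r=p'-1$, Hölder's inequality and the testing bound
$\int(\sum_P\frac{w(P)}{|P|}\mathbf 1_P)^{p'}d\sigma\lesssim\|w\|_{A_p}^{p'}w(R)$ give the first
estimate. With $r=0$ one must sum $\frac{\sigma(P)}{|P|}w(P)$, which is at most a constant times
$\|w\|_{A_p}^{p'-1}(|R|/w(R))^{p'-1}w(R)$. After division by $w(R)$ the supremum over $R$ is
controlled by the power $p'-1$ of the dyadic maximal function of $1/w$ relative to $w$; Doob's
inequality bounds its $L^{p'}(w)$ norm by $\sigma(Q)^{1/p'}$, and $(p'-1)p=p'$ yields the second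
estimate.

Almost everywhere convergence rests on a third bound, by the mass of $g$. Scales up to $2^i$ see
only points with $\epsilon(x)\le2^i$, and this set shrinks to nothing as $i\to-\infty$. The sums are
therefore Cauchy in $L^1(\sigma)$, and since they are constant on small cubes up to negligible
terms, Lebesgue differentiation makes them converge pointwise. Fatou's lemma transfers the bounds
for finite sums to the limit. -/

theorem Cube.toSet_eq_pi (Q : Cube d) :
    Q.toSet = Set.pi Set.univ fun i => Set.Ico (Q.corner i) (Q.corner i + Q.side) := by
  ext x; simp [Cube.toSet]

theorem Cube.corner_mem (Q : Cube d) : Q.corner ∈ Q.toSet := fun i =>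
  ⟨le_rfl, by linarith [Q.side_pos]⟩

@[measurability]
theorem Cube.measurableSet_toSet (Q : Cube d) : MeasurableSet Q.toSet := by
  rw [Q.toSet_eq_pi]
  exact MeasurableSet.univ_pi fun i => measurableSet_Ico

theorem Cube.vol_pos (Q : Cube d) : 0 < Q.vol := pow_pos Q.side_pos _

theorem Cube.volume_toSet (Q : Cube d) : volume Q.toSet = ENNReal.ofReal Q.vol := by
  rw [Q.toSet_eq_pi, Real.volume_pi_Ico]
  simp [Cube.vol, ENNReal.ofReal_pow Q.side_pos.le]

theorem Cube.volume_pos (Q : Cube d) : 0 < volume Q.toSet := by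
  rw [Q.volume_toSet]; simpa using Q.vol_pos

theorem Cube.volume_ne_zero (Q : Cube d) : volume Q.toSet ≠ 0 := Q.volume_pos.ne'

theorem Cube.volume_ne_top (Q : Cube d) : volume Q.toSet ≠ ∞ := by
  rw [Q.volume_toSet]; simp

/-- The integer `k` with `ℓ(Q) = 2^k`, for a cube of a dyadic grid. -/
def Cube.scale (Q : Cube d) : ℤ := Int.log 2 Q.side

/-! ### Geometry of a dyadic grid: nesting, countability, measurability. -/

namespace DyadicGrid

variable (D : DyadicGrid d)

theorem side_eq_zpow {Q : Cube d} (hQ : Q ∈ D.cubes) : Q.side = (2 : ℝ) ^ Q.scale := by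
  obtain ⟨k, hk⟩ := D.side_eq Q hQ
  have : Q.scale = k := by
    rw [Cube.scale, hk]
    exact_mod_cast Int.log_zpow (R := ℝ) (b := 2) (by norm_num) k
  rw [this, hk]

/-- The cube of the grid of side length `2^k` that contains `x`. -/
def cubeAt (k : ℤ) (x : Fin d → ℝ) : Cube d := (D.partition k x).choose

theorem cubeAt_mem (k : ℤ) (x : Fin d → ℝ) : D.cubeAt k x ∈ D.cubes :=
  (D.partition k x).choose_spec.1.1

theorem cubeAt_side (k : ℤ) (x : Fin d → ℝ) : (D.cubeAt k x).side = (2 : ℝ) ^ k :=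
  (D.partition k x).choose_spec.1.2.1

theorem mem_cubeAt (k : ℤ) (x : Fin d → ℝ) : x ∈ (D.cubeAt k x).toSet :=
  (D.partition k x).choose_spec.1.2.2

theorem cubeAt_eq_of_side {Q : Cube d} (hQ : Q ∈ D.cubes) {k : ℤ} (hk : Q.side = (2 : ℝ) ^ k)
    {x : Fin d → ℝ} (hx : x ∈ Q.toSet) : D.cubeAt k x = Q :=
  ((D.partition k x).choose_spec.2 Q ⟨hQ, hk, hx⟩).symm

theorem cubeAt_scale_eq {Q : Cube d} (hQ : Q ∈ D.cubes) {x : Fin d → ℝ} (hx : x ∈ Q.toSet) :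
    D.cubeAt Q.scale x = Q :=
  D.cubeAt_eq_of_side hQ (D.side_eq_zpow hQ) hx

@[simp]
theorem scale_cubeAt (k : ℤ) (x : Fin d → ℝ) : (D.cubeAt k x).scale = k := by
  have h := D.side_eq_zpow (D.cubeAt_mem k x)
  rw [cubeAt_side] at h
  exact (zpow_right_injective₀ (by norm_num : (0:ℝ) < 2) (by norm_num) h).symm

theorem cubeAt_eq_of_mem {k : ℤ} {x y : Fin d → ℝ} (h : y ∈ (D.cubeAt k x).toSet) :
    D.cubeAt k y = D.cubeAt k x :=
  D.cubeAt_eq_of_side (D.cubeAt_mem k x) (D.cubeAt_side k x) h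

theorem mem_cubeAt_iff {k : ℤ} {x y : Fin d → ℝ} :
    y ∈ (D.cubeAt k x).toSet ↔ D.cubeAt k y = D.cubeAt k x :=
  ⟨D.cubeAt_eq_of_mem, fun h => h ▸ D.mem_cubeAt k y⟩

theorem cubeAt_sub_one_subset (k : ℤ) (x : Fin d → ℝ) :
    (D.cubeAt (k - 1) x).toSet ⊆ (D.cubeAt k x).toSet := by
  have hx := D.mem_cubeAt k x
  rw [D.children _ (D.cubeAt_mem k x)] at hx
  simp only [Set.mem_iUnion] at hx
  obtain ⟨Q', ⟨h1, h2, h3⟩, h4⟩ := hx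
  rw [D.cubeAt_eq_of_side h1 (k := k - 1) _ h4]
  · exact h3
  · rw [h2, cubeAt_side, zpow_sub₀ (by norm_num)]; simp

theorem cubeAt_subset {j k : ℤ} (hjk : j ≤ k) (x : Fin d → ℝ) :
    (D.cubeAt j x).toSet ⊆ (D.cubeAt k x).toSet := by
  induction k, hjk using Int.leInduction with
  | base => exact subset_rfl
  | succ n hn ih =>
    refine ih.trans ?_
    simpa using D.cubeAt_sub_one_subset (n + 1) x

theorem cubeAt_mono {j k : ℤ} (hjk : j ≤ k) {x y : Fin d → ℝ} (h : D.cubeAt j y = D.cubeAt j x) :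
    D.cubeAt k y = D.cubeAt k x :=
  D.cubeAt_eq_of_mem (D.cubeAt_subset hjk x (D.mem_cubeAt_iff.2 h))

theorem subset_of_mem {P Q : Cube d} (hP : P ∈ D.cubes) (hQ : Q ∈ D.cubes)
    (h : P.scale ≤ Q.scale) {x : Fin d → ℝ} (hxP : x ∈ P.toSet) (hxQ : x ∈ Q.toSet) :
    P.toSet ⊆ Q.toSet := by
  have := D.cubeAt_subset h x
  rwa [D.cubeAt_scale_eq hP hxP, D.cubeAt_scale_eq hQ hxQ] at this

theorem eq_of_mem {P Q : Cube d} (hP : P ∈ D.cubes) (hQ : Q ∈ D.cubes)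
    (h : P.scale = Q.scale) {x : Fin d → ℝ} (hxP : x ∈ P.toSet) (hxQ : x ∈ Q.toSet) : P = Q := by
  rw [← D.cubeAt_scale_eq hP hxP, ← D.cubeAt_scale_eq hQ hxQ, h]

theorem volume_cube {Q : Cube d} (hQ : Q ∈ D.cubes) :
    volume Q.toSet = ENNReal.ofReal (((2 : ℝ) ^ Q.scale) ^ d) := by
  rw [Q.volume_toSet, Cube.vol, D.side_eq_zpow hQ]

theorem volume_cubeAt (k : ℤ) (x : Fin d → ℝ) :
    volume (D.cubeAt k x).toSet = ENNReal.ofReal (((2 : ℝ) ^ k) ^ d) := by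
  rw [D.volume_cube (D.cubeAt_mem k x), scale_cubeAt]

/-- Volumes detect the scale only in positive dimension; for $d=0$ all cubes have the same point
set. -/
theorem scale_le_of_subset (hd : 0 < d) {P Q : Cube d} (hP : P ∈ D.cubes) (hQ : Q ∈ D.cubes)
    (h : P.toSet ⊆ Q.toSet) : P.scale ≤ Q.scale := by
  have h1 := measure_mono (μ := volume) h
  rw [D.volume_cube hP, D.volume_cube hQ, ENNReal.ofReal_le_ofReal_iff (by positivity)] at h1
  have h2 := (pow_le_pow_iff_left₀ (by positivity) (by positivity) hd.ne').1 h1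
  exact (zpow_le_zpow_iff_right₀ (by norm_num)).1 h2

theorem scale_lt_of_ssubset (hd : 0 < d) {P Q : Cube d} (hP : P ∈ D.cubes) (hQ : Q ∈ D.cubes)
    (h : P.toSet ⊂ Q.toSet) : P.scale < Q.scale := by
  refine lt_of_le_of_ne (D.scale_le_of_subset hd hP hQ h.subset) fun he => h.ne ?_
  rw [D.eq_of_mem hP hQ he P.corner_mem (h.subset P.corner_mem)]

/-- A cube is determined by its scale and any one of its points, and its interior meets a countable
dense set. -/
theorem countable_cubes : D.cubes.Countable := by
  obtain ⟨s, hs, hd⟩ := TopologicalSpace.exists_countable_dense (Fin d → ℝ)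
  have : D.cubes ⊆ ⋃ k : ℤ, D.cubeAt k '' s := by
    intro Q hQ
    have ho : IsOpen (Set.pi Set.univ fun i => Set.Ioo (Q.corner i) (Q.corner i + Q.side)) :=
      isOpen_set_pi Set.finite_univ fun _ _ => isOpen_Ioo
    have hne : (Set.pi Set.univ fun i => Set.Ioo (Q.corner i) (Q.corner i + Q.side)).Nonempty := by
      refine ⟨fun i => Q.corner i + Q.side / 2, fun i _ => ?_⟩
      constructor <;> dsimp only <;> linarith [Q.side_pos]
    obtain ⟨x, hx, hxs⟩ := hd.inter_open_nonempty _ ho hne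
    refine Set.mem_iUnion.2 ⟨Q.scale, x, hxs, D.cubeAt_scale_eq hQ ?_⟩
    intro i
    exact ⟨(hx i trivial).1.le, (hx i trivial).2⟩
  exact (Set.countable_iUnion fun k => hs.image _).mono this

theorem countable_subset {s : Set (Cube d)} (hs : s ⊆ D.cubes) : s.Countable :=
  D.countable_cubes.mono hs

/-- Preimages are countable unions of cubes. Measurability of the scale operators comes from here,
with no assumption on the input function. -/
theorem measurable_of_cubeAt {E : Type*} [MeasurableSpace E] (k : ℤ) {f : (Fin d → ℝ) → E}
    (hf : ∀ x y, D.cubeAt k x = D.cubeAt k y → f x = f y) : Measurable f := by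
  intro t ht
  have : f ⁻¹' t = ⋃ Q ∈ {Q ∈ D.cubes | Q.scale = k ∧ Q.toSet ⊆ f ⁻¹' t}, Q.toSet := by
    ext x
    simp only [Set.mem_iUnion, Set.mem_ofPred_eq]
    constructor
    · intro hx
      refine ⟨D.cubeAt k x, ⟨D.cubeAt_mem k x, by simp, fun y hy => ?_⟩, D.mem_cubeAt k x⟩
      have := hf y x (D.cubeAt_eq_of_mem hy)
      simpa [this] using hx
    · rintro ⟨Q, ⟨h1, h2, h3⟩, h4⟩
      exact h3 h4
  rw [this]
  exact MeasurableSet.biUnion (D.countable_subset fun Q hQ => hQ.1)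
    fun Q _ => Q.measurableSet_toSet

theorem measurable_of_cubeAt₂ {E : Type*} [MeasurableSpace E] (k : ℤ)
    {f : (Fin d → ℝ) → (Fin d → ℝ) → E}
    (hf : ∀ x x' y y', D.cubeAt k x = D.cubeAt k x' → D.cubeAt k y = D.cubeAt k y' →
      f x y = f x' y') : Measurable (Function.uncurry f) := by
  intro t ht
  have : Function.uncurry f ⁻¹' t = ⋃ Q ∈ {Q : Cube d × Cube d | (Q.1 ∈ D.cubes ∧ Q.2 ∈ D.cubes) ∧
      Q.1.toSet ×ˢ Q.2.toSet ⊆ Function.uncurry f ⁻¹' t}, Q.1.toSet ×ˢ Q.2.toSet := by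
    ext ⟨x, y⟩
    simp only [Set.mem_iUnion, Set.mem_ofPred_eq]
    constructor
    · intro hx
      refine ⟨(D.cubeAt k x, D.cubeAt k y),
        ⟨⟨D.cubeAt_mem k x, D.cubeAt_mem k y⟩, fun z hz => ?_⟩,
          ⟨D.mem_cubeAt k x, D.mem_cubeAt k y⟩⟩
      have := hf z.1 x z.2 y (D.cubeAt_eq_of_mem hz.1) (D.cubeAt_eq_of_mem hz.2)
      simp only [Set.mem_preimage, Function.uncurry] at hx ⊢
      rwa [this]
    · rintro ⟨Q, ⟨-, h3⟩, h4⟩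
      exact h3 h4
  rw [this]
  refine MeasurableSet.biUnion ((D.countable_cubes.prod D.countable_cubes).mono
    fun Q hQ => Set.mem_prod.2 hQ.1)
    fun Q _ => Q.1.measurableSet_toSet.prod Q.2.measurableSet_toSet

theorem mem_descendants_iff {Q P : Cube d} (hQ : Q ∈ D.cubes) (j : ℕ) :
    P ∈ descendants D.cubes j Q ↔ P ∈ D.cubes ∧ P.scale = Q.scale - j ∧ P.toSet ⊆ Q.toSet := by
  refine ⟨fun ⟨h1, h2, h3⟩ => ⟨h1, ?_, h3⟩, fun ⟨h1, h2, h3⟩ => ⟨h1, ?_, h3⟩⟩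
  · rw [D.side_eq_zpow h1, D.side_eq_zpow hQ, ← zpow_natCast, ← zpow_sub₀ (by norm_num)] at h2
    exact zpow_right_injective₀ (by norm_num : (0:ℝ) < 2) (by norm_num) h2
  · rw [D.side_eq_zpow h1, D.side_eq_zpow hQ, ← zpow_natCast, ← zpow_sub₀ (by norm_num), h2]

theorem cubeAt_mem_descendants {Q : Cube d} (hQ : Q ∈ D.cubes) (j : ℕ) {x : Fin d → ℝ}
    (hx : x ∈ Q.toSet) : D.cubeAt (Q.scale - j) x ∈ descendants D.cubes j Q := by
  rw [D.mem_descendants_iff hQ]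
  refine ⟨D.cubeAt_mem _ _, by simp, ?_⟩
  exact D.subset_of_mem (D.cubeAt_mem _ _) hQ (by simp) (D.mem_cubeAt _ _) hx

theorem eq_cubeAt_of_mem_descendants {Q P : Cube d} (hQ : Q ∈ D.cubes) {j : ℕ}
    (hP : P ∈ descendants D.cubes j Q) {x : Fin d → ℝ} (hx : x ∈ P.toSet) :
    P = D.cubeAt (Q.scale - j) x := by
  rw [D.mem_descendants_iff hQ] at hP
  rw [← hP.2.1, D.cubeAt_scale_eq hP.1 hx]

end DyadicGrid

/-! ### From sums over cubes to sums over scales. -/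

namespace DyadicGrid

theorem finsum_cubes_eq_sum (D : DyadicGrid d) (F : Cube d → ℂ) (y : Fin d → ℝ)
    (hF : ∀ Q ∈ D.cubes, y ∉ Q.toSet → F Q = 0) (a b : ℝ) (s : Finset ℤ)
    (hs : ∀ k : ℤ, k ∈ s ↔ a ≤ (2 : ℝ) ^ k ∧ (2 : ℝ) ^ k ≤ b) :
    ∑ᶠ (Q : Cube d) (_ : Q ∈ D.cubes ∧ a ≤ Q.side ∧ Q.side ≤ b), F Q =
      ∑ k ∈ s, F (D.cubeAt k y) := by
  classical
  have hinj : Set.InjOn (fun k => D.cubeAt k y) (s : Set ℤ) := by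
    intro j _ k _ hjk
    have := congrArg Cube.scale hjk
    simpa using this
  rw [← finsum_mem_coe_finset, ← finsum_mem_image (f := F) hinj]
  refine finsum_mem_inter_support_eq F {Q | Q ∈ D.cubes ∧ a ≤ Q.side ∧ Q.side ≤ b}
    ((fun k => D.cubeAt k y) '' (s : Set ℤ)) ?_
  ext Q
  simp only [Set.mem_inter_iff, Set.mem_ofPred_eq, Set.mem_image, Function.mem_support,
    Finset.mem_coe]
  constructor
  · rintro ⟨⟨h1, h2, h3⟩, h4⟩
    have hy : y ∈ Q.toSet := by
      by_contra h; exact h4 (hF Q h1 h)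
    refine ⟨⟨Q.scale, ?_, D.cubeAt_scale_eq h1 hy⟩, h4⟩
    rw [hs, ← D.side_eq_zpow h1]
    exact ⟨h2, h3⟩
  · rintro ⟨⟨k, hk, rfl⟩, h4⟩
    rw [hs] at hk
    exact ⟨⟨D.cubeAt_mem k y, by simpa [D.cubeAt_side] using hk⟩, h4⟩

end DyadicGrid

/-! ### The kernels of a shift: locality, size and constancy. -/

/-- A family of kernels, one for each scale, that live on the cubes of that scale, obey the
normalized size bound, and are constant on products of cubes that are `κ + 1` generations
smaller. -/
structure LocalKernel (D : DyadicGrid d) (κ : ℕ) (a : ℤ → (Fin d → ℝ) → (Fin d → ℝ) → ℂ) :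
    Prop where
  zero : ∀ k x y, D.cubeAt k x ≠ D.cubeAt k y → a k x y = 0
  bound : ∀ k x y, ‖a k x y‖ ≤ (((2 : ℝ) ^ k) ^ d)⁻¹
  const : ∀ (k j : ℤ) x x' y y', j + κ + 1 ≤ k → D.cubeAt j x = D.cubeAt j x' →
    D.cubeAt j y = D.cubeAt j y' → a k x y = a k x' y'

namespace GeneralizedShift

variable {D : DyadicGrid d} {m n : ℕ} (S : GeneralizedShift D m n)

theorem k_eq_zero {Q Q' R' : Cube d} (hQ : Q ∈ D.cubes) (hQ' : Q' ∈ descendants D.cubes m Q)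
    (hR' : R' ∈ descendants D.cubes n Q) {x : Fin d → ℝ} (hx : x ∉ Q'.toSet) :
    S.k R' Q' x = 0 := by
  obtain ⟨c, -, h⟩ := S.k_haar Q hQ Q' hQ' R' hR'
  exact h x hx

theorem h_eq_zero {Q Q' R' : Cube d} (hQ : Q ∈ D.cubes) (hQ' : Q' ∈ descendants D.cubes m Q)
    (hR' : R' ∈ descendants D.cubes n Q) {x : Fin d → ℝ} (hx : x ∉ R'.toSet) :
    S.h Q' R' x = 0 := by
  obtain ⟨c, -, h⟩ := S.h_haar Q hQ Q' hQ' R' hR'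
  exact h x hx

theorem kernel_eq_zero {Q : Cube d} (hQ : Q ∈ D.cubes) {x y : Fin d → ℝ}
    (h : x ∉ Q.toSet ∨ y ∉ Q.toSet) : S.kernel Q x y = 0 := by
  unfold kernel
  refine finsum_mem_eq_zero_of_forall_eq_zero fun Q' hQ' =>
    finsum_mem_eq_zero_of_forall_eq_zero fun R' hR' => ?_
  rcases h with h | h
  · rw [S.k_eq_zero hQ hQ' hR' fun hx => h (hQ'.2.2 hx), zero_mul]
  · rw [S.h_eq_zero hQ hQ' hR' fun hx => h (hR'.2.2 hx), map_zero, mul_zero]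

-- Haar functions vanish off their cubes, so only the descendant that contains $x$ and the one that
-- contains $y$ survive in the double sum.
open Classical in
theorem kernel_eq {Q : Cube d} (hQ : Q ∈ D.cubes) {x y : Fin d → ℝ}
    (hx : x ∈ Q.toSet) (hy : y ∈ Q.toSet) : S.kernel Q x y =
      S.k (D.cubeAt (Q.scale - n) y) (D.cubeAt (Q.scale - m) x) x *
        (starRingEnd ℂ) (S.h (D.cubeAt (Q.scale - m) x) (D.cubeAt (Q.scale - n) y) y) := by
  unfold kernel
  have hxm := D.cubeAt_mem_descendants hQ m hx
  have hyn := D.cubeAt_mem_descendants hQ n hy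
  rw [finsum_eq_single _ (D.cubeAt (Q.scale - m) x), finsum_eq_if, if_pos hxm,
    finsum_eq_single _ (D.cubeAt (Q.scale - n) y), finsum_eq_if, if_pos hyn]
  · intro R' hR'
    rw [finsum_eq_if]
    split_ifs with h
    · rw [S.h_eq_zero hQ hxm h fun hh => hR' (D.eq_cubeAt_of_mem_descendants hQ h hh), map_zero,
        mul_zero]
    · rfl
  · intro Q' hQ'
    rw [finsum_eq_if]
    split_ifs with h
    · refine finsum_mem_eq_zero_of_forall_eq_zero fun R' hR' => ?_
      rw [S.k_eq_zero hQ h hR' fun hh => hQ' (D.eq_cubeAt_of_mem_descendants hQ h hh), zero_mul]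
    · rfl

theorem norm_kernel_le {Q : Cube d} (hQ : Q ∈ D.cubes) (x y : Fin d → ℝ) :
    ‖S.kernel Q x y‖ ≤ 1 := by
  by_cases h : x ∈ Q.toSet ∧ y ∈ Q.toSet
  · rw [S.kernel_eq hQ h.1 h.2, norm_mul, RCLike.norm_conj]
    exact mul_le_one₀ (S.k_le Q hQ _ (D.cubeAt_mem_descendants hQ m h.1) _
      (D.cubeAt_mem_descendants hQ n h.2) x) (norm_nonneg _)
      (S.h_le Q hQ _ (D.cubeAt_mem_descendants hQ m h.1) _
      (D.cubeAt_mem_descendants hQ n h.2) y)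
  · rw [S.kernel_eq_zero hQ (by tauto)]; simp

theorem _root_.HaarShift.IsGeneralizedHaar.eq_of_cubeAt_eq {R : Cube d} (hR : R ∈ D.cubes)
    {h : (Fin d → ℝ) → ℂ} (hh : IsGeneralizedHaar D R h) {j : ℤ} (hj : j + 1 ≤ R.scale)
    {x y : Fin d → ℝ} (hxy : D.cubeAt j x = D.cubeAt j y) : h x = h y := by
  obtain ⟨c, h1, h2⟩ := hh
  have hR' : x ∈ R.toSet ↔ y ∈ R.toSet := by
    have := D.cubeAt_mono (k := R.scale) (by omega) hxy
    constructor
    · intro hx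
      rw [D.cubeAt_scale_eq hR hx] at this
      rw [this]; exact D.mem_cubeAt _ _
    · intro hx
      rw [D.cubeAt_scale_eq hR hx] at this
      rw [← this]; exact D.mem_cubeAt _ _
  by_cases hx : x ∈ R.toSet
  · have e := D.cubeAt_mono (k := R.scale - 1) (by omega) hxy
    have hdx := D.cubeAt_mem_descendants hR 1 hx
    simp only [Nat.cast_one] at hdx
    rw [h1 _ hdx x (D.mem_cubeAt _ _), h1 _ hdx y (by rw [e]; exact D.mem_cubeAt _ _)]
  · rw [h2 x hx, h2 y (by tauto)]

/-- The kernel of `∑_{ℓ(Q) = 2^k} S_Q`. -/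
def scaleKernel (k : ℤ) (x y : Fin d → ℝ) : ℂ :=
  ((((2 : ℝ) ^ k) ^ d : ℝ) : ℂ)⁻¹ * S.kernel (D.cubeAt k x) x y

/-- The finest sets that $s_Q$ distinguishes are children of cubes at most $\kappa$ generations
below $Q$; this is where the $+1$ in `j + κ + 1` comes from. -/
theorem kernel_const {k j : ℤ} {κ : ℕ} (hm : m ≤ κ) (hn : n ≤ κ) {x x' y y' : Fin d → ℝ}
    (hjk : j + κ + 1 ≤ k)
    (hx : D.cubeAt j x = D.cubeAt j x') (hy : D.cubeAt j y = D.cubeAt j y') :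
    S.kernel (D.cubeAt k x) x y = S.kernel (D.cubeAt k x') x' y' := by
  have hQ := D.cubeAt_mem k x
  have ex := D.cubeAt_mono (k := k) (by omega) hx
  have ey := D.cubeAt_mono (k := k) (by omega) hy
  have exm := D.cubeAt_mono (k := k - m) (by omega) hx
  have eyn := D.cubeAt_mono (k := k - n) (by omega) hy
  rw [← ex]
  have hxQ := D.mem_cubeAt k x
  have hxQ' : x' ∈ (D.cubeAt k x).toSet := by rw [ex]; exact D.mem_cubeAt k x'
  have hiff : y ∈ (D.cubeAt k x).toSet ↔ y' ∈ (D.cubeAt k x).toSet := by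
    rw [D.mem_cubeAt_iff, D.mem_cubeAt_iff, ey]
  by_cases hyQ : y ∈ (D.cubeAt k x).toSet
  · rw [S.kernel_eq hQ hxQ hyQ, S.kernel_eq hQ hxQ' (hiff.1 hyQ)]
    simp only [DyadicGrid.scale_cubeAt]
    have d1 := D.cubeAt_mem_descendants hQ m hxQ
    have d2 := D.cubeAt_mem_descendants hQ n hyQ
    simp only [DyadicGrid.scale_cubeAt] at d1 d2
    rw [← exm, ← eyn]
    congr 1
    · exact (S.k_haar _ hQ _ d1 _ d2).eq_of_cubeAt_eq (D.cubeAt_mem _ _) (by simp; omega) hx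
    · congr 1
      exact (S.h_haar _ hQ _ d1 _ d2).eq_of_cubeAt_eq (D.cubeAt_mem _ _) (by simp; omega) hy
  · rw [S.kernel_eq_zero hQ (Or.inr hyQ), S.kernel_eq_zero hQ (Or.inr (hiff.not.1 hyQ))]

theorem localKernel_scaleKernel {κ : ℕ} (hm : m ≤ κ) (hn : n ≤ κ) :
    LocalKernel D κ S.scaleKernel where
  zero k x y h := by
    rw [scaleKernel, S.kernel_eq_zero (D.cubeAt_mem k x), mul_zero]
    right
    rw [D.mem_cubeAt_iff]
    exact fun h' => h h'.symm
  bound k x y := by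
    rw [scaleKernel, norm_mul, norm_inv, Complex.norm_real, Real.norm_of_nonneg (by positivity)]
    exact mul_le_of_le_one_right (by positivity) (S.norm_kernel_le (D.cubeAt_mem k x) x y)
  const k j x x' y y' h hx hy := by
    rw [scaleKernel, scaleKernel, S.kernel_const hm hn h hx hy]

end GeneralizedShift

/-! ### Truncations, adjoints and the $L^2$ hypothesis written scale by scale. -/

/-- The integral operator with kernel `a`. -/
def kernelOp (a : (Fin d → ℝ) → (Fin d → ℝ) → ℂ) (f : (Fin d → ℝ) → ℂ) (x : Fin d → ℝ) : ℂ :=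
  ∫ y, a x y * f y

theorem GeneralizedShift.component_cubeAt {D : DyadicGrid d} {m n : ℕ}
    (S : GeneralizedShift D m n) (k : ℤ) (f : (Fin d → ℝ) → ℂ) (x : Fin d → ℝ) :
    S.component (D.cubeAt k x) f x = kernelOp (S.scaleKernel k) f x := by
  simp only [component, kernelOp, scaleKernel, Cube.vol, D.cubeAt_side, mul_assoc]
  rw [integral_const_mul]

theorem GeneralizedShift.truncation_eq_sum {D : DyadicGrid d} {m n : ℕ}
    (S : GeneralizedShift D m n) (a b : ℝ) (s : Finset ℤ)
    (hs : ∀ k : ℤ, k ∈ s ↔ a ≤ (2 : ℝ) ^ k ∧ (2 : ℝ) ^ k ≤ b) (f : (Fin d → ℝ) → ℂ)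
    (x : Fin d → ℝ) :
    S.truncation a b f x = ∑ k ∈ s, kernelOp (S.scaleKernel k) f x := by
  rw [truncation, D.finsum_cubes_eq_sum _ x _ a b s hs]
  · simp_rw [S.component_cubeAt]
  · intro Q hQ hx
    simp [component, S.kernel_eq_zero hQ (Or.inl hx)]

theorem mem_Icc_iff_zpow (N : ℕ) (k : ℤ) : k ∈ Finset.Icc (-(N : ℤ)) N ↔
    (2 : ℝ) ^ (-(N : ℤ)) ≤ (2 : ℝ) ^ k ∧ (2 : ℝ) ^ k ≤ (2 : ℝ) ^ (N : ℤ) := by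
  rw [Finset.mem_Icc, zpow_le_zpow_iff_right₀ (by norm_num), zpow_le_zpow_iff_right₀ (by norm_num)]

namespace Linearization

/-- The function `1_{ε(x) ≤ 2^k ≤ υ(x)} e^{iϑ(x)} g(x)`. -/
def cutoff (L : Linearization d) (k : ℤ) (g : (Fin d → ℝ) → ℂ) (x : Fin d → ℝ) : ℂ :=
  Set.indicator {x | L.ε x ≤ (2 : ℝ) ^ k ∧ (2 : ℝ) ^ k ≤ L.υ x}
    (fun x => Complex.exp (L.ϑ x * Complex.I) * g x) x

/-- The scale-by-scale adjoint: the operator with kernel `a k x y`, transposed and applied to the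
cut-off function. -/
def adjointScale (L : Linearization d) (a : ℤ → (Fin d → ℝ) → (Fin d → ℝ) → ℂ) (k : ℤ)
    (g : (Fin d → ℝ) → ℂ) (y : Fin d → ℝ) : ℂ :=
  ∫ x, a k x y * L.cutoff k g x

variable {D : DyadicGrid d} {m n : ℕ}

theorem adjointTerm_cubeAt (L : Linearization d) (S : GeneralizedShift D m n) (k : ℤ)
    (g : (Fin d → ℝ) → ℂ) (y : Fin d → ℝ) :
    L.adjointTerm S (D.cubeAt k y) g y = L.adjointScale S.scaleKernel k g y := by
  unfold adjointTerm adjointScale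
  rw [← integral_const_mul, ← integral_indicator (Cube.measurableSet_toSet _)]
  congr 1
  ext x
  by_cases hx : x ∈ (D.cubeAt k y).toSet
  · rw [Set.indicator_of_mem hx]
    simp only [GeneralizedShift.scaleKernel, cutoff, Cube.vol, D.cubeAt_side, mul_assoc]
    rw [D.mem_cubeAt_iff.1 hx]
  · rw [Set.indicator_of_notMem hx, GeneralizedShift.scaleKernel,
      S.kernel_eq_zero (D.cubeAt_mem k x)]
    · simp
    · right
      rw [D.mem_cubeAt_iff] at hx ⊢
      exact fun h => hx h.symm

theorem adjointPartial_eq_sum (L : Linearization d) (S : GeneralizedShift D m n) (N : ℕ)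
    (g : (Fin d → ℝ) → ℂ) (y : Fin d → ℝ) :
    L.adjointPartial S N g y =
      ∑ k ∈ Finset.Icc (-(N : ℤ)) N, L.adjointScale S.scaleKernel k g y := by
  rw [adjointPartial, D.finsum_cubes_eq_sum _ y _ _ _ _ (mem_Icc_iff_zpow N)]
  · simp_rw [L.adjointTerm_cubeAt]
  · intro Q hQ hy
    simp [adjointTerm, S.kernel_eq_zero hQ (Or.inr hy)]

end Linearization

/-- `L²` boundedness of the sum of the scale operators with kernels `a k`. -/
def KernelL2Bounded (a : ℤ → (Fin d → ℝ) → (Fin d → ℝ) → ℂ) (B : ℝ≥0) : Prop :=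
  ∀ f : (Fin d → ℝ) → ℂ, MemLp f 2 volume → ∃ g : (Fin d → ℝ) → ℂ, MemLp g 2 volume ∧
    Tendsto (fun N : ℕ => eLpNorm
      (fun x => ∑ k ∈ Finset.Icc (-(N : ℤ)) N, kernelOp (a k) f x - g x) 2 volume)
      atTop (𝓝 0) ∧
    eLpNorm g 2 volume ≤ B * eLpNorm f 2 volume

theorem GeneralizedShift.L2Bounded.kernelL2Bounded {D : DyadicGrid d} {m n : ℕ}
    {S : GeneralizedShift D m n} {B : ℝ≥0} (h : S.L2Bounded B) :
    KernelL2Bounded S.scaleKernel B := by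
  intro f hf
  obtain ⟨g, h1, h2, h3⟩ := h f hf
  refine ⟨g, h1, ?_, h3⟩
  simpa only [S.truncation_eq_sum _ _ _ (mem_Icc_iff_zpow _)] using h2

/-! ### Sparse families and power integrals of sparse functions. -/

/-- A rule that assigns to every cube of the grid a disjoint family of subcubes in the grid that
cover at most half of it. -/
structure IsSparse (D : DyadicGrid d) (ch : Cube d → Set (Cube d)) : Prop where
  mem : ∀ R ∈ D.cubes, ∀ P ∈ ch R, P ∈ D.cubes
  subset : ∀ R ∈ D.cubes, ∀ P ∈ ch R, P.toSet ⊆ R.toSet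
  disjoint : ∀ R ∈ D.cubes, (ch R).PairwiseDisjoint Cube.toSet
  volume_le : ∀ R ∈ D.cubes, ∑' P : ch R, volume P.1.toSet ≤ volume R.toSet / 2

/-- The sparse function `∑ c(P) 1_P`, the sum being over the first `K` generations of the
descendants of `R` under the rule `ch`. -/
def sparseSum (ch : Cube d → Set (Cube d)) (c : Cube d → ℝ≥0∞) :
    ℕ → Cube d → (Fin d → ℝ) → ℝ≥0∞
  | 0, _, _ => 0
  | K + 1, R, x => R.toSet.indicator (fun _ => c R) x + ∑' P : ch R, sparseSum ch c K P.1 x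

/-- The sum `∑ F(P)` over the first `K` generations of the descendants of `R`. -/
def sparseTotal (ch : Cube d → Set (Cube d)) (F : Cube d → ℝ≥0∞) : ℕ → Cube d → ℝ≥0∞
  | 0, _ => 0
  | K + 1, R => F R + ∑' P : ch R, sparseTotal ch F K P.1

theorem tsum_rpow_mul_rpow_le {ι : Type*} (f g : ι → ℝ≥0∞) {s t : ℝ} (hs : 0 ≤ s) (ht : 0 ≤ t)
    (hst : s + t = 1) :
    ∑' i, f i ^ s * g i ^ t ≤ (∑' i, f i) ^ s * (∑' i, g i) ^ t := by
  let _ : MeasurableSpace ι := ⊤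
  have := ENNReal.lintegral_mul_norm_pow_le (μ := Measure.count) (f := f) (g := g)
    (measurable_from_top.aemeasurable) (measurable_from_top.aemeasurable) hs ht hst
  simpa [lintegral_count] using this

theorem tsum_rpow_of_subsingleton {ι : Type*} (f : ι → ℝ≥0∞) {r : ℝ} (hr : 0 < r)
    (h : ∀ i j, f i ≠ 0 → f j ≠ 0 → i = j) : (∑' i, f i) ^ r = ∑' i, f i ^ r := by
  by_cases h0 : ∀ i, f i = 0
  · simp [h0, hr]
  · push Not at h0
    obtain ⟨i, hi⟩ := h0
    have hj : ∀ j, j ≠ i → f j = 0 := fun j hj => by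
      by_contra hne; exact hj (h j i hne hi)
    rw [tsum_eq_single i hj, tsum_eq_single i]
    intro j hji
    simp [hj j hji, hr]

/-- Bernoulli's inequality for $F=(a+F)(1-\frac a{a+F})$. It is the convexity step that peels the
top cube off a sparse sum. -/
theorem add_rpow_le_rpow_add_mul (a F : ℝ≥0∞) {r : ℝ} (hr : 1 ≤ r) :
    (a + F) ^ r ≤ F ^ r + ENNReal.ofReal r * a * (a + F) ^ (r - 1) := by
  by_cases hF : F = ∞
  · simp [hF, ENNReal.top_rpow_of_pos (by linarith : 0 < r)]
  by_cases ha : a = ∞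
  · have hr0 : ENNReal.ofReal r ≠ 0 := by simp; linarith
    have : (∞ : ℝ≥0∞) ^ (r - 1) ≠ 0 := by
      rcases hr.eq_or_lt with h | h
      · simp [← h]
      · simp [ENNReal.top_rpow_of_pos (by linarith : 0 < r - 1)]
    rw [ha, ENNReal.mul_top hr0, top_add, ENNReal.top_mul this]
    simp
  lift F to ℝ≥0 using hF
  lift a to ℝ≥0 using ha
  by_cases hs : a + F = 0
  · have : a = 0 ∧ F = 0 := by simpa using hs
    rw [this.1, this.2]; simp [show 0 < r by linarith]
  rw [← ENNReal.coe_add, ← ENNReal.coe_rpow_of_nonneg _ (by linarith),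
    ← ENNReal.coe_rpow_of_nonneg _ (by linarith), ← ENNReal.coe_rpow_of_nonneg _ (by linarith),
    ENNReal.ofReal, ← ENNReal.coe_mul, ← ENNReal.coe_mul, ← ENNReal.coe_add, ENNReal.coe_le_coe,
    ← NNReal.coe_le_coe]
  push_cast
  rw [Real.coe_toNNReal r (by linarith)]
  have hpos : (0 : ℝ) < a + F := by
    have : 0 < a + F := pos_iff_ne_zero.2 hs
    exact_mod_cast this
  have hF : (F : ℝ) = (a + F) * (1 + -(a / (a + F))) := by field_simp; ring
  have hle : (a : ℝ) / (a + F) ≤ 1 := (div_le_one hpos).2 (by linarith [F.2])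
  have hb := one_add_mul_self_le_rpow_one_add (s := -((a : ℝ) / (a + F))) (by linarith) hr
  have h1 : (F : ℝ) ^ r = (a + F : ℝ) ^ r * (1 + -((a : ℝ) / (a + F))) ^ r := by
    rw [← Real.mul_rpow hpos.le (by linarith), ← hF]
  have h2 : (a + F : ℝ) ^ r = (a + F : ℝ) ^ (r - 1) * (a + F) := by
    rw [← Real.rpow_add_one hpos.ne']; ring_nf
  have h3 := mul_le_mul_of_nonneg_left hb (Real.rpow_nonneg hpos.le r)
  rw [← h1] at h3
  have h4 : (a + F : ℝ) ^ r * (1 + r * -(a / (a + F))) =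
      (a + F : ℝ) ^ r - r * a * (a + F) ^ (r - 1) := by
    rw [h2]; field_simp; ring
  linarith

section General

variable {D : DyadicGrid d} {ch : Cube d → Set (Cube d)}

theorem sparseSum_eq_zero (hS : IsSparse D ch) (c : Cube d → ℝ≥0∞) (K : ℕ) {R : Cube d}
    (hR : R ∈ D.cubes) {x : Fin d → ℝ} (hx : x ∉ R.toSet) : sparseSum ch c K R x = 0 := by
  induction K generalizing R with
  | zero => rfl
  | succ K ih =>
    rw [sparseSum, Set.indicator_of_notMem hx, zero_add, ENNReal.tsum_eq_zero]
    exact fun P => ih (hS.mem R hR _ P.2) fun h => hx (hS.subset R hR _ P.2 h)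

theorem measurable_sparseSum (hS : IsSparse D ch) (c : Cube d → ℝ≥0∞) (K : ℕ) {R : Cube d}
    (hR : R ∈ D.cubes) : Measurable (sparseSum ch c K R) := by
  induction K generalizing R with
  | zero => exact measurable_const
  | succ K ih =>
    have := (D.countable_subset (hS.mem R hR)).to_subtype
    exact (measurable_const.indicator R.measurableSet_toSet).add
      (Measurable.tsum fun P => ih (hS.mem R hR _ P.2))

theorem lintegral_sparseSum (hS : IsSparse D ch) (μ : Measure (Fin d → ℝ)) (c : Cube d → ℝ≥0∞)
    (K : ℕ) {R : Cube d} (hR : R ∈ D.cubes) :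
    ∫⁻ x, sparseSum ch c K R x ∂μ = sparseTotal ch (fun P => c P * μ P.toSet) K R := by
  induction K generalizing R with
  | zero => simp [sparseSum, sparseTotal]
  | succ K ih =>
    have := (D.countable_subset (hS.mem R hR)).to_subtype
    simp only [sparseSum, sparseTotal]
    rw [lintegral_add_left (measurable_const.indicator R.measurableSet_toSet),
      lintegral_tsum fun P => (measurable_sparseSum hS c K (hS.mem R hR _ P.2)).aemeasurable,
      lintegral_indicator_const R.measurableSet_toSet]
    congr 1
    exact tsum_congr fun P => ih (hS.mem R hR _ P.2)

theorem sparseTotal_mono (hS : IsSparse D ch) {F G : Cube d → ℝ≥0∞}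
    (h : ∀ P ∈ D.cubes, F P ≤ G P) (K : ℕ) {R : Cube d} (hR : R ∈ D.cubes) :
    sparseTotal ch F K R ≤ sparseTotal ch G K R := by
  induction K generalizing R with
  | zero => exact le_rfl
  | succ K ih =>
    exact add_le_add (h R hR) (ENNReal.tsum_le_tsum fun P => ih (hS.mem R hR _ P.2))

theorem sparseTotal_const_mul (ch : Cube d → Set (Cube d)) (a : ℝ≥0∞) (F : Cube d → ℝ≥0∞) (K : ℕ)
    (R : Cube d) : sparseTotal ch (fun P => a * F P) K R = a * sparseTotal ch F K R := by
  induction K generalizing R with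
  | zero => simp [sparseTotal]
  | succ K ih => simp only [sparseTotal, ih, ENNReal.tsum_mul_left, mul_add]

/-- A geometric series: the hypothesis on `C` is what the induction from one generation to the next
reproduces, and $1/(1-\theta)$ satisfies it. -/
theorem sparseTotal_le_of_decay (hS : IsSparse D ch) {F : Cube d → ℝ≥0∞} {θ C : ℝ≥0∞}
    (hC : 1 + C * θ ≤ C) (hF : ∀ R ∈ D.cubes, ∑' P : ch R, F P.1 ≤ θ * F R) (K : ℕ) {R : Cube d}
    (hR : R ∈ D.cubes) : sparseTotal ch F K R ≤ C * F R := by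
  induction K generalizing R with
  | zero => exact zero_le
  | succ K ih =>
    calc sparseTotal ch F (K + 1) R ≤ F R + ∑' P : ch R, C * F P.1 :=
          add_le_add le_rfl (ENNReal.tsum_le_tsum fun P => ih (hS.mem R hR _ P.2))
      _ ≤ F R + C * (θ * F R) := by
          rw [ENNReal.tsum_mul_left]; gcongr; exact hF R hR
      _ = (1 + C * θ) * F R := by ring
      _ ≤ C * F R := by gcongr

theorem sparseSum_subsingleton (hS : IsSparse D ch) (c : Cube d → ℝ≥0∞) (K : ℕ) {R : Cube d}
    (hR : R ∈ D.cubes) (x : Fin d → ℝ) (P P' : ch R) (h : sparseSum ch c K P.1 x ≠ 0)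
    (h' : sparseSum ch c K P'.1 x ≠ 0) : P = P' := by
  have hx : x ∈ P.1.toSet := by
    by_contra hx; exact h (sparseSum_eq_zero hS c K (hS.mem R hR _ P.2) hx)
  have hx' : x ∈ P'.1.toSet := by
    by_contra hx; exact h' (sparseSum_eq_zero hS c K (hS.mem R hR _ P'.2) hx)
  by_contra hne
  exact Set.disjoint_left.1 (hS.disjoint R hR P.2 P'.2 fun h => hne (Subtype.ext h)) hx hx'

/-- Subadditivity of $z\mapsto z^r$ separates the top cube; the sums over different children have
disjoint supports, so the power passes inside them. -/
theorem lintegral_sparseSum_rpow_le_of_le_one (hS : IsSparse D ch) (μ : Measure (Fin d → ℝ))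
    (c : Cube d → ℝ≥0∞) {r : ℝ} (hr : 0 < r) (hr1 : r ≤ 1) (K : ℕ) {R : Cube d}
    (hR : R ∈ D.cubes) : ∫⁻ x, sparseSum ch c K R x ^ r ∂μ ≤
      sparseTotal ch (fun P => c P ^ r * μ P.toSet) K R := by
  induction K generalizing R with
  | zero => simp [sparseSum, sparseTotal, hr]
  | succ K ih =>
    have := (D.countable_subset (hS.mem R hR)).to_subtype
    simp only [sparseSum, sparseTotal]
    have hm : ∀ P : ch R, Measurable fun x => sparseSum ch c K P.1 x ^ r := fun P =>
      (measurable_sparseSum hS c K (hS.mem R hR _ P.2)).pow_const r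
    calc ∫⁻ x, (R.toSet.indicator (fun _ => c R) x + ∑' P : ch R, sparseSum ch c K P.1 x) ^ r ∂μ
        ≤ ∫⁻ x, R.toSet.indicator (fun _ => c R ^ r) x +
            ∑' P : ch R, sparseSum ch c K P.1 x ^ r ∂μ := by
          refine lintegral_mono fun x => ?_
          refine (ENNReal.rpow_add_le_add_rpow _ _ hr.le hr1).trans ?_
          rw [tsum_rpow_of_subsingleton _ hr (sparseSum_subsingleton hS c K hR x)]
          gcongr
          by_cases hx : x ∈ R.toSet <;> simp [hx, hr]
      _ ≤ _ := by
          rw [lintegral_add_left (measurable_const.indicator R.measurableSet_toSet),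
            lintegral_tsum fun P => (hm P).aemeasurable,
            lintegral_indicator_const R.measurableSet_toSet]
          gcongr with P
          exact ih (hS.mem R hR _ P.2)

/-- A discrete integration by parts: each cube pays $r\,c(R)\int(\cdot)^{r-1}$, and the $r$-th
powers that remain belong to its children. An $r$-th moment is thus reduced to moments of order
$r-1$. -/
theorem lintegral_sparseSum_rpow_le_of_one_lt (hS : IsSparse D ch) (μ : Measure (Fin d → ℝ))
    (c : Cube d → ℝ≥0∞) {r : ℝ} (hr : 1 < r) (F : Cube d → ℝ≥0∞)
    (hF : ∀ K, ∀ R ∈ D.cubes,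
      ENNReal.ofReal r * c R * ∫⁻ x, sparseSum ch c K R x ^ (r - 1) ∂μ ≤ F R) (K : ℕ)
    {R : Cube d} (hR : R ∈ D.cubes) :
    ∫⁻ x, sparseSum ch c K R x ^ r ∂μ ≤ sparseTotal ch F K R := by
  have hr0 : 0 < r := by linarith
  induction K generalizing R with
  | zero => simp [sparseSum, sparseTotal, hr0]
  | succ K ih =>
    have := (D.countable_subset (hS.mem R hR)).to_subtype
    have hm : ∀ P : ch R, Measurable fun x => sparseSum ch c K P.1 x ^ r := fun P =>
      (measurable_sparseSum hS c K (hS.mem R hR _ P.2)).pow_const r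
    calc ∫⁻ x, sparseSum ch c (K + 1) R x ^ r ∂μ
        ≤ ∫⁻ x, ENNReal.ofReal r * c R * sparseSum ch c (K + 1) R x ^ (r - 1) +
            ∑' P : ch R, sparseSum ch c K P.1 x ^ r ∂μ := by
          refine lintegral_mono fun x => ?_
          by_cases hx : x ∈ R.toSet
          · simp only [sparseSum, Set.indicator_of_mem hx]
            rw [← tsum_rpow_of_subsingleton _ hr0 (sparseSum_subsingleton hS c K hR x)]
            exact (add_rpow_le_rpow_add_mul _ _ hr.le).trans (add_comm _ _).le
          · simp [sparseSum_eq_zero hS c _ hR hx, hr0]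
      _ ≤ _ := by
          rw [lintegral_add_left (((measurable_sparseSum hS c (K + 1) hR).pow_const _).const_mul _),
            lintegral_tsum fun P => (hm P).aemeasurable, lintegral_const_mul _
              ((measurable_sparseSum hS c (K + 1) hR).pow_const _), sparseTotal]
          gcongr with P
          · exact hF (K + 1) R hR
          · exact ih (hS.mem R hR _ P.2)

end General

/-! ### Dual pairs of measures and the $A_p$ bounds for sparse sums. -/

/-- A pair of measures that obeys the `A_p` condition with constant `A` on the cubes of a dyadic
grid, together with the consequence of Hölder's inequality that dual weights enjoy. -/
structure ApPair (D : DyadicGrid d) (μ ν : Measure (Fin d → ℝ)) (p : ℝ) (A : ℝ≥0∞) : Prop where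
  left_ne_zero : ∀ Q ∈ D.cubes, μ Q.toSet ≠ 0
  left_ne_top : ∀ Q ∈ D.cubes, μ Q.toSet ≠ ∞
  right_ne_zero : ∀ Q ∈ D.cubes, ν Q.toSet ≠ 0
  right_ne_top : ∀ Q ∈ D.cubes, ν Q.toSet ≠ ∞
  mul_le : ∀ Q ∈ D.cubes, μ Q.toSet * ν Q.toSet ^ (p - 1) ≤ A * volume Q.toSet ^ p
  le_mul : ∀ E, MeasurableSet E → volume E ^ p ≤ μ E * ν E ^ (p - 1)

namespace ApPair

variable {D : DyadicGrid d} {μ ν : Measure (Fin d → ℝ)} {p : ℝ} {A : ℝ≥0∞}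
  {ch : Cube d → Set (Cube d)}

/-- Raise both inequalities to the power $q-1$ and use $(p-1)(q-1)=1$. Every later estimate may thus
be applied with the two weights exchanged. -/
theorem symm (h : ApPair D μ ν p A) {q : ℝ} (hpq : p.HolderConjugate q) :
    ApPair D ν μ q (A ^ (q - 1)) where
  left_ne_zero := h.right_ne_zero
  left_ne_top := h.right_ne_top
  right_ne_zero := h.left_ne_zero
  right_ne_top := h.left_ne_top
  mul_le Q hQ := by
    have h1 := ENNReal.rpow_le_rpow (h.mul_le Q hQ) hpq.symm.sub_one_pos.le
    rw [ENNReal.mul_rpow_of_nonneg _ _ hpq.symm.sub_one_pos.le,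
      ENNReal.mul_rpow_of_nonneg _ _ hpq.symm.sub_one_pos.le, ← ENNReal.rpow_mul,
      ← ENNReal.rpow_mul] at h1
    have e1 : (p - 1) * (q - 1) = 1 := by
      have := hpq.mul_eq_add; linarith
    have e2 : p * (q - 1) = q := by
      have := hpq.mul_eq_add; linarith
    rw [e1, e2, ENNReal.rpow_one, mul_comm] at h1
    exact h1
  le_mul E hE := by
    have h1 := ENNReal.rpow_le_rpow (h.le_mul E hE) hpq.symm.sub_one_pos.le
    rw [ENNReal.mul_rpow_of_nonneg _ _ hpq.symm.sub_one_pos.le, ← ENNReal.rpow_mul,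
      ← ENNReal.rpow_mul] at h1
    have e1 : (p - 1) * (q - 1) = 1 := by
      have := hpq.mul_eq_add; linarith
    have e2 : p * (q - 1) = q := by
      have := hpq.mul_eq_add; linarith
    rw [e1, e2, ENNReal.rpow_one, mul_comm] at h1
    exact h1

/-- The average of `μ` over `Q` is at most `A (|Q| / ν(Q))^{p-1}`. -/
theorem average_le (h : ApPair D μ ν p A) (hp : 1 < p) {Q : Cube d} (hQ : Q ∈ D.cubes) :
    μ Q.toSet / volume Q.toSet ≤ A * (volume Q.toSet / ν Q.toSet) ^ (p - 1) := by
  have hp' : 0 < p - 1 := by linarith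
  have hv0 := Q.volume_ne_zero
  have hvt := Q.volume_ne_top
  have hn0 := h.right_ne_zero Q hQ
  have hnt := h.right_ne_top Q hQ
  have h1 := h.mul_le Q hQ
  rw [ENNReal.div_rpow_of_nonneg _ _ hp'.le]
  have hn0' : ν Q.toSet ^ (p - 1) ≠ 0 := by simp [hn0, hnt]
  have hnt' : ν Q.toSet ^ (p - 1) ≠ ∞ := ENNReal.rpow_ne_top_of_nonneg hp'.le hnt
  rw [ENNReal.div_le_iff hv0 hvt, ← mul_div_assoc, ← ENNReal.mul_div_right_comm,
    ENNReal.le_div_iff_mul_le (Or.inl hn0') (Or.inl hnt')]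
  refine h1.trans (le_of_eq ?_)
  rw [mul_assoc]
  congr 1
  nth_rw 3 [← ENNReal.rpow_one (volume Q.toSet)]
  rw [← ENNReal.rpow_add _ _ hv0 hvt]
  ring_nf

theorem volume_half_le (hS : IsSparse D ch) {R : Cube d} (hR : R ∈ D.cubes) :
    volume R.toSet ≤ 2 * volume (R.toSet \ ⋃ P ∈ ch R, P.toSet) := by
  have hcount := D.countable_subset (hS.mem R hR)
  have hm : MeasurableSet (⋃ P ∈ ch R, P.toSet) :=
    MeasurableSet.biUnion hcount fun P _ => P.measurableSet_toSet
  have hu : volume (⋃ P ∈ ch R, P.toSet) ≤ volume R.toSet / 2 := by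
    rw [measure_biUnion hcount (hS.disjoint R hR) fun P _ => P.measurableSet_toSet]
    exact hS.volume_le R hR
  have hsub : (⋃ P ∈ ch R, P.toSet) ⊆ R.toSet := Set.iUnion₂_subset (hS.subset R hR)
  have hut : volume (⋃ P ∈ ch R, P.toSet) ≠ ∞ := measure_ne_top_of_subset hsub R.volume_ne_top
  rw [measure_sdiff hsub hm.nullMeasurableSet hut]
  calc volume R.toSet = 2 * (volume R.toSet - volume R.toSet / 2) := by
        rw [ENNReal.sub_half R.volume_ne_top, ENNReal.mul_div_cancel (by simp) (by simp)]
    _ ≤ _ := by gcongr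

/-- The set left over by the children carries a fixed proportion of the measure `μ`. -/
theorem measure_le (h : ApPair D μ ν p A) (hp : 1 < p) (hS : IsSparse D ch) {R : Cube d}
    (hR : R ∈ D.cubes) :
    μ R.toSet ≤ 2 ^ p * A * μ (R.toSet \ ⋃ P ∈ ch R, P.toSet) := by
  have hp' : 0 < p - 1 := by linarith
  have hp0 : 0 < p := by linarith
  set E := R.toSet \ ⋃ P ∈ ch R, P.toSet with hE
  have hm : MeasurableSet E := R.measurableSet_toSet.diff
    (MeasurableSet.biUnion (D.countable_subset (hS.mem R hR)) fun P _ => P.measurableSet_toSet)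
  have hv0 : volume R.toSet ^ p ≠ 0 := by simp [R.volume_ne_zero, hp0.le]
  have hvt : volume R.toSet ^ p ≠ ∞ := ENNReal.rpow_ne_top_of_nonneg hp0.le R.volume_ne_top
  have h1 : volume R.toSet ^ p ≤ 2 ^ p * (μ E * ν R.toSet ^ (p - 1)) := by
    calc volume R.toSet ^ p ≤ (2 * volume E) ^ p := by
          gcongr; exact volume_half_le hS hR
      _ = 2 ^ p * volume E ^ p := ENNReal.mul_rpow_of_nonneg _ _ hp0.le
      _ ≤ 2 ^ p * (μ E * ν E ^ (p - 1)) := by gcongr; exact h.le_mul E hm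
      _ ≤ _ := by
        have : ν E ≤ ν R.toSet := measure_mono Set.sdiff_subset
        gcongr
  -- The factor $|R|^p$ is bounded by Hölder on the left-over set $E$, with $|R|\le2|E|$; the
  -- resulting product $\mu(R)\nu(R)^{p-1}$ is then an $A_p$ quantity.
  refine (ENNReal.mul_le_mul_iff_left hv0 hvt).1 ?_
  calc μ R.toSet * volume R.toSet ^ p ≤ μ R.toSet * (2 ^ p * (μ E * ν R.toSet ^ (p - 1))) := by
        gcongr
    _ = 2 ^ p * μ E * (μ R.toSet * ν R.toSet ^ (p - 1)) := by ring
    _ ≤ 2 ^ p * μ E * (A * volume R.toSet ^ p) := mul_le_mul_right (h.mul_le R hR) _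
    _ = _ := by ring

/-- Each cube is charged to its left-over set. These sets are disjoint, and the induction refills
$R$ from its left-over set and its children. -/
theorem sparseTotal_measure_le (h : ApPair D μ ν p A) (hp : 1 < p) (hS : IsSparse D ch) (K : ℕ)
    {R : Cube d} (hR : R ∈ D.cubes) :
    sparseTotal ch (fun P => μ P.toSet) K R ≤ 2 ^ p * A * μ R.toSet := by
  induction K generalizing R with
  | zero => exact zero_le
  | succ K ih =>
    have hcount := D.countable_subset (hS.mem R hR)
    have hm : MeasurableSet (⋃ P ∈ ch R, P.toSet) :=
      MeasurableSet.biUnion hcount fun P _ => P.measurableSet_toSet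
    have hsub : (⋃ P ∈ ch R, P.toSet) ⊆ R.toSet := Set.iUnion₂_subset (hS.subset R hR)
    calc sparseTotal ch (fun P => μ P.toSet) (K + 1) R
        ≤ 2 ^ p * A * μ (R.toSet \ ⋃ P ∈ ch R, P.toSet) +
          ∑' P : ch R, 2 ^ p * A * μ P.1.toSet := by
          refine add_le_add (h.measure_le hp hS hR)
            (ENNReal.tsum_le_tsum fun P => ih (hS.mem R hR _ P.2))
      _ = 2 ^ p * A * μ R.toSet := by
          rw [ENNReal.tsum_mul_left, ← measure_biUnion hcount (hS.disjoint R hR)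
            fun P _ => P.measurableSet_toSet, ← mul_add,
            ← measure_union Set.disjoint_sdiff_left hm, Set.sdiff_union_of_subset hsub]

end ApPair

/-- The power sums of sparse families decay geometrically from one generation to the next. -/
theorem exists_sparseTotal_rpow_le {t : ℝ} (ht : 0 < t) (ht1 : t ≤ 1) :
    ∃ C : ℝ≥0, ∀ (D : DyadicGrid d) (ch : Cube d → Set (Cube d)), IsSparse D ch →
      ∀ ν : Measure (Fin d → ℝ), ∀ K, ∀ R ∈ D.cubes,
      sparseTotal ch (fun P => volume P.toSet ^ t * ν P.toSet ^ (1 - t)) K R ≤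
        C * (volume R.toSet ^ t * ν R.toSet ^ (1 - t)) := by
  obtain ⟨θ, hθ1, hθ⟩ : ∃ θ : ℝ≥0, θ < 1 ∧ (1 / 2 : ℝ≥0∞) ^ t = θ := by
    refine ⟨(1 / 2) ^ t, NNReal.rpow_lt_one ?_ ht, ?_⟩
    · rw [one_div]; exact inv_lt_one_of_one_lt₀ (by norm_num)
    · rw [ENNReal.coe_rpow_of_nonneg _ ht.le]; simp
  refine ⟨1 / (1 - θ), fun D ch hS ν K R hR => ?_⟩
  refine sparseTotal_le_of_decay hS (θ := θ) (C := ((1 / (1 - θ) : ℝ≥0) : ℝ≥0∞)) ?_ ?_ K hR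
  · rw [← ENNReal.coe_mul, ← ENNReal.coe_one, ← ENNReal.coe_add, ENNReal.coe_le_coe,
      ← NNReal.coe_le_coe]
    push_cast [hθ1.le]
    have : (0 : ℝ) < 1 - θ := by
      have : (θ : ℝ) < 1 := by exact_mod_cast hθ1
      linarith
    apply le_of_eq
    field_simp
    ring
  · intro Q hQ
    have hcount := D.countable_subset (hS.mem Q hQ)
    -- Hölder for sums with exponents $t$ and $1-t$; the halved volume gives the decay factor
    -- $\theta=2^{-t}$.
    calc ∑' P : ch Q, volume P.1.toSet ^ t * ν P.1.toSet ^ (1 - t)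
        ≤ (∑' P : ch Q, volume P.1.toSet) ^ t * (∑' P : ch Q, ν P.1.toSet) ^ (1 - t) :=
          tsum_rpow_mul_rpow_le _ _ ht.le (by linarith) (by ring)
      _ ≤ (1 / 2 * volume Q.toSet) ^ t * ν Q.toSet ^ (1 - t) := by
          gcongr
          · rw [one_div, mul_comm]
            exact hS.volume_le Q hQ
          · rw [← measure_biUnion hcount (hS.disjoint Q hQ) fun P _ => P.measurableSet_toSet]
            exact measure_mono (Set.iUnion₂_subset (hS.subset Q hQ))
      _ = θ * (volume Q.toSet ^ t * ν Q.toSet ^ (1 - t)) := by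
          rw [ENNReal.mul_rpow_of_nonneg _ _ ht.le, hθ, mul_assoc]

theorem div_rpow_mul_self {a b : ℝ≥0∞} (hb0 : b ≠ 0) (hbt : b ≠ ∞) {t : ℝ} (ht : 0 ≤ t) :
    (a / b) ^ t * b = a ^ t * b ^ (1 - t) := by
  rw [ENNReal.div_rpow_of_nonneg _ _ ht, ENNReal.rpow_sub _ _ hb0 hbt, ENNReal.rpow_one,
    div_eq_mul_inv, div_eq_mul_inv]
  ring

/-- Power integrals of the sparse function built from the averages of `μ`, with respect to the dual
measure `ν`, for exponents at most `q - 1`. -/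
theorem exists_lintegral_sparseSum_rpow_le {p q : ℝ} (hpq : p.HolderConjugate q) (n : ℕ) (r : ℝ)
    (hr : 0 < r) (hrn : r ≤ n) (hrq : r ≤ q - 1) :
    ∃ C : ℝ≥0, ∀ (D : DyadicGrid d) (ch : Cube d → Set (Cube d)), IsSparse D ch →
      ∀ (μ ν : Measure (Fin d → ℝ)) (A : ℝ≥0∞), ApPair D μ ν p A → ∀ K, ∀ R ∈ D.cubes,
      ∫⁻ x, sparseSum ch (fun P => μ P.toSet / volume P.toSet) K R x ^ r ∂ν ≤
        C * A ^ r * ((volume R.toSet / ν R.toSet) ^ ((p - 1) * r) * ν R.toSet) := by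
  have e1 : (p - 1) * (q - 1) = 1 := by
    have := hpq.mul_eq_add; linarith
  have hp1 := hpq.sub_one_pos
  -- The integer `n` only bounds the number of times that $r$ can be lowered by one before it
  -- reaches $(0,1]$.
  induction n generalizing r with
  | zero => exact absurd hrn (by simp [hr])
  | succ n ih =>
    have ht : 0 < (p - 1) * r := mul_pos hp1 hr
    -- The restriction $r\le q-1$ serves here: the power sums decay only for exponents in $(0,1]$.
    have ht1 : (p - 1) * r ≤ 1 := by
      exact (mul_le_mul_of_nonneg_left hrq hp1.le).trans e1.le
    obtain ⟨C₀, hC₀⟩ := exists_sparseTotal_rpow_le (d := d) ht ht1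
    rcases le_or_gt r 1 with h1 | h1
    · refine ⟨C₀, fun D ch hS μ ν A h K R hR => ?_⟩
      refine (lintegral_sparseSum_rpow_le_of_le_one hS ν _ hr h1 K hR).trans ?_
      calc sparseTotal ch (fun P => (μ P.toSet / volume P.toSet) ^ r * ν P.toSet) K R
          ≤ sparseTotal ch (fun P => A ^ r *
              (volume P.toSet ^ ((p - 1) * r) * ν P.toSet ^ (1 - (p - 1) * r))) K R := by
            refine sparseTotal_mono hS (fun P hP => ?_) K hR
            rw [← div_rpow_mul_self (h.right_ne_zero P hP) (h.right_ne_top P hP) ht.le,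
              ← mul_assoc, ENNReal.rpow_mul, ← ENNReal.mul_rpow_of_nonneg _ _ hr.le]
            gcongr
            exact h.average_le hpq.lt hP
        _ = A ^ r * sparseTotal ch (fun P =>
              (volume P.toSet ^ ((p - 1) * r) * ν P.toSet ^ (1 - (p - 1) * r))) K R :=
            sparseTotal_const_mul _ _ _ _ _
        _ ≤ _ := by
            rw [div_rpow_mul_self (h.right_ne_zero R hR) (h.right_ne_top R hR) ht.le,
              mul_comm (C₀ : ℝ≥0∞), mul_assoc]
            gcongr
            exact hC₀ D ch hS ν K R hR
    · obtain ⟨C₁, hC₁⟩ := ih (r - 1) (by linarith) (by push_cast at hrn; linarith) (by linarith)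
      refine ⟨C₀ * (r.toNNReal * C₁), fun D ch hS μ ν A h K R hR => ?_⟩
      refine (lintegral_sparseSum_rpow_le_of_one_lt hS ν _ h1 (fun P => (r.toNNReal * C₁ * A ^ r) *
              (volume P.toSet ^ ((p - 1) * r) * ν P.toSet ^ (1 - (p - 1) * r))) ?_ K hR).trans ?_
      · intro K' P hP
        rw [← div_rpow_mul_self (h.right_ne_zero P hP) (h.right_ne_top P hP) ht.le]
        set ρ := volume P.toSet / ν P.toSet with hρ
        have hρ0 : ρ ≠ 0 := by simp [hρ, P.volume_ne_zero, h.right_ne_top P hP]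
        have hρt : ρ ≠ ∞ := (ENNReal.div_lt_top P.volume_ne_top (h.right_ne_zero P hP)).ne
        calc _ ≤ ENNReal.ofReal r * (A * ρ ^ (p - 1)) *
              (C₁ * A ^ (r - 1) * (ρ ^ ((p - 1) * (r - 1)) * ν P.toSet)) := by
              gcongr
              · exact h.average_le hpq.lt hP
              · exact hC₁ D ch hS μ ν A h K' P hP
          _ = ENNReal.ofReal r * C₁ * (A ^ (1 : ℝ) * A ^ (r - 1)) *
              ((ρ ^ (p - 1) * ρ ^ ((p - 1) * (r - 1))) * ν P.toSet) := by
              rw [ENNReal.rpow_one]; ring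
          _ = _ := by
              rw [← ENNReal.rpow_add _ _ hρ0 hρt,
                ← ENNReal.rpow_add_of_nonneg _ _ (by norm_num) (by linarith)]
              congr 3
              · ring_nf
              · ring
      · rw [sparseTotal_const_mul, div_rpow_mul_self (h.right_ne_zero R hR) (h.right_ne_top R hR)
          ht.le]
        push_cast
        calc _ ≤ (r.toNNReal * C₁ * A ^ r) * (C₀ * (volume R.toSet ^ ((p - 1) * r) *
              ν R.toSet ^ (1 - (p - 1) * r))) := by gcongr; exact hC₀ D ch hS ν K R hR
          _ = _ := by ring

/-- The testing estimate for sparse functions. -/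
theorem exists_lintegral_sparseSum_conjExponent_le {p q : ℝ} (hpq : p.HolderConjugate q) :
    ∃ C : ℝ≥0, ∀ (D : DyadicGrid d) (ch : Cube d → Set (Cube d)), IsSparse D ch →
      ∀ (μ ν : Measure (Fin d → ℝ)) (A : ℝ≥0∞), ApPair D μ ν p A → ∀ K, ∀ R ∈ D.cubes,
      ∫⁻ x, sparseSum ch (fun P => μ P.toSet / volume P.toSet) K R x ^ q ∂ν ≤
        C * A ^ q * μ R.toSet := by
  have e1 : (p - 1) * (q - 1) = 1 := by
    have := hpq.mul_eq_add; linarith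
  obtain ⟨n, hn⟩ := exists_nat_ge (q - 1)
  obtain ⟨C₁, hC₁⟩ := exists_lintegral_sparseSum_rpow_le (d := d) hpq n (q - 1)
    hpq.symm.sub_one_pos hn le_rfl
  refine ⟨q.toNNReal * C₁ * (2 ^ p : ℝ≥0), fun D ch hS μ ν A h K R hR => ?_⟩
  -- At the exponent $q-1$ the power of $|P|/\nu(P)$ is exactly one, so the $\nu$-mass cancels and
  -- each cube pays a multiple of $A^{q-1}\mu(P)$. The total mass of the family supplies the last
  -- factor $A$.
  refine (lintegral_sparseSum_rpow_le_of_one_lt hS ν _ hpq.symm.lt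
    (fun P => (q.toNNReal * C₁ * A ^ (q - 1)) * μ P.toSet) ?_ K hR).trans ?_
  · intro K' P hP
    calc _ ≤ ENNReal.ofReal q * (μ P.toSet / volume P.toSet) * (C₁ * A ^ (q - 1) *
          ((volume P.toSet / ν P.toSet) ^ ((p - 1) * (q - 1)) * ν P.toSet)) := by
          gcongr; exact hC₁ D ch hS μ ν A h K' P hP
      _ = ENNReal.ofReal q * C₁ * A ^ (q - 1) * ((μ P.toSet / volume P.toSet) *
          ((volume P.toSet / ν P.toSet) * ν P.toSet)) := by
          rw [e1, ENNReal.rpow_one]; ring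
      _ = _ := by
          rw [ENNReal.div_mul_cancel (h.right_ne_zero P hP) (h.right_ne_top P hP),
            ENNReal.div_mul_cancel P.volume_ne_zero P.volume_ne_top]
          rfl
  · rw [sparseTotal_const_mul]
    calc _ ≤ (q.toNNReal * C₁ * A ^ (q - 1)) * (2 ^ p * A * μ R.toSet) := by
          gcongr; exact h.sparseTotal_measure_le hpq.lt hS K hR
      _ = q.toNNReal * C₁ * 2 ^ p * (A ^ (q - 1) * A ^ (1 : ℝ)) * μ R.toSet := by
          rw [ENNReal.rpow_one]; ring
      _ = _ := by
          rw [← ENNReal.rpow_add_of_nonneg _ _ hpq.symm.sub_one_pos.le (by norm_num)]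
          push_cast
          rw [ENNReal.coe_rpow_of_nonneg _ hpq.pos.le]
          simp

/-- The estimate behind the nonstandard testing condition. -/
theorem exists_sparseTotal_average_mul_le {p q : ℝ} (hpq : p.HolderConjugate q) :
    ∃ C : ℝ≥0, ∀ (D : DyadicGrid d) (ch : Cube d → Set (Cube d)), IsSparse D ch →
      ∀ (μ ν : Measure (Fin d → ℝ)) (A : ℝ≥0∞), ApPair D μ ν p A → A ≠ ∞ → ∀ K, ∀ R ∈ D.cubes,
      sparseTotal ch (fun P => ν P.toSet / volume P.toSet * μ P.toSet) K R ≤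
        C * A ^ (q - 1) * ((volume R.toSet / μ R.toSet) ^ (q - 1) * μ R.toSet) := by
  have e1 : (p - 1) * (q - 1) = 1 := by
    have := hpq.mul_eq_add; linarith
  have hp1 := hpq.sub_one_pos
  have hq1 := hpq.symm.sub_one_pos
  -- The $A_p$ condition is applied to the average of $\nu$ if $q\le2$ and to that of $\mu$
  -- otherwise, so that the power sum has exponent at most one.
  rcases le_or_gt (q - 1) 1 with hq | hq
  · obtain ⟨C, hC⟩ := exists_sparseTotal_rpow_le (d := d) hq1 hq
    refine ⟨C, fun D ch hS μ ν A h hA K R hR => ?_⟩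
    calc _ ≤ sparseTotal ch (fun P => A ^ (q - 1) *
          (volume P.toSet ^ (q - 1) * μ P.toSet ^ (1 - (q - 1)))) K R := by
          refine sparseTotal_mono hS (fun P hP => ?_) K hR
          rw [← div_rpow_mul_self (h.left_ne_zero P hP) (h.left_ne_top P hP) hq1.le, ← mul_assoc]
          gcongr
          exact (h.symm hpq).average_le hpq.symm.lt hP
      _ ≤ A ^ (q - 1) * (C * (volume R.toSet ^ (q - 1) * μ R.toSet ^ (1 - (q - 1)))) := by
          rw [sparseTotal_const_mul]; gcongr; exact hC D ch hS μ K R hR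
      _ = _ := by
          rw [div_rpow_mul_self (h.left_ne_zero R hR) (h.left_ne_top R hR) hq1.le]; ring
  · have hp2 : p - 1 ≤ 1 := by nlinarith
    obtain ⟨C, hC⟩ := exists_sparseTotal_rpow_le (d := d) hp1 hp2
    refine ⟨C, fun D ch hS μ ν A h hA K R hR => ?_⟩
    have hv0 := R.volume_ne_zero
    have hvt := R.volume_ne_top
    have hm0 := h.left_ne_zero R hR
    have hmt := h.left_ne_top R hR
    have hn0 := h.right_ne_zero R hR
    have hnt := h.right_ne_top R hR
    have hA0 : A ≠ 0 := by
      rintro rfl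
      have := h.mul_le R hR
      simp [hm0, hn0, hnt] at this
    calc _ ≤ sparseTotal ch (fun P => A *
          (volume P.toSet ^ (p - 1) * ν P.toSet ^ (1 - (p - 1)))) K R := by
          refine sparseTotal_mono hS (fun P hP => ?_) K hR
          rw [← div_rpow_mul_self (h.right_ne_zero P hP) (h.right_ne_top P hP) hp1.le, ← mul_assoc,
            div_eq_mul_inv, mul_right_comm, mul_comm (ν P.toSet), mul_right_comm,
            mul_comm _ (ν P.toSet), mul_comm _ (ν P.toSet), ← div_eq_mul_inv]
          gcongr
          exact h.average_le hpq.lt hP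
      _ ≤ A * (C * (volume R.toSet ^ (p - 1) * ν R.toSet ^ (1 - (p - 1)))) := by
          rw [sparseTotal_const_mul]; gcongr; exact hC D ch hS ν K R hR
      -- What remains is a power $2-p\ge0$ of the average of $\nu$ over $R$. A second use of $A_p$,
      -- now on $R$ alone, brings the power of $A$ to $1+(q-1)(2-p)=q-1$.
      _ = C * (A * ((ν R.toSet / volume R.toSet) ^ (2 - p) * volume R.toSet)) := by
          rw [div_rpow_mul_self hv0 hvt (by linarith)]
          ring_nf
      _ ≤ C * (A * ((A ^ (q - 1) * (volume R.toSet / μ R.toSet) ^ (q - 1)) ^ (2 - p) *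
            volume R.toSet)) := by
          gcongr
          · linarith
          · exact (h.symm hpq).average_le hpq.symm.lt hR
      _ = _ := by
          have e2 : (q - 1) * (2 - p) = q - 2 := by linarith
          rw [ENNReal.mul_rpow_of_nonneg _ _ (by linarith), ← ENNReal.rpow_mul, ← ENNReal.rpow_mul,
            e2]
          set ρ := volume R.toSet / μ R.toSet with hρ
          have hρ0 : ρ ≠ 0 := by simp [hρ, hv0, hmt]
          have hρt : ρ ≠ ∞ := (ENNReal.div_lt_top hvt hm0).ne
          have hv : volume R.toSet = ρ ^ (1 : ℝ) * μ R.toSet := by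
            rw [ENNReal.rpow_one, hρ, ENNReal.div_mul_cancel hm0 hmt]
          rw [hv, show q - 1 = q - 2 + 1 by ring, ENNReal.rpow_add _ _ hρ0 hρt,
            ENNReal.rpow_add _ _ hA0 hA, ENNReal.rpow_one, ENNReal.rpow_one]
          ring

/-! ### Averages over cubes and Lebesgue differentiation. -/

theorem tendsto_two_zpow_atBot : Tendsto (fun k : ℤ => (2 : ℝ) ^ k) atBot (𝓝 0) := by
  have h : Tendsto (fun k : ℤ => (k : ℝ) * Real.log 2) atBot atBot :=
    (tendsto_intCast_atBot_iff.2 tendsto_id).atBot_mul_const (Real.log_pos (by norm_num))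
  refine (Real.tendsto_exp_atBot.comp h).congr fun k => ?_
  rw [Function.comp_apply, mul_comm, ← Real.rpow_def_of_pos (by norm_num), Real.rpow_intCast]

/-- The average of `|f|` over `Q`. -/
def avg (f : (Fin d → ℝ) → ℂ) (Q : Cube d) : ℝ≥0∞ :=
  (∫⁻ y in Q.toSet, ‖f y‖ₑ) / volume Q.toSet

theorem avg_mul_volume (f : (Fin d → ℝ) → ℂ) (Q : Cube d) :
    avg f Q * volume Q.toSet = ∫⁻ y in Q.toSet, ‖f y‖ₑ :=
  ENNReal.div_mul_cancel Q.volume_ne_zero Q.volume_ne_top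

theorem avg_ne_top {f : (Fin d → ℝ) → ℂ} (hf : LocallyIntegrable f) (Q : Cube d) :
    avg f Q ≠ ∞ := by
  refine (ENNReal.div_lt_top ?_ Q.volume_ne_zero).ne
  have : IntegrableOn f (Set.Icc Q.corner (fun i => Q.corner i + Q.side)) :=
    hf.integrableOn_isCompact isCompact_Icc
  refine (this.mono_set (t := Set.Icc Q.corner (fun i => Q.corner i + Q.side))
    (s := Q.toSet) fun x hx => ⟨fun i => (hx i).1, fun i => (hx i).2.le⟩).2.ne

theorem avg_le_of_ae_le {f : (Fin d → ℝ) → ℂ} {M : ℝ≥0∞} (h : ∀ᵐ x, ‖f x‖ₑ ≤ M) (Q : Cube d) :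
    avg f Q ≤ M := by
  refine ENNReal.div_le_of_le_mul ?_
  calc ∫⁻ y in Q.toSet, ‖f y‖ₑ ≤ ∫⁻ _ in Q.toSet, M :=
        lintegral_mono_ae (ae_restrict_of_ae h)
    _ = M * volume Q.toSet := by simp

/-- In the sup metric a cube is a closed ball up to a null set, so the differentiation theorem for
balls applies to dyadic cubes. -/
theorem Cube.ae_eq_closedBall (Q : Cube d) :
    Q.toSet =ᵐ[volume] Metric.closedBall (fun i => Q.corner i + Q.side / 2) (Q.side / 2) := by
  have h : Metric.closedBall (fun i => Q.corner i + Q.side / 2) (Q.side / 2) =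
      Set.Icc Q.corner (fun i => Q.corner i + Q.side) := by
    rw [closedBall_pi _ (by linarith [Q.side_pos]), ← Set.pi_univ_Icc]
    congr 1
    ext i
    rw [Real.closedBall_eq_Icc]
    ring_nf
  rw [h, Q.toSet_eq_pi]
  exact Measure.univ_pi_Ico_ae_eq_Icc

namespace DyadicGrid

/-- The Lebesgue differentiation theorem along the cubes of a dyadic grid. -/
theorem ae_tendsto_average (D : DyadicGrid d) {E : Type*} [NormedAddCommGroup E] [NormedSpace ℝ E]
    [CompleteSpace E] {f : (Fin d → ℝ) → E} (hf : LocallyIntegrable f) :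
    ∀ᵐ x, Tendsto (fun k : ℤ => ⨍ y in (D.cubeAt k x).toSet, f y) atBot (𝓝 (f x)) := by
  filter_upwards [IsUnifLocDoublingMeasure.ae_tendsto_average volume hf 1] with x hx
  have := hx (l := atBot) (fun k : ℤ => fun i => (D.cubeAt k x).corner i + (D.cubeAt k x).side / 2)
    (fun k : ℤ => (D.cubeAt k x).side / 2) ?_ ?_
  · refine this.congr fun k => ?_
    exact (setAverage_congr (Cube.ae_eq_closedBall _)).symm
  · refine tendsto_nhdsWithin_iff.2 ⟨?_, Eventually.of_forall fun k => ?_⟩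
    · simp only [D.cubeAt_side]
      have h2 : Tendsto (fun k : ℤ => (2 : ℝ) ^ k) atBot (𝓝 0) :=
        tendsto_two_zpow_atBot
      simpa using h2.div_const 2
    · have := (D.cubeAt k x).side_pos
      simp only [Set.mem_Ioi]; linarith
  · refine Eventually.of_forall fun k => ?_
    have hxk := D.mem_cubeAt k x
    have hs := (D.cubeAt k x).side_pos
    rw [one_mul, Metric.mem_closedBall, dist_pi_le_iff (by linarith)]
    intro i
    rw [Real.dist_eq, abs_le]
    constructor <;> linarith [(hxk i).1, (hxk i).2]

theorem ae_tendsto_avg (D : DyadicGrid d) {f : (Fin d → ℝ) → ℂ} (hf : LocallyIntegrable f) :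
    ∀ᵐ x, Tendsto (fun k : ℤ => avg f (D.cubeAt k x)) atBot (𝓝 ‖f x‖ₑ) := by
  filter_upwards [D.ae_tendsto_average (f := fun y => ‖f y‖) fun y => (hf y).norm] with x hx
  have := ENNReal.tendsto_ofReal hx
  rw [ofReal_norm] at this
  refine this.congr fun k => ?_
  have hint : IntegrableOn f (D.cubeAt k x).toSet :=
    ⟨hf.aestronglyMeasurable.restrict, by
      have := avg_ne_top hf (D.cubeAt k x)
      rw [HasFiniteIntegral, ← avg_mul_volume]
      exact ENNReal.mul_lt_top this.lt_top (Cube.volume_ne_top _).lt_top⟩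
  rw [setAverage_eq, smul_eq_mul, ENNReal.ofReal_mul (by positivity), avg, mul_comm,
    div_eq_mul_inv, Measure.real, ← ENNReal.toReal_inv,
    ENNReal.ofReal_toReal (ENNReal.inv_ne_top.2 (Cube.volume_ne_zero _)),
    ofReal_integral_norm_eq_lintegral_enorm hint]

end DyadicGrid

/-! ### Size and locality of the scale operators. -/

namespace LocalKernel

variable {D : DyadicGrid d} {κ : ℕ} {a : ℤ → (Fin d → ℝ) → (Fin d → ℝ) → ℂ}

theorem measurable (ha : LocalKernel D κ a) (k : ℤ) : Measurable (Function.uncurry (a k)) :=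
  D.measurable_of_cubeAt₂ (k - κ - 1) fun x x' y y' hx hy =>
    ha.const k (k - κ - 1) x x' y y' (by omega) hx hy

theorem measurable_right (ha : LocalKernel D κ a) (k : ℤ) (x : Fin d → ℝ) : Measurable (a k x) :=
  (ha.measurable k).comp measurable_prodMk_left

theorem kernelOp_congr (ha : LocalKernel D κ a) {k j : ℤ} (hjk : j + κ + 1 ≤ k)
    (f : (Fin d → ℝ) → ℂ) {x x' : Fin d → ℝ} (hx : D.cubeAt j x = D.cubeAt j x') :
    kernelOp (a k) f x = kernelOp (a k) f x' := by
  simp only [kernelOp]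
  congr 1
  ext y
  rw [ha.const k j x x' y y hjk hx rfl]

theorem measurable_kernelOp (ha : LocalKernel D κ a) (k : ℤ) (f : (Fin d → ℝ) → ℂ) :
    Measurable (kernelOp (a k) f) :=
  D.measurable_of_cubeAt (k - κ - 1) fun _ _ h => ha.kernelOp_congr (by omega) f h

theorem enorm_le (ha : LocalKernel D κ a) (k : ℤ) (x y z : Fin d → ℝ) :
    ‖a k x y‖ₑ ≤ (volume (D.cubeAt k z).toSet)⁻¹ := by
  rw [D.volume_cubeAt, ← ENNReal.ofReal_inv_of_pos (by positivity), ← ofReal_norm]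
  exact ENNReal.ofReal_le_ofReal (ha.bound k x y)

theorem enorm_kernelOp_le (ha : LocalKernel D κ a) (k : ℤ) (f : (Fin d → ℝ) → ℂ)
    (x : Fin d → ℝ) : ‖kernelOp (a k) f x‖ₑ ≤ avg f (D.cubeAt k x) := by
  refine (enorm_integral_le_lintegral_enorm _).trans ?_
  rw [avg, div_eq_mul_inv, mul_comm, ← lintegral_const_mul' _ _
    (ENNReal.inv_ne_top.2 (Cube.volume_ne_zero _)),
    ← lintegral_indicator (Cube.measurableSet_toSet _)]
  refine lintegral_mono fun y => ?_
  by_cases hy : y ∈ (D.cubeAt k x).toSet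
  · rw [Set.indicator_of_mem hy, enorm_mul]
    gcongr
    exact ha.enorm_le k x y x
  · rw [D.mem_cubeAt_iff] at hy
    rw [ha.zero k x y fun h => hy h.symm]; simp

theorem kernelOp_indicator (ha : LocalKernel D κ a) {k : ℤ} (f : (Fin d → ℝ) → ℂ)
    {s : Set (Fin d → ℝ)} {x : Fin d → ℝ} (hs : (D.cubeAt k x).toSet ⊆ s) :
    kernelOp (a k) (s.indicator f) x = kernelOp (a k) f x := by
  simp only [kernelOp]
  congr 1
  ext y
  by_cases hy : y ∈ (D.cubeAt k x).toSet
  · rw [Set.indicator_of_mem (hs hy)]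
  · rw [D.mem_cubeAt_iff] at hy
    rw [ha.zero k x y fun h => hy h.symm]; simp

theorem integrable_mul (ha : LocalKernel D κ a) (k : ℤ) {f : (Fin d → ℝ) → ℂ}
    (hf : LocallyIntegrable f) (x : Fin d → ℝ) : Integrable (fun y => a k x y * f y) := by
  refine ⟨(ha.measurable_right k x).aestronglyMeasurable.mul hf.aestronglyMeasurable, ?_⟩
  have h1 : ∫⁻ y, ‖a k x y * f y‖ₑ ≤ avg f (D.cubeAt k x) := by
    rw [avg, div_eq_mul_inv, mul_comm, ← lintegral_const_mul' _ _
      (ENNReal.inv_ne_top.2 (Cube.volume_ne_zero _)),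
      ← lintegral_indicator (Cube.measurableSet_toSet _)]
    refine lintegral_mono fun y => ?_
    by_cases hy : y ∈ (D.cubeAt k x).toSet
    · rw [Set.indicator_of_mem hy, enorm_mul]
      gcongr
      exact ha.enorm_le k x y x
    · rw [D.mem_cubeAt_iff] at hy
      rw [ha.zero k x y fun h => hy h.symm]; simp
  exact h1.trans_lt (avg_ne_top hf _).lt_top

end LocalKernel

/-- The volumes of the ancestors of a cube grow geometrically. -/
theorem DyadicGrid.sum_volume_div_le (D : DyadicGrid d) (hd : 0 < d) {Q : Cube d}
    (hQ : Q ∈ D.cubes) (x : Fin d → ℝ) (N : ℤ) :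
    ∑ k ∈ Finset.Icc (Q.scale + 1) N, volume Q.toSet / volume (D.cubeAt k x).toSet ≤ 1 := by
  have key : ∀ n : ℕ, ∑ k ∈ Finset.Icc (Q.scale + 1) (Q.scale + n),
      ((2 : ℝ) ^ Q.scale) ^ d / ((2 : ℝ) ^ k) ^ d ≤ 1 - (1 / 2) ^ n := by
    intro n
    induction n with
    | zero => simp
    | succ n ih =>
      have hI : Finset.Icc (Q.scale + 1) (Q.scale + (n + 1 : ℕ)) =
          insert (Q.scale + (n + 1 : ℕ)) (Finset.Icc (Q.scale + 1) (Q.scale + n)) := by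
        ext j; simp only [Finset.mem_Icc, Finset.mem_insert]; push_cast; omega
      rw [hI, Finset.sum_insert (by simp)]
      -- The true ratio is $2^{-(n+1)d}$; since $d\ge1$ it is at most $2^{-(n+1)}$, which makes the
      -- bound independent of $d$.
      have h1 : ((2 : ℝ) ^ Q.scale) ^ d / ((2 : ℝ) ^ (Q.scale + (n + 1 : ℕ))) ^ d ≤
          (1 / 2) ^ (n + 1) := by
        rw [← div_pow, zpow_add₀ (by norm_num), div_mul_cancel_left₀ (by positivity),
          zpow_natCast, ← inv_pow, ← one_div]
        exact pow_le_of_le_one (by positivity) (pow_le_one₀ (by norm_num) (by norm_num)) hd.ne'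
      have h2 : (1 / 2 : ℝ) ^ (n + 1) = (1 / 2) ^ n / 2 := by rw [pow_succ]; ring
      linarith
  have h0 : ∀ k, volume Q.toSet / volume (D.cubeAt k x).toSet =
      ENNReal.ofReal (((2 : ℝ) ^ Q.scale) ^ d / ((2 : ℝ) ^ k) ^ d) := fun k => by
    rw [D.volume_cubeAt, D.volume_cube hQ, ENNReal.ofReal_div_of_pos (by positivity)]
  simp_rw [h0]
  rw [← ENNReal.ofReal_sum_of_nonneg fun _ _ => by positivity, ← ENNReal.ofReal_one]
  refine ENNReal.ofReal_le_ofReal ?_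
  refine (Finset.sum_le_sum_of_subset_of_nonneg (t := Finset.Icc (Q.scale + 1)
    (Q.scale + (N - Q.scale).toNat)) ?_ fun _ _ _ => by positivity).trans ((key _).trans ?_)
  · intro j; simp only [Finset.mem_Icc]; omega
  · have : (0 : ℝ) ≤ (1 / 2) ^ (N - Q.scale).toNat := by positivity
    linarith

/-- The operators at scales above that of a cube carrying `f` sum up to at most an average. -/
theorem DyadicGrid.sum_avg_cubeAt_le (D : DyadicGrid d) (hd : 0 < d) {Q : Cube d}
    (hQ : Q ∈ D.cubes) {f : (Fin d → ℝ) → ℂ} (hf : ∀ x ∉ Q.toSet, f x = 0) (x : Fin d → ℝ)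
    (s : Finset ℤ) (hs : ∀ k ∈ s, Q.scale + 1 ≤ k) :
    ∑ k ∈ s, avg f (D.cubeAt k x) ≤ avg f Q := by
  have h1 : ∀ k, avg f (D.cubeAt k x) ≤
      avg f Q * (volume Q.toSet / volume (D.cubeAt k x).toSet) := by
    intro k
    rw [← mul_div_assoc, avg_mul_volume, avg]
    gcongr 1
    rw [← lintegral_indicator (Cube.measurableSet_toSet _),
      ← lintegral_indicator (Cube.measurableSet_toSet _)]
    refine lintegral_mono fun y => ?_
    by_cases hy : y ∈ Q.toSet
    · rw [Set.indicator_of_mem hy]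
      exact Set.indicator_le_self' (fun _ _ => zero_le) y
    · refine (Set.indicator_le_self' (fun _ _ => zero_le) y).trans ?_
      simp [hf y hy]
  obtain ⟨N, hN⟩ := s.bddAbove
  calc ∑ k ∈ s, avg f (D.cubeAt k x)
      ≤ ∑ k ∈ Finset.Icc (Q.scale + 1) N, avg f (D.cubeAt k x) :=
        Finset.sum_le_sum_of_subset fun k hk => Finset.mem_Icc.2 ⟨hs k hk, hN hk⟩
    _ ≤ ∑ k ∈ Finset.Icc (Q.scale + 1) N,
          avg f Q * (volume Q.toSet / volume (D.cubeAt k x).toSet) :=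
        Finset.sum_le_sum fun k _ => h1 k
    _ ≤ avg f Q * 1 := by
        rw [← Finset.mul_sum]; gcongr; exact D.sum_volume_div_le hd hQ x N
    _ = avg f Q := mul_one _

theorem LocalKernel.sum_enorm_kernelOp_le {D : DyadicGrid d} {κ : ℕ}
    {a : ℤ → (Fin d → ℝ) → (Fin d → ℝ) → ℂ} (ha : LocalKernel D κ a) (hd : 0 < d) {Q : Cube d}
    (hQ : Q ∈ D.cubes) {f : (Fin d → ℝ) → ℂ} (hf : ∀ x ∉ Q.toSet, f x = 0) (x : Fin d → ℝ)
    (s : Finset ℤ) (hs : ∀ k ∈ s, Q.scale + 1 ≤ k) :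
    ∑ k ∈ s, ‖kernelOp (a k) f x‖ₑ ≤ avg f Q :=
  (Finset.sum_le_sum fun k _ => ha.enorm_kernelOp_le k f x).trans
    (D.sum_avg_cubeAt_le hd hQ hf x s hs)

/-! ### Consequences of the $L^2$ bound and Cotlar's inequality. -/

theorem lintegral_enorm_le_eLpNorm_two {h : (Fin d → ℝ) → ℂ} (hm : AEStronglyMeasurable h volume)
    (Q : Cube d) :
    ∫⁻ x in Q.toSet, ‖h x‖ₑ ≤ eLpNorm h 2 volume * volume Q.toSet ^ (1 / 2 : ℝ) := by
  have h1 := eLpNorm_le_eLpNorm_mul_rpow_measure_univ (μ := volume.restrict Q.toSet)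
    (p := 1) (q := 2) (by norm_num) (hm.restrict (s := Q.toSet))
  rw [eLpNorm_one_eq_lintegral_enorm, Measure.restrict_apply_univ] at h1
  refine h1.trans ?_
  have : (1 / (1 : ℝ≥0∞).toReal - 1 / (2 : ℝ≥0∞).toReal : ℝ) = 1 / 2 := by norm_num
  rw [this]
  gcongr
  exact Measure.restrict_le_self

theorem eLpNorm_two_le_of_bounded {h : (Fin d → ℝ) → ℂ} {M : ℝ≥0} (hM : ∀ᵐ x, ‖h x‖ₑ ≤ M)
    {Q : Cube d} (hQ : ∀ x ∉ Q.toSet, h x = 0) :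
    eLpNorm h 2 volume ≤ M * volume Q.toSet ^ (1 / 2 : ℝ) := by
  have h1 : eLpNorm h 2 volume ≤ eLpNorm (Q.toSet.indicator fun _ => (M : ℝ)) 2 volume := by
    refine eLpNorm_mono_ae ?_
    filter_upwards [hM] with x hx
    by_cases hxQ : x ∈ Q.toSet
    · rw [Set.indicator_of_mem hxQ, NNReal.norm_eq]
      rw [enorm_le_coe] at hx
      exact_mod_cast hx
    · simp [hQ x hxQ, hxQ]
  refine h1.trans ((eLpNorm_indicator_const_le _ _).trans ?_)
  simp [enorm_eq_nnnorm]

theorem volume_rpow_half_mul_self (Q : Cube d) :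
    volume Q.toSet ^ (1 / 2 : ℝ) * volume Q.toSet ^ (1 / 2 : ℝ) = volume Q.toSet := by
  rw [← ENNReal.rpow_add _ _ Q.volume_ne_zero Q.volume_ne_top]; norm_num

theorem enorm_le_enorm_sub_add (u v : ℂ) : ‖u‖ₑ ≤ ‖u - v‖ₑ + ‖v‖ₑ := by
  simpa using enorm_add_le (u - v) v

theorem lintegral_add_add_add {α : Type*} [MeasurableSpace α] {μ : Measure α}
    {f₁ f₂ f₃ f₄ : α → ℝ≥0∞} (h₂ : AEMeasurable f₂ μ) (h₃ : AEMeasurable f₃ μ)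
    (h₄ : AEMeasurable f₄ μ) :
    ∫⁻ x, f₁ x + f₂ x + (f₃ x + f₄ x) ∂μ =
      ∫⁻ x, f₁ x ∂μ + ∫⁻ x, f₂ x ∂μ + (∫⁻ x, f₃ x ∂μ + ∫⁻ x, f₄ x ∂μ) := by
  have h34 : AEMeasurable (fun x => f₃ x + f₄ x) μ := h₃.add h₄
  rw [lintegral_add_right' _ h34, lintegral_add_right' _ h₂, lintegral_add_right' _ h₄]

section Kernel

variable {D : DyadicGrid d} {κ : ℕ} {a : ℤ → (Fin d → ℝ) → (Fin d → ℝ) → ℂ}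

/-- On a bounded function carried by a cube, the sum of all the scale operators is the limit in
`L¹` of any cube of its truncations, and is bounded in average. -/
theorem KernelL2Bounded.exists_limit {B : ℝ≥0} (hB : KernelL2Bounded a B)
    (ha : LocalKernel D κ a) {h : (Fin d → ℝ) → ℂ} (hm : AEStronglyMeasurable h volume) {M : ℝ≥0}
    (hM : ∀ᵐ x, ‖h x‖ₑ ≤ M) {Q : Cube d} (hQ : ∀ x ∉ Q.toSet, h x = 0) :
    ∃ H : (Fin d → ℝ) → ℂ, AEStronglyMeasurable H volume ∧
      (∀ P : Cube d, Tendsto (fun N : ℕ => ∫⁻ x in P.toSet,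
        ‖∑ k ∈ Finset.Icc (-(N : ℤ)) N, kernelOp (a k) h x - H x‖ₑ) atTop (𝓝 0)) ∧
      ∫⁻ x in Q.toSet, ‖H x‖ₑ ≤ B * M * volume Q.toSet := by
  have h2 := eLpNorm_two_le_of_bounded hM hQ
  have hh : MemLp h 2 volume := ⟨hm, h2.trans_lt (ENNReal.mul_lt_top (by simp)
    (ENNReal.rpow_lt_top_of_nonneg (by norm_num) Q.volume_ne_top))⟩
  obtain ⟨H, hH, hlim, hle⟩ := hB h hh
  refine ⟨H, hH.1, fun P => ?_, ?_⟩
  · have hc : volume P.toSet ^ (1 / 2 : ℝ) ≠ ∞ :=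
      ENNReal.rpow_ne_top_of_nonneg (by norm_num) P.volume_ne_top
    have := ENNReal.Tendsto.mul_const hlim (b := volume P.toSet ^ (1 / 2 : ℝ)) (Or.inr hc)
    rw [zero_mul] at this
    refine tendsto_of_tendsto_of_tendsto_of_le_of_le tendsto_const_nhds this
      (fun _ => zero_le) fun N => ?_
    refine lintegral_enorm_le_eLpNorm_two (AEStronglyMeasurable.sub ?_ hH.1) P
    exact (Finset.measurable_sum _ fun k _ => ha.measurable_kernelOp k h).aestronglyMeasurable
  · calc ∫⁻ x in Q.toSet, ‖H x‖ₑ ≤ eLpNorm H 2 volume * volume Q.toSet ^ (1 / 2 : ℝ) :=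
          lintegral_enorm_le_eLpNorm_two hH.1 Q
      _ ≤ B * (M * volume Q.toSet ^ (1 / 2 : ℝ)) * volume Q.toSet ^ (1 / 2 : ℝ) := by
          gcongr; exact hle.trans (by gcongr)
      _ = B * M * (volume Q.toSet ^ (1 / 2 : ℝ) * volume Q.toSet ^ (1 / 2 : ℝ)) := by ring
      _ = _ := by rw [volume_rpow_half_mul_self]

theorem sum_Icc_eq_add {E : Type*} [AddCommMonoid E] (F : ℤ → E) {i j k : ℤ} (hij : i ≤ j + 1)
    (hjk : j ≤ k) : ∑ l ∈ Finset.Icc i k, F l =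
      ∑ l ∈ Finset.Icc i j, F l + ∑ l ∈ Finset.Icc (j + 1) k, F l := by
  rw [← Finset.sum_union]
  · congr 1
    ext l; simp only [Finset.mem_Icc, Finset.mem_union]; omega
  · rw [Finset.disjoint_left]; intro l; simp only [Finset.mem_Icc]; omega

/-- Cotlar's inequality for bounded functions. -/
theorem cotlar_of_bounded {B : ℝ≥0} (hB : KernelL2Bounded a B) (ha : LocalKernel D κ a)
    (hd : 0 < d) {g : (Fin d → ℝ) → ℂ} {M : ℝ≥0}
    (hM : ∀ᵐ x, ‖g x‖ₑ ≤ M) {R : Cube d} (hR : R ∈ D.cubes) (hgR : ∀ x ∉ R.toSet, g x = 0)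
    {G : (Fin d → ℝ) → ℂ} (hGm : AEStronglyMeasurable G volume) (hgm : AEStronglyMeasurable g volume)
    (hG : ∀ P : Cube d, Tendsto (fun N : ℕ => ∫⁻ x in P.toSet,
        ‖∑ k ∈ Finset.Icc (-(N : ℤ)) N, kernelOp (a k) g x - G x‖ₑ) atTop (𝓝 0))
    {P : Cube d} (hP : P ∈ D.cubes) (hPR : P.scale + κ + 1 ≤ R.scale) {x : Fin d → ℝ}
    (hx : x ∈ P.toSet) :
    ‖∑ k ∈ Finset.Icc (P.scale + κ + 1) R.scale, kernelOp (a k) g x‖ₑ * volume P.toSet ≤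
      (∫⁻ y in P.toSet, ‖G y‖ₑ) + (κ + 2 + B) * M * volume P.toSet := by
  set Λ := ∑ k ∈ Finset.Icc (P.scale + κ + 1) R.scale, kernelOp (a k) g x with hΛ
  set gP := P.toSet.indicator g with hgP
  have hgPm : AEStronglyMeasurable gP volume := hgm.indicator P.measurableSet_toSet
  have hMP : ∀ᵐ x, ‖gP x‖ₑ ≤ M := by
    filter_upwards [hM] with y hy
    exact (enorm_indicator_le_enorm_self _ _).trans hy
  have hgP0 : ∀ y ∉ P.toSet, gP y = 0 := fun y hy => Set.indicator_of_notMem hy _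
  obtain ⟨H, hHm, hH, hHle⟩ := hB.exists_limit ha hgPm hMP hgP0
  -- pointwise comparison
  have hpt : ∀ N : ℕ, -(N : ℤ) ≤ P.scale → R.scale ≤ N → ∀ z ∈ P.toSet, ‖Λ‖ₑ ≤
      ‖∑ k ∈ Finset.Icc (-(N : ℤ)) N, kernelOp (a k) g z‖ₑ +
      ‖∑ k ∈ Finset.Icc (-(N : ℤ)) N, kernelOp (a k) gP z‖ₑ + (κ + 2) * M := by
    intro N hN1 hN2 z hz
    have e1 := sum_Icc_eq_add (fun k => kernelOp (a k) g z) (i := -(N : ℤ)) (j := P.scale) (k := N)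
      (by omega) (by omega)
    have e2 := sum_Icc_eq_add (fun k => kernelOp (a k) g z) (i := P.scale + 1) (j := P.scale + κ)
      (k := N) (by omega) (by omega)
    have e3 := sum_Icc_eq_add (fun k => kernelOp (a k) g z) (i := P.scale + κ + 1) (j := R.scale)
      (k := N) (by omega) (by omega)
    have e4 := sum_Icc_eq_add (fun k => kernelOp (a k) gP z) (i := -(N : ℤ)) (j := P.scale) (k := N)
      (by omega) (by omega)
    -- Scales up to that of $P$ see only the restriction of $g$ to $P$.
    have e5 : ∑ k ∈ Finset.Icc (-(N : ℤ)) P.scale, kernelOp (a k) gP z =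
        ∑ k ∈ Finset.Icc (-(N : ℤ)) P.scale, kernelOp (a k) g z := by
      refine Finset.sum_congr rfl fun k hk => ha.kernelOp_indicator g ?_
      exact D.subset_of_mem (D.cubeAt_mem _ _) hP (by simpa using (Finset.mem_Icc.1 hk).2)
        (D.mem_cubeAt _ _) hz
    have e6 : ∑ k ∈ Finset.Icc (P.scale + κ + 1) R.scale, kernelOp (a k) g z = Λ := by
      refine Finset.sum_congr rfl fun k hk => ?_
      refine ha.kernelOp_congr (j := P.scale) (Finset.mem_Icc.1 hk).1 g ?_
      rw [D.cubeAt_scale_eq hP hz, D.cubeAt_scale_eq hP hx]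
    -- The errors: one $M$ for each tail above a cube that carries the function, by geometric growth
    -- of volumes, and one $M$ for each of the $\kappa$ scales just above $P$.
    have b1 : ‖∑ k ∈ Finset.Icc (P.scale + 1) (N : ℤ), kernelOp (a k) gP z‖ₑ ≤ M :=
      (enorm_sum_le _ _).trans ((ha.sum_enorm_kernelOp_le hd hP hgP0 z _
        fun k hk => (Finset.mem_Icc.1 hk).1).trans (avg_le_of_ae_le hMP P))
    have b2 : ‖∑ k ∈ Finset.Icc (R.scale + 1) (N : ℤ), kernelOp (a k) g z‖ₑ ≤ M :=
      (enorm_sum_le _ _).trans ((ha.sum_enorm_kernelOp_le hd hR hgR z _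
        fun k hk => (Finset.mem_Icc.1 hk).1).trans (avg_le_of_ae_le hM R))
    have b3 : ‖∑ k ∈ Finset.Icc (P.scale + 1) (P.scale + κ), kernelOp (a k) g z‖ₑ ≤ κ * M := by
      refine (enorm_sum_le _ _).trans ?_
      refine (Finset.sum_le_card_nsmul _ _ _ fun k _ =>
        (ha.enorm_kernelOp_le k g z).trans (avg_le_of_ae_le hM _)).trans ?_
      simp
    rw [e6] at e3
    have e7 : Λ = ∑ k ∈ Finset.Icc (-(N : ℤ)) N, kernelOp (a k) g z -
        ∑ k ∈ Finset.Icc (-(N : ℤ)) N, kernelOp (a k) gP z +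
        (∑ k ∈ Finset.Icc (P.scale + 1) (N : ℤ), kernelOp (a k) gP z -
        ∑ k ∈ Finset.Icc (P.scale + 1) (P.scale + κ), kernelOp (a k) g z -
        ∑ k ∈ Finset.Icc (R.scale + 1) (N : ℤ), kernelOp (a k) g z) := by
      rw [e1, e4, e5, e2, e3]; ring
    rw [e7]
    refine (enorm_add_le _ _).trans (add_le_add enorm_sub_le ?_)
    calc _ ≤ (M + κ * M : ℝ≥0∞) + M :=
          enorm_sub_le.trans (add_le_add (enorm_sub_le.trans (add_le_add b1 b3)) b2)
      _ = _ := by ring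
  -- integrate over the cube
  have hint : ∀ᶠ N : ℕ in atTop, ‖Λ‖ₑ * volume P.toSet ≤
      (∫⁻ y in P.toSet, ‖∑ k ∈ Finset.Icc (-(N : ℤ)) N, kernelOp (a k) g y - G y‖ₑ) +
      (∫⁻ y in P.toSet, ‖G y‖ₑ) +
      ((∫⁻ y in P.toSet, ‖∑ k ∈ Finset.Icc (-(N : ℤ)) N, kernelOp (a k) gP y - H y‖ₑ) +
      (∫⁻ y in P.toSet, ‖H y‖ₑ)) + (κ + 2) * M * volume P.toSet := by
    filter_upwards [eventually_ge_atTop (max (-P.scale).toNat R.scale.toNat)] with N hN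
    have hN1 : -(N : ℤ) ≤ P.scale := by omega
    have hN2 : R.scale ≤ N := by omega
    have ms : ∀ h, Measurable fun y => ∑ k ∈ Finset.Icc (-(N : ℤ)) N, kernelOp (a k) h y := fun h =>
      Finset.measurable_sum _ fun k _ => ha.measurable_kernelOp k h
    calc ‖Λ‖ₑ * volume P.toSet = ∫⁻ _ in P.toSet, ‖Λ‖ₑ := by simp
      _ ≤ ∫⁻ y in P.toSet,
          ((‖∑ k ∈ Finset.Icc (-(N : ℤ)) N, kernelOp (a k) g y - G y‖ₑ + ‖G y‖ₑ) +
          (‖∑ k ∈ Finset.Icc (-(N : ℤ)) N, kernelOp (a k) gP y - H y‖ₑ + ‖H y‖ₑ)) +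
          (κ + 2) * M := by
          refine setLIntegral_mono_ae' P.measurableSet_toSet (Eventually.of_forall fun y hy => ?_)
          refine (hpt N hN1 hN2 y hy).trans ?_
          gcongr
          · exact enorm_le_enorm_sub_add _ _
          · exact enorm_le_enorm_sub_add _ _
      _ = _ := by
          have m3 : AEMeasurable (fun y => ‖∑ k ∈ Finset.Icc (-(N : ℤ)) N, kernelOp (a k) gP y -
            H y‖ₑ) (volume.restrict P.toSet) :=
            (((ms gP).aestronglyMeasurable.sub hHm).restrict (s := P.toSet)).enorm
          rw [lintegral_add_right _ measurable_const,
            lintegral_add_add_add (hGm.restrict (s := P.toSet)).enorm m3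
              (hHm.restrict (s := P.toSet)).enorm]
          simp
  have hlim := (((hG P).add_const (∫⁻ y in P.toSet, ‖G y‖ₑ)).add
    ((hH P).add_const (∫⁻ y in P.toSet, ‖H y‖ₑ))).add_const ((κ + 2) * M * volume P.toSet)
  refine (ge_of_tendsto hlim hint).trans ?_
  rw [zero_add, zero_add, add_assoc]
  gcongr
  calc _ ≤ B * M * volume P.toSet + (κ + 2) * M * volume P.toSet := by gcongr
    _ = _ := by ring

end Kernel

/-! ### Stopping cubes and pointwise sparse domination. -/

/-- The stopping condition for a subcube `P` of `R`: the average of `|f|` jumps, or the truncated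
sum of the scale operators, which is constant on `P`, is large there. -/
def Stops (κ : ℕ) (a : ℤ → (Fin d → ℝ) → (Fin d → ℝ) → ℂ) (T : ℝ≥0)
    (f : (Fin d → ℝ) → ℂ) (R P : Cube d) : Prop :=
  8 * avg f R < avg f P ∨ ∃ x ∈ P.toSet, T * κ * avg f R <
    ‖∑ i ∈ Finset.Icc (P.scale + κ + 1) R.scale, kernelOp (a i) f x‖ₑ

/-- The maximal stopping subcubes of `R`. -/
def stopCubes (D : DyadicGrid d) (κ : ℕ) (a : ℤ → (Fin d → ℝ) → (Fin d → ℝ) → ℂ) (T : ℝ≥0)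
    (f : (Fin d → ℝ) → ℂ) (R : Cube d) : Set (Cube d) :=
  {P | P ∈ D.cubes ∧ P.toSet ⊂ R.toSet ∧ Stops κ a T f R P ∧
    ∀ P' ∈ D.cubes, P.toSet ⊂ P'.toSet → P'.toSet ⊂ R.toSet → ¬ Stops κ a T f R P'}

section

variable {D : DyadicGrid d} {κ : ℕ} {a : ℤ → (Fin d → ℝ) → (Fin d → ℝ) → ℂ} {T : ℝ≥0}
  {f : (Fin d → ℝ) → ℂ}

theorem DyadicGrid.ssubset_of_mem (D : DyadicGrid d) (hd : 0 < d) {P Q : Cube d}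
    (hP : P ∈ D.cubes) (hQ : Q ∈ D.cubes)
    (h : P.scale < Q.scale) {x : Fin d → ℝ} (hxP : x ∈ P.toSet) (hxQ : x ∈ Q.toSet) :
    P.toSet ⊂ Q.toSet := by
  refine (D.subset_of_mem hP hQ h.le hxP hxQ).ssubset_of_ne fun he => ?_
  exact absurd (D.scale_le_of_subset hd hQ hP he.symm.subset) (by omega)

theorem stopCubes_pairwiseDisjoint (hd : 0 < d) (R : Cube d) :
    (stopCubes D κ a T f R).PairwiseDisjoint Cube.toSet := by
  have aux : ∀ P ∈ stopCubes D κ a T f R, ∀ P' ∈ stopCubes D κ a T f R, P.scale ≤ P'.scale →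
      P ≠ P' → Disjoint P.toSet P'.toSet := by
    intro P hP P' hP' hle hne
    rw [Set.disjoint_left]
    intro x hx hx'
    rcases hle.eq_or_lt with h | h
    · exact hne (D.eq_of_mem hP.1 hP'.1 h hx hx')
    · exact hP.2.2.2 P' hP'.1 (D.ssubset_of_mem hd hP.1 hP'.1 h hx hx') hP'.2.1 hP'.2.2.1
  intro P hP P' hP' hne
  rcases le_total P.scale P'.scale with h | h
  · exact aux P hP P' hP' h hne
  · exact (aux P' hP' P hP h hne.symm).symm

theorem exists_stopCube (hd : 0 < d) {R : Cube d} (hR : R ∈ D.cubes) {x : Fin d → ℝ}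
    (hx : x ∈ R.toSet) {j : ℤ}
    (h : ∃ i, j ≤ i ∧ i < R.scale ∧ Stops κ a T f R (D.cubeAt i x)) :
    ∃ P ∈ stopCubes D κ a T f R, x ∈ P.toSet ∧ j ≤ P.scale ∧ P.scale < R.scale ∧
      ∀ i, P.scale < i → i < R.scale → ¬ Stops κ a T f R (D.cubeAt i x) := by
  obtain ⟨i, ⟨h1, h2, h3⟩, hmax⟩ := Int.exists_greatest_of_bdd
    ⟨R.scale, fun z hz => hz.2.1.le⟩ h
  have hns : ∀ l, i < l → l < R.scale → ¬ Stops κ a T f R (D.cubeAt l x) := fun l hl hlR hs =>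
    absurd (hmax l ⟨by omega, hlR, hs⟩) (by omega)
  refine ⟨D.cubeAt i x, ⟨D.cubeAt_mem i x, D.ssubset_of_mem hd (D.cubeAt_mem i x) hR (by simpa)
    (D.mem_cubeAt i x) hx, h3, fun P' hP' hs hs' => ?_⟩, D.mem_cubeAt i x, by simpa, by simpa,
    by simpa using hns⟩
  have hxP' := hs.subset (D.mem_cubeAt i x)
  have e := D.cubeAt_scale_eq hP' hxP'
  rw [← e]
  refine hns _ ?_ (D.scale_lt_of_ssubset hd hP' hR hs')
  simpa using D.scale_lt_of_ssubset hd (D.cubeAt_mem i x) hP' hs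

/-- The second stopping condition at scale $j$ controls the scales above $j+\kappa$. The $\kappa+1$
scales left over are bounded singly by the first condition, which costs $8(\kappa+1)\le16\kappa$
averages. -/
theorem enorm_sum_le_of_not_stops (ha : LocalKernel D κ a) (hκ : 1 ≤ κ) {R : Cube d}
    (hR : R ∈ D.cubes) {x : Fin d → ℝ} (hx : x ∈ R.toSet) {j : ℤ} (hj : j ≤ R.scale)
    (h : ∀ i, j ≤ i → i < R.scale → ¬ Stops κ a T f R (D.cubeAt i x)) :
    ‖∑ i ∈ Finset.Icc j R.scale, kernelOp (a i) f x‖ₑ ≤ (16 + T) * κ * avg f R := by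
  have hκ' : (1 : ℝ≥0∞) ≤ κ := by exact_mod_cast hκ
  have h1 : ∀ i, j ≤ i → i ≤ R.scale → ‖kernelOp (a i) f x‖ₑ ≤ 8 * avg f R := by
    intro i hi hiR
    refine (ha.enorm_kernelOp_le i f x).trans ?_
    rcases hiR.eq_or_lt with rfl | hlt
    · rw [D.cubeAt_scale_eq hR hx]
      exact le_mul_of_one_le_left zero_le (by norm_num)
    · exact not_lt.1 fun hh => h i hi hlt (Or.inl hh)
  have hsum : ∀ l, l ≤ j + κ → l ≤ R.scale →
      ‖∑ i ∈ Finset.Icc j l, kernelOp (a i) f x‖ₑ ≤ 16 * κ * avg f R := by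
    intro l hl hlR
    refine (enorm_sum_le _ _).trans ((Finset.sum_le_card_nsmul _ _ _ fun i hi =>
      h1 i (Finset.mem_Icc.1 hi).1 ((Finset.mem_Icc.1 hi).2.trans hlR)).trans ?_)
    rw [nsmul_eq_mul, Int.card_Icc]
    have hc : ((l + 1 - j).toNat : ℝ≥0∞) ≤ κ + 1 := by
      have : (l + 1 - j).toNat ≤ κ + 1 := by omega
      exact_mod_cast this
    calc _ ≤ (κ + κ : ℝ≥0∞) * (8 * avg f R) := by gcongr; exact hc.trans (by gcongr)
      _ = _ := by ring
  rcases le_or_gt R.scale (j + κ) with hc | hc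
  · refine (hsum _ hc le_rfl).trans ?_
    gcongr
    exact le_self_add
  · rw [sum_Icc_eq_add _ (i := j) (j := j + κ) (by omega) (by omega)]
    refine (enorm_add_le _ _).trans ?_
    rw [add_mul, add_mul]
    refine add_le_add (hsum _ le_rfl hc.le) ?_
    have := h j le_rfl (by omega)
    simp only [Stops, not_or, not_exists, not_and, not_lt, DyadicGrid.scale_cubeAt] at this
    exact this.2 x (D.mem_cubeAt j x)

/-- Pointwise domination of truncated sums by the sparse function of the stopping cubes. -/
theorem enorm_sum_le_sparseSum (ha : LocalKernel D κ a) (hκ : 1 ≤ κ) (hd : 0 < d)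
    (K : ℕ) {R : Cube d}
    (hR : R ∈ D.cubes) {x : Fin d → ℝ} (hx : x ∈ R.toSet) {j : ℤ} (hjK : R.scale - j < K) :
    ‖∑ i ∈ Finset.Icc j R.scale, kernelOp (a i) f x‖ₑ ≤
      (16 + T) * κ * sparseSum (stopCubes D κ a T f) (avg f) K R x := by
  induction K generalizing R with
  | zero =>
    rw [Finset.Icc_eq_empty (by push_cast at hjK; omega)]; simp
  | succ K ih =>
    rcases le_or_gt j R.scale with hj | hj
    swap
    · rw [Finset.Icc_eq_empty (by omega)]; simp
    rw [sparseSum, Set.indicator_of_mem hx, mul_add]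
    by_cases h : ∃ i, j ≤ i ∧ i < R.scale ∧ Stops κ a T f R (D.cubeAt i x)
    · obtain ⟨P, hP, hxP, hjP, hPR, hns⟩ := exists_stopCube hd hR hx h
      -- The sum is cut at the largest stopping cube that contains $x$: above it nothing stops, and
      -- below it the argument restarts from $P$ with the average over $P$.
      rw [sum_Icc_eq_add _ (i := j) (j := P.scale) (by omega) hPR.le, add_comm]
      refine (enorm_add_le _ _).trans (add_le_add ?_ ?_)
      · exact enorm_sum_le_of_not_stops ha hκ hR hx (by omega) fun i hi => hns i (by omega)
      · refine (ih hP.1 hxP (by push_cast at hjK; omega)).trans ?_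
        gcongr
        exact ENNReal.le_tsum (⟨P, hP⟩ : stopCubes D κ a T f R)
    · push Not at h
      exact (enorm_sum_le_of_not_stops ha hκ hR hx hj h).trans le_self_add

theorem DyadicGrid.volume_cubeAt_succ (D : DyadicGrid d) {P : Cube d} (hP : P ∈ D.cubes)
    (x : Fin d → ℝ) : volume (D.cubeAt (P.scale + 1) x).toSet = 2 ^ d * volume P.toSet := by
  rw [D.volume_cubeAt, D.volume_cube hP, zpow_add₀ (by norm_num), mul_pow, mul_comm,
    ENNReal.ofReal_mul (by positivity)]
  simp

/-- The dyadic parent of a stopping cube is $R$ or fails to stop, and it is only $2^d$ times larger.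
-/
theorem avg_stopCube_le (hd : 0 < d) {R : Cube d} (hR : R ∈ D.cubes) {P : Cube d}
    (hP : P ∈ stopCubes D κ a T f R) : avg f P ≤ 8 * 2 ^ d * avg f R := by
  have hlt := D.scale_lt_of_ssubset hd hP.1 hR hP.2.1
  set P' := D.cubeAt (P.scale + 1) P.corner with hP'
  have hxR : P.corner ∈ R.toSet := hP.2.1.subset P.corner_mem
  have hPP' : P.toSet ⊂ P'.toSet :=
    D.ssubset_of_mem hd hP.1 (D.cubeAt_mem _ _) (by simp [hP']) P.corner_mem (D.mem_cubeAt _ _)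
  have h1 : avg f P' ≤ 8 * avg f R := by
    rcases (show P.scale + 1 ≤ R.scale by omega).eq_or_lt with h | h
    · rw [hP', h, D.cubeAt_scale_eq hR hxR]
      exact le_mul_of_one_le_left zero_le (by norm_num)
    · have := hP.2.2.2 P' (D.cubeAt_mem _ _) hPP'
        (D.ssubset_of_mem hd (D.cubeAt_mem _ _) hR (by simpa [hP'] using h)
          (D.mem_cubeAt _ P.corner) hxR)
      exact not_lt.1 fun hh => this (Or.inl hh)
  calc avg f P ≤ 2 ^ d * avg f P' := by
        rw [avg, avg, D.volume_cubeAt_succ hP.1, ← mul_div_assoc,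
          ENNReal.mul_div_mul_left _ _ (by simp) (by simp)]
        exact ENNReal.div_le_div_right (lintegral_mono_set hPP'.subset) _
    _ ≤ 2 ^ d * (8 * avg f R) := by gcongr
    _ = _ := by ring

theorem ae_enorm_le_of_not_mem_stopCubes (hd : 0 < d) (hf : LocallyIntegrable f) {R : Cube d}
    (hR : R ∈ D.cubes) : ∀ᵐ x, x ∈ R.toSet → (∀ P ∈ stopCubes D κ a T f R, x ∉ P.toSet) →
      ‖f x‖ₑ ≤ 8 * avg f R := by
  filter_upwards [D.ae_tendsto_avg hf] with x hx hxR hP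
  refine le_of_tendsto hx ?_
  filter_upwards [eventually_lt_atBot R.scale] with k hk
  by_contra hlt
  obtain ⟨P, hP1, hP2, -⟩ := exists_stopCube (j := k) hd hR hxR
    ⟨k, le_rfl, hk, Or.inl (not_le.1 hlt)⟩
  exact hP P hP1 hP2

/-- The degenerate case, set apart because the volume estimate divides by the average over $R$. -/
theorem stopCubes_eq_empty (ha : LocalKernel D κ a) {R : Cube d} (hR : R ∈ D.cubes)
    (h0 : avg f R = 0) : stopCubes D κ a T f R = ∅ := by
  have hz : ∀ P ∈ D.cubes, P.toSet ⊆ R.toSet → avg f P = 0 := by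
    intro P _ hPR
    rw [avg, ENNReal.div_eq_zero_iff] at h0 ⊢
    left
    rcases h0 with h0 | h0
    · exact le_antisymm ((lintegral_mono_set hPR).trans h0.le) zero_le
    · exact absurd h0 R.volume_ne_top
  refine Set.eq_empty_iff_forall_notMem.2 fun P hP => ?_
  rcases hP.2.2.1 with h | ⟨x, hx, h⟩
  · rw [hz P hP.1 hP.2.1.subset] at h; exact not_lt_zero h
  · rw [h0, mul_zero] at h
    refine h.ne' ?_
    rw [enorm_eq_zero]
    refine Finset.sum_eq_zero fun i hi => ?_
    rw [← enorm_eq_zero]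
    refine le_antisymm ((ha.enorm_kernelOp_le i f x).trans_eq (hz _ (D.cubeAt_mem _ _) ?_)) zero_le
    exact D.subset_of_mem (D.cubeAt_mem _ _) hR (by simpa using (Finset.mem_Icc.1 hi).2)
      (D.mem_cubeAt _ _) (hP.2.1.subset hx)

/-! ### The Calderón–Zygmund decomposition along the stopping cubes -/

open Classical in
/-- The good part of `f` on `R`: averages over the stopping cubes, and `f` off them. -/
def goodPart (D : DyadicGrid d) (κ : ℕ) (a : ℤ → (Fin d → ℝ) → (Fin d → ℝ) → ℂ) (T : ℝ≥0)
    (f : (Fin d → ℝ) → ℂ) (R : Cube d) (x : Fin d → ℝ) : ℂ :=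
  if h : ∃ P, P ∈ stopCubes D κ a T f R ∧ x ∈ P.toSet then ⨍ y in h.choose.toSet, f y
  else R.toSet.indicator f x

theorem goodPart_of_mem (hd : 0 < d) {R P : Cube d} (hP : P ∈ stopCubes D κ a T f R)
    {x : Fin d → ℝ} (hx : x ∈ P.toSet) : goodPart D κ a T f R x = ⨍ y in P.toSet, f y := by
  have h : ∃ P, P ∈ stopCubes D κ a T f R ∧ x ∈ P.toSet := ⟨P, hP, hx⟩
  rw [goodPart, dif_pos h]
  have : h.choose = P := by
    by_contra hne
    exact Set.disjoint_left.1 (stopCubes_pairwiseDisjoint hd R h.choose_spec.1 hP hne)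
      h.choose_spec.2 hx
  rw [this]

theorem goodPart_of_not_mem {R : Cube d} {x : Fin d → ℝ}
    (h : ∀ P ∈ stopCubes D κ a T f R, x ∉ P.toSet) :
    goodPart D κ a T f R x = R.toSet.indicator f x := by
  rw [goodPart, dif_neg]
  rintro ⟨P, h1, h2⟩
  exact h P h1 h2

theorem goodPart_eq_zero {R : Cube d} {x : Fin d → ℝ} (hx : x ∉ R.toSet) :
    goodPart D κ a T f R x = 0 := by
  rw [goodPart_of_not_mem fun P hP h => hx (hP.2.1.subset h), Set.indicator_of_notMem hx]

theorem enorm_average_le (f : (Fin d → ℝ) → ℂ) (P : Cube d) :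
    ‖⨍ y in P.toSet, f y‖ₑ ≤ avg f P := by
  rw [setAverage_eq, enorm_smul, avg, mul_comm, div_eq_mul_inv]
  gcongr
  · exact enorm_integral_le_lintegral_enorm _
  · rw [enorm_inv, Real.enorm_of_nonneg (by positivity), Measure.real,
      ENNReal.ofReal_toReal P.volume_ne_top]
    · simp [Measure.real, ENNReal.toReal_eq_zero_iff, P.volume_ne_zero, P.volume_ne_top]

/-- The function is constant on each of countably many stopping cubes and equals $\mathbf 1_Rf$ off
their union. -/
theorem aestronglyMeasurable_goodPart (hd : 0 < d) (hf : LocallyIntegrable f) (R : Cube d) :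
    AEStronglyMeasurable (goodPart D κ a T f R) volume := by
  have hcount : (stopCubes D κ a T f R).Countable := D.countable_subset fun P hP => hP.1
  have := hcount.to_subtype
  let U : Set (Fin d → ℝ) := ⋃ P ∈ stopCubes D κ a T f R, P.toSet
  have hU : MeasurableSet U := MeasurableSet.biUnion hcount fun P _ => P.measurableSet_toSet
  have huniv : (⋃ o : Option (stopCubes D κ a T f R),
      o.elim Uᶜ fun P => P.1.toSet) = Set.univ := by
    refine Set.eq_univ_of_forall fun x => ?_
    by_cases hx : x ∈ U
    · simp only [U, Set.mem_iUnion] at hx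
      obtain ⟨P, hP, hx⟩ := hx
      exact Set.mem_iUnion.2 ⟨some ⟨P, hP⟩, hx⟩
    · exact Set.mem_iUnion.2 ⟨none, hx⟩
  rw [← Measure.restrict_univ (μ := volume), ← huniv, aestronglyMeasurable_iUnion_iff]
  rintro (_ | P)
  · refine ((hf.aestronglyMeasurable.indicator R.measurableSet_toSet).restrict
      (s := Uᶜ)).congr ?_
    filter_upwards [ae_restrict_mem hU.compl] with x hx
    refine (goodPart_of_not_mem fun P hP h => hx ?_).symm
    exact Set.mem_biUnion hP h
  · refine (aestronglyMeasurable_const (b := ⨍ y in P.1.toSet, f y)).congr ?_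
    filter_upwards [ae_restrict_mem P.1.measurableSet_toSet] with x hx
    exact (goodPart_of_mem hd P.2 hx).symm

theorem ae_enorm_goodPart_le (hd : 0 < d) (hf : LocallyIntegrable f) {R : Cube d}
    (hR : R ∈ D.cubes) :
    ∀ᵐ x, ‖goodPart D κ a T f R x‖ₑ ≤ 8 * 2 ^ d * avg f R := by
  filter_upwards [ae_enorm_le_of_not_mem_stopCubes (D := D) (κ := κ) (a := a) (T := T) hd hf hR]
    with x hx
  by_cases h : ∃ P ∈ stopCubes D κ a T f R, x ∈ P.toSet
  · obtain ⟨P, hP, hxP⟩ := h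
    rw [goodPart_of_mem hd hP hxP]
    exact (enorm_average_le f P).trans (avg_stopCube_le hd hR hP)
  · push Not at h
    rw [goodPart_of_not_mem h]
    by_cases hxR : x ∈ R.toSet
    · rw [Set.indicator_of_mem hxR]
      refine (hx hxR h).trans ?_
      gcongr
      exact le_mul_of_one_le_right zero_le (one_le_pow₀ (by norm_num))
    · rw [Set.indicator_of_notMem hxR]; simp

end

theorem locallyIntegrable_of_bounded {g : (Fin d → ℝ) → ℂ} (hg : AEStronglyMeasurable g volume)
    {M : ℝ≥0} (hM : ∀ᵐ x, ‖g x‖ₑ ≤ M) : LocallyIntegrable g := by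
  refine MemLp.locallyIntegrable (p := ⊤) (memLp_top_of_bound hg M ?_) le_top
  filter_upwards [hM] with x hx
  rw [enorm_le_coe] at hx
  exact_mod_cast hx

theorem integrableOn_cube {f : (Fin d → ℝ) → ℂ} (hf : LocallyIntegrable f) (Q : Cube d) :
    IntegrableOn f Q.toSet :=
  ⟨hf.aestronglyMeasurable.restrict, by
    rw [HasFiniteIntegral, ← avg_mul_volume]
    exact ENNReal.mul_lt_top (avg_ne_top hf Q).lt_top Q.volume_ne_top.lt_top⟩

/-! ### The bad part, and sparsity of the stopping cubes. -/

section

variable {D : DyadicGrid d} {κ : ℕ} {a : ℤ → (Fin d → ℝ) → (Fin d → ℝ) → ℂ} {T : ℝ≥0}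
  {f : (Fin d → ℝ) → ℂ}

/-- The contribution at scale `i` of the bad part of `f` carried by the cube `P`. -/
def badBound (D : DyadicGrid d) (f : (Fin d → ℝ) → ℂ) (P : Cube d) (i : ℤ) (x : Fin d → ℝ) :
    ℝ≥0∞ :=
  (D.cubeAt i P.corner).toSet.indicator
    (fun _ => 2 * (∫⁻ y in P.toSet, ‖f y‖ₑ) / volume (D.cubeAt i P.corner).toSet) x

theorem measurable_badBound (P : Cube d) (i : ℤ) : Measurable (badBound D f P i) :=
  measurable_const.indicator (Cube.measurableSet_toSet _)

theorem lintegral_badBound (P : Cube d) (i : ℤ) :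
    ∫⁻ x, badBound D f P i x = 2 * ∫⁻ y in P.toSet, ‖f y‖ₑ := by
  simp only [badBound]
  rw [lintegral_indicator_const (Cube.measurableSet_toSet _),
    ENNReal.div_mul_cancel (Cube.volume_ne_zero _) (Cube.volume_ne_top _)]

/-- At scales beyond $P$ by more than $\kappa$ generations the kernel is constant in $y\in P$, so
the mean-zero piece is annihilated. At scales up to that of $P$ the kernel does not leave $P$. Only
$\kappa$ scales remain, which is the source of the linear dependence on $\kappa$. -/
theorem enorm_setIntegral_bad_le (ha : LocalKernel D κ a) (hf : LocallyIntegrable f)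
    {P : Cube d} (hP : P ∈ D.cubes) {i : ℤ} {x : Fin d → ℝ} (hxP : x ∉ P.toSet ∨ P.scale < i) :
    ‖∫ y in P.toSet, a i x y * (f y - ⨍ z in P.toSet, f z)‖ₑ ≤
      if P.scale + 1 ≤ i ∧ i ≤ P.scale + κ then badBound D f P i x else 0 := by
  have hfP := integrableOn_cube hf P
  set c := ⨍ z in P.toSet, f z with hc
  have hz : ∀ u, (∀ y ∈ P.toSet, a i x y = u) →
      ∫ y in P.toSet, a i x y * (f y - c) = u * (∫ y in P.toSet, (f y - c)) := by
    intro u hu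
    rw [← integral_const_mul]
    refine setIntegral_congr_fun P.measurableSet_toSet fun y hy => ?_
    simp only [hu y hy]
  by_cases h1 : P.scale + 1 ≤ i
  · by_cases h2 : i ≤ P.scale + κ
    · rw [if_pos ⟨h1, h2⟩]
      by_cases hx : x ∈ (D.cubeAt i P.corner).toSet
      · rw [badBound, Set.indicator_of_mem hx]
        refine (enorm_integral_le_lintegral_enorm _).trans ?_
        have hcle : ∫⁻ y in P.toSet, ‖f y - c‖ₑ ≤ 2 * ∫⁻ y in P.toSet, ‖f y‖ₑ := by
          calc ∫⁻ y in P.toSet, ‖f y - c‖ₑ ≤ ∫⁻ y in P.toSet, (‖f y‖ₑ + ‖c‖ₑ) :=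
                lintegral_mono fun y => enorm_sub_le
            _ = (∫⁻ y in P.toSet, ‖f y‖ₑ) + ‖c‖ₑ * volume P.toSet := by
                rw [lintegral_add_right _ measurable_const]; simp
            _ ≤ (∫⁻ y in P.toSet, ‖f y‖ₑ) + avg f P * volume P.toSet := by
                gcongr; exact enorm_average_le f P
            _ = _ := by rw [avg_mul_volume]; ring
        calc ∫⁻ y in P.toSet, ‖a i x y * (f y - c)‖ₑ
            ≤ ∫⁻ y in P.toSet, (volume (D.cubeAt i P.corner).toSet)⁻¹ * ‖f y - c‖ₑ := by
              refine lintegral_mono fun y => ?_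
              rw [enorm_mul]
              gcongr
              exact ha.enorm_le i x y _
          _ = (volume (D.cubeAt i P.corner).toSet)⁻¹ * ∫⁻ y in P.toSet, ‖f y - c‖ₑ :=
              lintegral_const_mul' _ _ (ENNReal.inv_ne_top.2 (Cube.volume_ne_zero _))
          _ ≤ _ := by
              rw [mul_comm, ← div_eq_mul_inv]
              gcongr
      · rw [hz 0 fun y hy => ha.zero i x y fun h => hx ?_]
        · simp
        · rw [D.mem_cubeAt_iff, h]
          refine D.cubeAt_mono (j := P.scale) (by omega) ?_
          rw [D.cubeAt_scale_eq hP hy, D.cubeAt_scale_eq hP P.corner_mem]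
    · rw [if_neg (by tauto), hz (a i x P.corner) fun y hy =>
        ha.const i P.scale x x y P.corner (by omega) rfl ?_]
      · have : ∫ y in P.toSet, (f y - c) = 0 := by
          rw [integral_sub hfP (integrableOn_const P.volume_ne_top), setIntegral_const,
            hc, measure_smul_setAverage _ P.volume_ne_top, sub_self]
        rw [this]; simp
      · rw [D.cubeAt_scale_eq hP hy, D.cubeAt_scale_eq hP P.corner_mem]
  · rw [if_neg (by tauto), hz 0 fun y hy => ha.zero i x y fun h => ?_]
    · simp
    · have hxP' : x ∉ P.toSet := by
        rcases hxP with h' | h'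
        · exact h'
        · omega
      have := D.cubeAt_mono (k := P.scale) (by omega) h
      rw [D.cubeAt_scale_eq hP hy] at this
      exact hxP' (this ▸ D.mem_cubeAt _ x)

theorem enorm_kernelOp_sub_goodPart_le (ha : LocalKernel D κ a) (hd : 0 < d)
    (hf : LocallyIntegrable f) {R : Cube d} (hR : R ∈ D.cubes)
    (hg : LocallyIntegrable (goodPart D κ a T f R)) {P : Cube d}
    (hP : P ∈ stopCubes D κ a T f R) {x : Fin d → ℝ} (hx : x ∈ P.toSet) {i : ℤ}
    (hi : P.scale + κ + 1 ≤ i) (hiR : i ≤ R.scale) :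
    ‖kernelOp (a i) f x - kernelOp (a i) (goodPart D κ a T f R) x‖ₑ ≤
      ∑' P' : stopCubes D κ a T f R,
        if P'.1.scale + 1 ≤ i ∧ i ≤ P'.1.scale + κ then badBound D f P'.1 i x else 0 := by
  have hcount : (stopCubes D κ a T f R).Countable := D.countable_subset fun P hP => hP.1
  have := hcount.to_subtype
  set g := goodPart D κ a T f R with hgdef
  have hxR := hP.2.1.subset hx
  have hsub : (D.cubeAt i x).toSet ⊆ R.toSet :=
    D.subset_of_mem (D.cubeAt_mem _ _) hR (by simpa) (D.mem_cubeAt _ _) hxR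
  have e1 : kernelOp (a i) f x - kernelOp (a i) g x = ∫ y, a i x y * (f y - g y) := by
    simp only [kernelOp, mul_sub]
    rw [integral_sub (ha.integrable_mul i hf x) (ha.integrable_mul i hg x)]
  have hint : Integrable (fun y => a i x y * (f y - g y)) := by
    simp only [mul_sub]
    exact (ha.integrable_mul i hf x).sub (ha.integrable_mul i hg x)
  have e2 : ∫ y, a i x y * (f y - g y) =
      ∫ y in ⋃ P' : stopCubes D κ a T f R, P'.1.toSet, a i x y * (f y - g y) := by
    refine (setIntegral_eq_integral_of_forall_compl_eq_zero fun y hy => ?_).symm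
    by_cases hyR : y ∈ R.toSet
    · rw [hgdef, goodPart_of_not_mem, Set.indicator_of_mem hyR]
      · simp
      · exact fun P' hP' h => hy (Set.mem_iUnion.2 ⟨⟨P', hP'⟩, h⟩)
    · rw [ha.zero i x y fun h => hyR (hsub (D.mem_cubeAt_iff.2 h.symm))]; simp
  rw [e1, e2, integral_iUnion (fun P' => P'.1.measurableSet_toSet) ?_ hint.integrableOn]
  · refine enorm_tsum_le_tsum_enorm.trans (ENNReal.tsum_le_tsum fun P' => ?_)
    have : ∫ y in P'.1.toSet, a i x y * (f y - g y) =
        ∫ y in P'.1.toSet, a i x y * (f y - ⨍ z in P'.1.toSet, f z) := by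
      refine setIntegral_congr_fun P'.1.measurableSet_toSet fun y hy => ?_
      simp only [hgdef, goodPart_of_mem hd P'.2 hy]
    rw [this]
    refine enorm_setIntegral_bad_le ha hf P'.2.1 ?_
    -- The point $x$ lies in $P$, hence outside every other stopping cube; for $P$ itself the scale
    -- $i$ is already larger.
    by_cases hPP : P = P'.1
    · right; rw [← hPP]; omega
    · left
      exact fun h => Set.disjoint_left.1 (stopCubes_pairwiseDisjoint hd R hP P'.2 hPP) hx h
  · intro P₁ P₂ hne
    exact stopCubes_pairwiseDisjoint hd R P₁.2 P₂.2 fun h => hne (Subtype.ext h)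

/-- The total contribution of the bad part. -/
def badSum (D : DyadicGrid d) (κ : ℕ) (a : ℤ → (Fin d → ℝ) → (Fin d → ℝ) → ℂ) (T : ℝ≥0)
    (f : (Fin d → ℝ) → ℂ) (R : Cube d) (x : Fin d → ℝ) : ℝ≥0∞ :=
  ∑' P : stopCubes D κ a T f R,
    ∑ i ∈ Finset.Icc (P.1.scale + 1) (P.1.scale + κ), badBound D f P.1 i x

theorem tsum_setLIntegral_stopCubes (hd : 0 < d) (R : Cube d) (g : (Fin d → ℝ) → ℝ≥0∞) :
    ∑' P : stopCubes D κ a T f R, ∫⁻ x in P.1.toSet, g x ≤ ∫⁻ x in R.toSet, g x := by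
  have hcount : (stopCubes D κ a T f R).Countable := D.countable_subset fun P hP => hP.1
  have := hcount.to_subtype
  rw [← lintegral_iUnion (s := fun P : stopCubes D κ a T f R => P.1.toSet)
    (fun P => P.1.measurableSet_toSet)
    fun P₁ P₂ hne => stopCubes_pairwiseDisjoint hd R P₁.2 P₂.2 fun h => hne (Subtype.ext h)]
  exact lintegral_mono_set (Set.iUnion_subset fun P => P.2.2.1.subset)

/-- Each bad piece spreads mass at most $2\int_P|f|$ at each of its $\kappa$ scales. -/
theorem lintegral_badSum_le (hd : 0 < d) (R : Cube d) :
    ∫⁻ x, badSum D κ a T f R x ≤ 2 * κ * ∫⁻ x in R.toSet, ‖f x‖ₑ := by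
  have hcount : (stopCubes D κ a T f R).Countable := D.countable_subset fun P hP => hP.1
  have := hcount.to_subtype
  simp only [badSum]
  rw [lintegral_tsum fun P => (Finset.measurable_sum _ fun i _ =>
    measurable_badBound P.1 i).aemeasurable]
  calc _ = ∑' P : stopCubes D κ a T f R, 2 * κ * ∫⁻ x in P.1.toSet, ‖f x‖ₑ := by
        refine tsum_congr fun P => ?_
        rw [lintegral_finsetSum _ fun i _ => measurable_badBound P.1 i]
        simp only [lintegral_badBound, Finset.sum_const, Int.card_Icc, nsmul_eq_mul]
        have : (P.1.scale + κ + 1 - (P.1.scale + 1)).toNat = κ := by omega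
        rw [this]; ring
    _ ≤ _ := by
        rw [ENNReal.tsum_mul_left]
        gcongr
        exact tsum_setLIntegral_stopCubes hd R _

theorem sum_enorm_sub_goodPart_le (ha : LocalKernel D κ a) (hd : 0 < d)
    (hf : LocallyIntegrable f) {R : Cube d} (hR : R ∈ D.cubes)
    (hg : LocallyIntegrable (goodPart D κ a T f R)) {P : Cube d}
    (hP : P ∈ stopCubes D κ a T f R) {x : Fin d → ℝ} (hx : x ∈ P.toSet) :
    ∑ i ∈ Finset.Icc (P.scale + κ + 1) R.scale,
      ‖kernelOp (a i) f x - kernelOp (a i) (goodPart D κ a T f R) x‖ₑ ≤ badSum D κ a T f R x := by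
  calc _ ≤ ∑ i ∈ Finset.Icc (P.scale + κ + 1) R.scale, ∑' P' : stopCubes D κ a T f R,
        if P'.1.scale + 1 ≤ i ∧ i ≤ P'.1.scale + κ then badBound D f P'.1 i x else 0 :=
        Finset.sum_le_sum fun i hi => enorm_kernelOp_sub_goodPart_le ha hd hf hR hg hP hx
          (Finset.mem_Icc.1 hi).1 (Finset.mem_Icc.1 hi).2
    _ = ∑' P' : stopCubes D κ a T f R, ∑ i ∈ Finset.Icc (P.scale + κ + 1) R.scale,
        if P'.1.scale + 1 ≤ i ∧ i ≤ P'.1.scale + κ then badBound D f P'.1 i x else 0 :=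
        (Summable.tsum_finsetSum fun _ _ => ENNReal.summable).symm
    _ ≤ _ := by
        refine ENNReal.tsum_le_tsum fun P' => ?_
        rw [← Finset.sum_filter]
        refine Finset.sum_le_sum_of_subset fun i hi => ?_
        simp only [Finset.mem_filter] at hi
        exact Finset.mem_Icc.2 hi.2

/-- The threshold for the truncated sums in the stopping condition. -/
def stopThreshold (d : ℕ) (B : ℝ≥0) : ℝ≥0 := 16 + 2 ^ d * (96 + 72 * B)

/-- The measure of a stopping cube is controlled by the three quantities that may cause it. -/
theorem volume_stopCube_le {B : ℝ≥0} (hB : KernelL2Bounded a B) (ha : LocalKernel D κ a)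
    (hκ : 1 ≤ κ) (hd : 0 < d) (hf : LocallyIntegrable f) {R : Cube d} (hR : R ∈ D.cubes)
    (hT : T = stopThreshold d B) : ∃ G : (Fin d → ℝ) → ℂ,
      ∫⁻ x in R.toSet, ‖G x‖ₑ ≤ B * (8 * 2 ^ d * avg f R) * volume R.toSet ∧
      ∀ P ∈ stopCubes D κ a T f R,
        16 * (4 * 2 ^ d * (B + 1)) * κ * avg f R * volume P.toSet ≤
          2 * (4 * 2 ^ d * (B + 1)) * κ * (∫⁻ x in P.toSet, ‖f x‖ₑ) +
          (4 * 2 ^ d * (B + 1)) * (∫⁻ x in P.toSet, badSum D κ a T f R x) +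
          ∫⁻ x in P.toSet, ‖G x‖ₑ := by
  have hft := avg_ne_top hf R
  set g := goodPart D κ a T f R with hgdef
  have hgm := aestronglyMeasurable_goodPart (D := D) (κ := κ) (a := a) (T := T) hd hf R
  obtain ⟨A, hA⟩ : ∃ A : ℝ≥0, (A : ℝ≥0∞) = avg f R := ⟨_, ENNReal.coe_toNNReal hft⟩
  have hM : ∀ᵐ x, ‖g x‖ₑ ≤ (8 * 2 ^ d * A : ℝ≥0) := by
    have := ae_enorm_goodPart_le (D := D) (κ := κ) (a := a) (T := T) hd hf hR
    push_cast
    rwa [hA]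
  have hgint : LocallyIntegrable g := locallyIntegrable_of_bounded hgm hM
  obtain ⟨G, hGm, hGlim, hGle⟩ := hB.exists_limit ha hgm hM fun x hx => goodPart_eq_zero hx
  refine ⟨G, by push_cast at hGle; rwa [hA] at hGle, fun P hP => ?_⟩
  set L : ℝ≥0∞ := 4 * 2 ^ d * (B + 1) with hL
  have hlt := D.scale_lt_of_ssubset hd hP.1 hR hP.2.1
  have hκ' : (1 : ℝ≥0∞) ≤ κ := by exact_mod_cast hκ
  -- If the inequality failed, each of the three terms would be small on $P$, and neither reason for
  -- stopping could occur.
  by_contra hcon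
  rw [not_le] at hcon
  rcases hP.2.2.1 with h | ⟨x, hx, h⟩
  · refine hcon.not_ge ?_
    calc 16 * L * κ * avg f R * volume P.toSet = 2 * L * κ * (8 * avg f R * volume P.toSet) := by
          ring
      _ ≤ 2 * L * κ * (avg f P * volume P.toSet) := by gcongr
      _ = 2 * L * κ * (∫⁻ x in P.toSet, ‖f x‖ₑ) := by rw [avg_mul_volume]
      _ ≤ _ := by rw [add_assoc]; exact le_self_add
  · have hscale : P.scale + κ + 1 ≤ R.scale := by
      by_contra hlt'
      rw [Finset.Icc_eq_empty hlt'] at h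
      simp at h
    have hL0 : L ≠ 0 := by simp [hL]
    have hLt : L ≠ ∞ := by simp [hL, ENNReal.mul_eq_top]
    have hcot := cotlar_of_bounded hB ha hd hM hR (fun x hx => goodPart_eq_zero hx) hGm hgm hGlim
      hP.1 hscale hx
    set Λf := ∑ i ∈ Finset.Icc (P.scale + κ + 1) R.scale, kernelOp (a i) f x with hΛf
    set Λg := ∑ i ∈ Finset.Icc (P.scale + κ + 1) R.scale, kernelOp (a i) g x with hΛg
    have hbadpt : ∀ z ∈ P.toSet, ‖Λf - Λg‖ₑ ≤ badSum D κ a T f R z := by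
      intro z hz
      refine le_trans ?_ (sum_enorm_sub_goodPart_le ha hd hf hR hgint hP hz)
      rw [hΛf, hΛg, ← Finset.sum_sub_distrib]
      refine (enorm_sum_le _ _).trans (Finset.sum_le_sum fun i hi => ?_)
      have e : D.cubeAt P.scale x = D.cubeAt P.scale z := by
        rw [D.cubeAt_scale_eq hP.1 hx, D.cubeAt_scale_eq hP.1 hz]
      rw [ha.kernelOp_congr (Finset.mem_Icc.1 hi).1 f e,
        ha.kernelOp_congr (Finset.mem_Icc.1 hi).1 g e]
    have hbad : ‖Λf - Λg‖ₑ * volume P.toSet ≤ ∫⁻ z in P.toSet, badSum D κ a T f R z := by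
      rw [← setLIntegral_const]
      exact setLIntegral_mono' P.measurableSet_toSet hbadpt
    have hb1 : ∫⁻ z in P.toSet, badSum D κ a T f R z ≤ 16 * κ * avg f R * volume P.toSet := by
      refine (ENNReal.mul_le_mul_iff_right hL0 hLt).1 ?_
      calc _ ≤ 16 * L * κ * avg f R * volume P.toSet :=
            le_trans (le_trans le_add_self le_self_add) hcon.le
        _ = _ := by ring
    have hb2 : ∫⁻ z in P.toSet, ‖G z‖ₑ ≤ 16 * L * κ * avg f R * volume P.toSet :=
      le_add_self.trans hcon.le
    refine absurd ((ENNReal.mul_lt_mul_iff_left P.volume_ne_zero P.volume_ne_top).2 h) (not_lt.2 ?_)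
    calc ‖Λf‖ₑ * volume P.toSet ≤ (‖Λf - Λg‖ₑ + ‖Λg‖ₑ) * volume P.toSet := by
          gcongr; exact enorm_le_enorm_sub_add _ _
      _ ≤ 16 * κ * avg f R * volume P.toSet + (16 * L * κ * avg f R * volume P.toSet +
          (κ + 2 + B) * (8 * 2 ^ d * A : ℝ≥0) * volume P.toSet) := by
          rw [add_mul]
          exact add_le_add (hbad.trans hb1) (hcot.trans (add_le_add hb2 le_rfl))
      _ ≤ 16 * κ * avg f R * volume P.toSet + (16 * L * κ * avg f R * volume P.toSet +
          (κ + 2 * κ + B * κ) * (8 * 2 ^ d * A : ℝ≥0) * volume P.toSet) := by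
          gcongr
          · exact le_mul_of_one_le_right zero_le hκ'
          · exact le_mul_of_one_le_right zero_le hκ'
      -- The budget behind `stopThreshold`: $16$ for the bad part, $16\cdot4\cdot2^d(B+1)$ for $G$,
      -- and $8\cdot2^d(3+B)$ for the Cotlar error, after $\kappa+2+B\le(3+B)\kappa$. A slack of
      -- $8\cdot2^d$ is left.
      _ ≤ T * κ * avg f R * volume P.toSet := by
          rw [← hA, hL, hT, stopThreshold]
          push_cast
          have : (16 + 2 ^ d * (96 + 72 * B) : ℝ≥0∞) =
            16 + 2 ^ d * (64 + 64 * B) + 2 ^ d * (24 + 8 * B) + 2 ^ d * 8 := by ring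
          rw [this]
          calc _ = (16 + 2 ^ d * (64 + 64 * B) + 2 ^ d * (24 + 8 * B) : ℝ≥0∞) * κ * A *
                volume P.toSet := by ring
            _ ≤ _ := mul_le_mul' (mul_le_mul' (mul_le_mul' le_self_add le_rfl) le_rfl) le_rfl

theorem isSparse_stopCubes {B : ℝ≥0} (hB : KernelL2Bounded a B) (ha : LocalKernel D κ a)
    (hκ : 1 ≤ κ) (hd : 0 < d) (hf : LocallyIntegrable f) :
    IsSparse D (stopCubes D κ a (stopThreshold d B) f) where
  mem R _ P hP := hP.1
  subset R _ P hP := hP.2.1.subset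
  disjoint R _ := stopCubes_pairwiseDisjoint hd R
  volume_le R hR := by
    by_cases h0 : avg f R = 0
    · rw [stopCubes_eq_empty ha hR h0]; simp
    have hft := avg_ne_top hf R
    obtain ⟨G, hG, hP⟩ := volume_stopCube_le hB ha hκ hd hf hR rfl
    set T := stopThreshold d B
    set L : ℝ≥0∞ := 4 * 2 ^ d * (B + 1) with hL
    have hL0 : L ≠ 0 := by simp [hL]
    have hLt : L ≠ ∞ := by simp [hL, ENNReal.mul_eq_top]
    have hκ' : (1 : ℝ≥0∞) ≤ κ := by exact_mod_cast hκ
    -- With $L=4\cdot2^d(B+1)$ each of the three terms sums to at most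
    -- $2L\kappa\langle|f|\rangle_R|R|$. The total $6$ is below $8$, half of the factor $16$ on the
    -- left.
    have hsum : 16 * L * κ * avg f R * ∑' P : stopCubes D κ a T f R, volume P.1.toSet ≤
        8 * L * κ * avg f R * volume R.toSet := by
      rw [← ENNReal.tsum_mul_left]
      calc _ ≤ ∑' P : stopCubes D κ a T f R, (2 * L * κ * (∫⁻ x in P.1.toSet, ‖f x‖ₑ) +
            L * (∫⁻ x in P.1.toSet, badSum D κ a T f R x) + ∫⁻ x in P.1.toSet, ‖G x‖ₑ) :=
            ENNReal.tsum_le_tsum fun P => hP P.1 P.2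
        _ ≤ 2 * L * κ * (∫⁻ x in R.toSet, ‖f x‖ₑ) + L * (2 * κ * ∫⁻ x in R.toSet, ‖f x‖ₑ) +
            ∫⁻ x in R.toSet, ‖G x‖ₑ := by
            rw [ENNReal.tsum_add, ENNReal.tsum_add, ENNReal.tsum_mul_left, ENNReal.tsum_mul_left]
            gcongr
            · exact tsum_setLIntegral_stopCubes hd R _
            · exact (tsum_setLIntegral_stopCubes hd R _).trans
                ((setLIntegral_le_lintegral _ _).trans (lintegral_badSum_le hd R))
            · exact tsum_setLIntegral_stopCubes hd R _
        _ ≤ 2 * L * κ * (avg f R * volume R.toSet) + L * (2 * κ * (avg f R * volume R.toSet)) +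
            (B + 1) * (8 * 2 ^ d * avg f R) * volume R.toSet * κ := by
            rw [avg_mul_volume]
            gcongr
            refine hG.trans ?_
            refine le_trans ?_ (le_mul_of_one_le_right zero_le hκ')
            gcongr
            exact le_self_add
        _ = 6 * L * κ * avg f R * volume R.toSet := by rw [hL]; ring
        _ ≤ _ := by gcongr; norm_num
    have hc0 : 8 * L * κ * avg f R ≠ 0 := by
      simp [hL0, h0]; omega
    have hct : 8 * L * κ * avg f R ≠ ∞ := by
      simp [hLt, hft, ENNReal.mul_eq_top]
    rw [ENNReal.le_div_iff_mul_le (by simp) (by simp)]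
    refine (ENNReal.mul_le_mul_iff_right hc0 hct).1 ?_
    calc _ = 16 * L * κ * avg f R * ∑' P : stopCubes D κ a T f R, volume P.1.toSet := by ring
      _ ≤ _ := hsum

end

/-! ### Weights as measures; an $A_p$ weight and its dual form a pair. -/

theorem lintegral_weightMeasure {s : (Fin d → ℝ) → ℝ} (hs : AEMeasurable s volume)
    (h : (Fin d → ℝ) → ℝ≥0∞) (hh : AEMeasurable h volume) :
    ∫⁻ x, h x ∂(weightMeasure s) = ∫⁻ x, ENNReal.ofReal (s x) * h x := by
  rw [weightMeasure, lintegral_withDensity_eq_lintegral_mul₀ hs.ennreal_ofReal hh]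
  rfl

theorem setLIntegral_weightMeasure {s : (Fin d → ℝ) → ℝ} (hs : AEMeasurable s volume)
    (h : (Fin d → ℝ) → ℝ≥0∞) (hh : AEMeasurable h volume) {E : Set (Fin d → ℝ)}
    (hE : MeasurableSet E) :
    ∫⁻ x in E, h x ∂(weightMeasure s) = ∫⁻ x in E, ENNReal.ofReal (s x) * h x := by
  rw [weightMeasure, setLIntegral_withDensity_eq_lintegral_mul₀ hs.ennreal_ofReal hh hE]
  rfl

theorem weightMeasure_apply (s : (Fin d → ℝ) → ℝ) {E : Set (Fin d → ℝ)}
    (hE : MeasurableSet E) : weightMeasure s E = ∫⁻ x in E, ENNReal.ofReal (s x) :=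
  withDensity_apply _ hE

theorem weightMeasure_absolutelyContinuous (s : (Fin d → ℝ) → ℝ) :
    weightMeasure s ≪ volume :=
  withDensity_absolutelyContinuous _ _

theorem weightMeasure_ne_zero {s : (Fin d → ℝ) → ℝ} (hm : AEMeasurable s volume)
    (hs : ∀ᵐ x, 0 < s x) {E : Set (Fin d → ℝ)} (hE : MeasurableSet E) (h0 : volume E ≠ 0) :
    weightMeasure s E ≠ 0 := by
  rw [weightMeasure_apply s hE]
  intro h
  rw [lintegral_eq_zero_iff' hm.ennreal_ofReal.restrict] at h
  have : ∀ᵐ x ∂(volume.restrict E), False := by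
    filter_upwards [h, ae_restrict_of_ae hs] with x h1 h2
    simp only [Pi.zero_apply, ENNReal.ofReal_eq_zero] at h1
    linarith
  rw [ae_iff] at this
  simp at this
  exact h0 this

theorem dualWeight_pos {w : (Fin d → ℝ) → ℝ} (p : ℝ) (hs : ∀ᵐ x, 0 < w x) :
    ∀ᵐ x, 0 < dualWeight w p x := by
  filter_upwards [hs] with x hx
  exact Real.rpow_pos_of_pos hx _

theorem aemeasurable_dualWeight {w : (Fin d → ℝ) → ℝ} (p : ℝ) (hw : AEMeasurable w volume) :
    AEMeasurable (dualWeight w p) volume :=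
  hw.pow_const _

namespace IsApWeight

variable {w : (Fin d → ℝ) → ℝ} {p : ℝ}

theorem mul_le_apConst (w : (Fin d → ℝ) → ℝ) (p : ℝ) (Q : Cube d) :
    (weightMeasure w Q.toSet / volume Q.toSet) *
    (weightMeasure (dualWeight w p) Q.toSet / volume Q.toSet) ^ (p - 1) ≤ apConst w p :=
  le_iSup (fun Q : Cube d => (weightMeasure w Q.toSet / volume Q.toSet) *
    (weightMeasure (dualWeight w p) Q.toSet / volume Q.toSet) ^ (p - 1)) Q

theorem weight_ne_zero (hw : IsApWeight w p) (Q : Cube d) : weightMeasure w Q.toSet ≠ 0 :=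
  weightMeasure_ne_zero hw.meas hw.pos Q.measurableSet_toSet Q.volume_ne_zero

theorem dual_ne_zero (hw : IsApWeight w p) (Q : Cube d) :
    weightMeasure (dualWeight w p) Q.toSet ≠ 0 :=
  weightMeasure_ne_zero (aemeasurable_dualWeight p hw.meas) (dualWeight_pos p hw.pos)
    Q.measurableSet_toSet Q.volume_ne_zero

theorem weight_ne_top (hw : IsApWeight w p) (hp : 1 < p) (Q : Cube d) :
    weightMeasure w Q.toSet ≠ ∞ := by
  intro h
  have h1 := (mul_le_apConst w p Q).trans_lt hw.finite
  rw [h, ENNReal.top_div_of_ne_top Q.volume_ne_top, ENNReal.top_mul] at h1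
  · exact lt_irrefl _ h1
  · have : 0 < weightMeasure (dualWeight w p) Q.toSet / volume Q.toSet :=
      ENNReal.div_pos (hw.dual_ne_zero Q) Q.volume_ne_top
    exact (ENNReal.rpow_pos_of_nonneg this (by linarith)).ne'

theorem dual_ne_top (hw : IsApWeight w p) (hp : 1 < p) (Q : Cube d) :
    weightMeasure (dualWeight w p) Q.toSet ≠ ∞ := by
  intro h
  have h1 := (mul_le_apConst w p Q).trans_lt hw.finite
  rw [h, ENNReal.top_div_of_ne_top Q.volume_ne_top, ENNReal.top_rpow_of_pos (by linarith),
    ENNReal.mul_top] at h1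
  · exact lt_irrefl _ h1
  · exact (ENNReal.div_pos (hw.weight_ne_zero Q) Q.volume_ne_top).ne'

theorem apPair (hw : IsApWeight w p) (hp : 1 < p) (D : DyadicGrid d) :
    ApPair D (weightMeasure w) (weightMeasure (dualWeight w p)) p (apConst w p) where
  left_ne_zero Q _ := hw.weight_ne_zero Q
  left_ne_top Q _ := hw.weight_ne_top hp Q
  right_ne_zero Q _ := hw.dual_ne_zero Q
  right_ne_top Q _ := hw.dual_ne_top hp Q
  mul_le Q _ := by
    have h := mul_le_apConst w p Q
    have hp' : 0 < p - 1 := by linarith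
    have e : volume Q.toSet ^ p = volume Q.toSet * volume Q.toSet ^ (p - 1) := by
      nth_rw 2 [← ENNReal.rpow_one (volume Q.toSet)]
      rw [← ENNReal.rpow_add _ _ Q.volume_ne_zero Q.volume_ne_top]
      ring_nf
    have hv0 : volume Q.toSet ^ (p - 1) ≠ 0 := by simp [Q.volume_ne_zero, Q.volume_ne_top]
    have hvt : volume Q.toSet ^ (p - 1) ≠ ∞ :=
      ENNReal.rpow_ne_top_of_nonneg hp'.le Q.volume_ne_top
    rw [e]
    calc _ = (weightMeasure w Q.toSet / volume Q.toSet * volume Q.toSet) *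
          (weightMeasure (dualWeight w p) Q.toSet ^ (p - 1) / volume Q.toSet ^ (p - 1) *
            volume Q.toSet ^ (p - 1)) := by
          rw [ENNReal.div_mul_cancel Q.volume_ne_zero Q.volume_ne_top,
            ENNReal.div_mul_cancel hv0 hvt]
      _ = (weightMeasure w Q.toSet / volume Q.toSet *
          (weightMeasure (dualWeight w p) Q.toSet / volume Q.toSet) ^ (p - 1)) *
          (volume Q.toSet * volume Q.toSet ^ (p - 1)) := by
          rw [ENNReal.div_rpow_of_nonneg _ _ hp'.le]; ring
      _ ≤ _ := by gcongr
  le_mul E hE := by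
    have hpq := Real.HolderConjugate.conjExponent hp
    have hp0 : 0 < p := by linarith
    set q := p.conjExponent with hq
    -- Hölder's inequality for $1=w^{1/p}\sigma^{1/q}$.
    have h1 : volume E ≤ weightMeasure w E ^ (1 / p) * weightMeasure (dualWeight w p) E ^ (1 / q) := by
      rw [weightMeasure_apply _ hE, weightMeasure_apply _ hE]
      refine le_trans (le_of_eq ?_) (ENNReal.lintegral_mul_norm_pow_le
        hw.meas.ennreal_ofReal.restrict (aemeasurable_dualWeight p hw.meas).ennreal_ofReal.restrict
        (by positivity) (by have := hpq.symm.pos; positivity) (by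
          rw [one_div, one_div]; exact hpq.inv_add_inv_eq_one))
      rw [← setLIntegral_one]
      refine lintegral_congr_ae ?_
      filter_upwards [ae_restrict_of_ae hw.pos] with x hx
      rw [ENNReal.ofReal_rpow_of_pos hx, ENNReal.ofReal_rpow_of_pos
        (show 0 < dualWeight w p x from Real.rpow_pos_of_pos hx _),
        ← ENNReal.ofReal_mul (by positivity), dualWeight, ← Real.rpow_mul hx.le,
        ← Real.rpow_add hx]
      have : 1 / p + (1 - q) * (1 / q) = 0 := by
        have h := hpq.inv_add_inv_eq_one
        have hq0 := hpq.symm.pos.ne'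
        rw [sub_mul, one_mul, mul_one_div_cancel hq0]
        rw [one_div, one_div]; linarith
      rw [← hq, this]; simp
    calc volume E ^ p ≤ (weightMeasure w E ^ (1 / p) *
          weightMeasure (dualWeight w p) E ^ (1 / q)) ^ p := by gcongr
      _ = _ := by
        rw [ENNReal.mul_rpow_of_nonneg _ _ hp0.le, ← ENNReal.rpow_mul, ← ENNReal.rpow_mul,
          one_div_mul_cancel hp0.ne', ENNReal.rpow_one]
        congr 2
        rw [one_div, ← div_eq_inv_mul]
        exact hpq.div_conj_eq_sub_one

end IsApWeight

theorem locallyIntegrable_of_weightMeasure {s : (Fin d → ℝ) → ℝ} (hm : AEMeasurable s volume)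
    (hs : ∀ᵐ x, 0 < s x) (hfin : ∀ Q : Cube d, weightMeasure s Q.toSet ≠ ∞) :
    LocallyIntegrable (fun x => (s x : ℂ)) := by
  intro x
  let Q : Cube d := ⟨fun i => x i - 1, 2, by norm_num⟩
  refine ⟨Q.toSet, ?_, Complex.measurable_ofReal.comp_aemeasurable hm |>.aestronglyMeasurable.restrict, ?_⟩
  · refine Filter.mem_of_superset (Metric.ball_mem_nhds x one_pos) fun y hy i => ?_
    have := (dist_le_pi_dist y x i).trans_lt hy
    rw [Real.dist_eq, abs_lt] at this
    simp only [Q]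
    constructor <;> linarith
  · have h := hfin Q
    rw [weightMeasure_apply _ Q.measurableSet_toSet] at h
    rw [HasFiniteIntegral]
    refine (lt_of_le_of_lt (le_of_eq ?_) h.lt_top)
    refine lintegral_congr_ae ?_
    filter_upwards [ae_restrict_of_ae hs] with y hy
    rw [← ofReal_norm, Complex.norm_real, Real.norm_of_nonneg hy.le]

/-! ### Intervals of scales, and duality for the linearized adjoint. -/

theorem LocalKernel.transpose {D : DyadicGrid d} {κ : ℕ}
    {a : ℤ → (Fin d → ℝ) → (Fin d → ℝ) → ℂ} (ha : LocalKernel D κ a) :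
    LocalKernel D κ fun k y x => a k x y where
  zero k x y h := ha.zero k y x h.symm
  bound k x y := ha.bound k y x
  const k j x x' y y' h hx hy := ha.const k j y y' x x' h hy hx

/-- A bound for the sum of the scale operators over an interval of scales, by a sparse function. -/
theorem enorm_sum_ordConnected_le {D : DyadicGrid d} {κ : ℕ}
    {a : ℤ → (Fin d → ℝ) → (Fin d → ℝ) → ℂ} {T : ℝ≥0} {f : (Fin d → ℝ) → ℂ}
    (ha : LocalKernel D κ a) (hκ : 1 ≤ κ) (hd : 0 < d) (K : ℕ) {R : Cube d} (hR : R ∈ D.cubes)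
    (hf : ∀ x ∉ R.toSet, f x = 0) {x : Fin d → ℝ} (hx : x ∈ R.toSet) (s : Finset ℤ)
    (hs : (s : Set ℤ).OrdConnected) (hK : ∀ i ∈ s, R.scale - i < K + 1) :
    ‖∑ i ∈ s, kernelOp (a i) f x‖ₑ ≤
      (33 + 2 * T) * κ * sparseSum (stopCubes D κ a T f) (avg f) (K + 1) R x := by
  set F := sparseSum (stopCubes D κ a T f) (avg f) (K + 1) R x with hF
  have hκ' : (1 : ℝ≥0∞) ≤ κ := by exact_mod_cast hκ
  -- Scales above $R$ act on a function carried by $R$ and cost one average over $R$, the top term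
  -- of the sparse sum.
  have hhigh : ‖∑ i ∈ s with ¬ i ≤ R.scale, kernelOp (a i) f x‖ₑ ≤ κ * F := by
    refine (enorm_sum_le _ _).trans ((ha.sum_enorm_kernelOp_le hd hR hf x _ fun k hk => ?_).trans ?_)
    · have := (Finset.mem_filter.1 hk).2; omega
    · refine le_trans ?_ (le_mul_of_one_le_left zero_le hκ')
      rw [hF, sparseSum, Set.indicator_of_mem hx]
      exact le_self_add
  have hlow : ‖∑ i ∈ s with i ≤ R.scale, kernelOp (a i) f x‖ₑ ≤ 2 * ((16 + T) * κ * F) := by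
    rcases (s.filter (· ≤ R.scale)).eq_empty_or_nonempty with h | h
    · rw [h]; simp
    · set u := s.filter (· ≤ R.scale) with hu
      set j := u.min' h
      set l := u.max' h
      have hju := Finset.mem_filter.1 (u.min'_mem h)
      have hlu := Finset.mem_filter.1 (u.max'_mem h)
      have hjl : j ≤ l := u.min'_le_max' h
      have e : u = Finset.Icc j l := by
        ext i
        rw [Finset.mem_Icc]
        refine ⟨fun hi => ⟨u.min'_le i hi, u.le_max' i hi⟩, fun hi => ?_⟩
        exact Finset.mem_filter.2 ⟨hs.out hju.1 hlu.1 hi, hi.2.trans hlu.2⟩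
      have e2 := sum_Icc_eq_add (fun i => kernelOp (a i) f x) (i := j) (j := l) (k := R.scale)
        (by omega) hlu.2
      -- An interval of scales is a difference of two sums that reach up to $R$, each sparsely
      -- dominated; hence the factor $2$.
      have e3 : ∑ i ∈ u, kernelOp (a i) f x = ∑ i ∈ Finset.Icc j R.scale, kernelOp (a i) f x -
          ∑ i ∈ Finset.Icc (l + 1) R.scale, kernelOp (a i) f x := by
        rw [e2, e]; ring
      have hjK := hK j hju.1
      rw [e3, two_mul]
      refine enorm_sub_le.trans (add_le_add ?_ ?_)
      · exact enorm_sum_le_sparseSum ha hκ hd (K + 1) hR hx (by push_cast; omega)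
      · exact enorm_sum_le_sparseSum ha hκ hd (K + 1) hR hx (by push_cast; omega)
  rw [← Finset.sum_filter_add_sum_filter_not s (· ≤ R.scale)]
  calc _ ≤ 2 * ((16 + T) * κ * F) + κ * F := (enorm_add_le _ _).trans (add_le_add hlow hhigh)
    _ = _ := by ring

namespace Linearization

variable (L : Linearization d) {D : DyadicGrid d} {κ : ℕ}
  {a : ℤ → (Fin d → ℝ) → (Fin d → ℝ) → ℂ}

theorem enorm_exp_mul (x : Fin d → ℝ) (z : ℂ) :
    ‖Complex.exp (L.ϑ x * Complex.I) * z‖ₑ = ‖z‖ₑ := by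
  rw [enorm_mul, ← ofReal_norm, Complex.norm_exp_ofReal_mul_I]; simp

theorem enorm_cutoff_le (k : ℤ) (g : (Fin d → ℝ) → ℂ) (x : Fin d → ℝ) :
    ‖L.cutoff k g x‖ₑ ≤ ‖g x‖ₑ := by
  refine (enorm_indicator_le_enorm_self _ _).trans ?_
  rw [L.enorm_exp_mul]

theorem aestronglyMeasurable_cutoff (k : ℤ) {g : (Fin d → ℝ) → ℂ}
    (hg : AEStronglyMeasurable g volume) : AEStronglyMeasurable (L.cutoff k g) volume := by
  have hs : NullMeasurableSet {x | L.ε x ≤ (2 : ℝ) ^ k ∧ (2 : ℝ) ^ k ≤ L.υ x} volume :=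
    (nullMeasurableSet_le L.ε_meas aemeasurable_const).inter
      (nullMeasurableSet_le aemeasurable_const L.υ_meas)
  refine AEStronglyMeasurable.indicator₀ (AEStronglyMeasurable.mul ?_ hg) hs
  exact (Complex.measurable_exp.comp_aemeasurable
    ((Complex.measurable_ofReal.comp_aemeasurable L.ϑ_meas).mul_const _)).aestronglyMeasurable

theorem integrable_cutoff (k : ℤ) {g : (Fin d → ℝ) → ℂ} (hg : Integrable g) :
    Integrable (L.cutoff k g) :=
  ⟨L.aestronglyMeasurable_cutoff k hg.1,
    (lintegral_mono fun x => L.enorm_cutoff_le k g x).trans_lt hg.2⟩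

theorem cutoff_congr (k : ℤ) {g g' : (Fin d → ℝ) → ℂ} {x : Fin d → ℝ}
    (h : L.ε x ≤ (2 : ℝ) ^ k → g x = g' x) : L.cutoff k g x = L.cutoff k g' x := by
  by_cases hx : L.ε x ≤ (2 : ℝ) ^ k ∧ (2 : ℝ) ^ k ≤ L.υ x
  · rw [cutoff, cutoff, Set.indicator_of_mem (by exact hx), Set.indicator_of_mem (by exact hx),
      h hx.1]
  · rw [cutoff, cutoff, Set.indicator_of_notMem (by exact hx), Set.indicator_of_notMem (by exact hx)]

open Classical in
theorem sum_cutoff_mul (s : Finset ℤ) (g : (Fin d → ℝ) → ℂ) (F : ℤ → ℂ) (x : Fin d → ℝ) :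
    ‖∑ k ∈ s, L.cutoff k g x * F k‖ₑ =
      ‖g x‖ₑ * ‖∑ k ∈ s with L.ε x ≤ (2 : ℝ) ^ k ∧ (2 : ℝ) ^ k ≤ L.υ x, F k‖ₑ := by
  have : ∑ k ∈ s, L.cutoff k g x * F k = Complex.exp (L.ϑ x * Complex.I) * (g x *
      ∑ k ∈ s with L.ε x ≤ (2 : ℝ) ^ k ∧ (2 : ℝ) ^ k ≤ L.υ x, F k) := by
    rw [Finset.sum_filter, Finset.mul_sum, Finset.mul_sum]
    refine Finset.sum_congr rfl fun k _ => ?_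
    simp only [cutoff, Set.indicator_apply, Set.mem_ofPred_eq]
    split_ifs <;> ring
  rw [this, L.enorm_exp_mul, enorm_mul]

theorem integrable_prod (ha : LocalKernel D κ a) (k : ℤ) {g f : (Fin d → ℝ) → ℂ}
    (hg : Integrable g) (hf : Integrable f) :
    Integrable (fun z : (Fin d → ℝ) × (Fin d → ℝ) => a k z.1 z.2 * (L.cutoff k g z.1 * f z.2))
      (volume.prod volume) := by
  refine Integrable.bdd_mul (c := (((2 : ℝ) ^ k) ^ d)⁻¹)
    ((L.integrable_cutoff k hg).mul_prod hf) ?_ ?_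
  · exact (ha.measurable k).aestronglyMeasurable
  · exact Eventually.of_forall fun z => ha.bound k z.1 z.2

open Classical in
/-- The duality between the adjoint and the linearized truncations. -/
theorem enorm_integral_adjoint_mul_le (ha : LocalKernel D κ a) (s : Finset ℤ)
    {g f : (Fin d → ℝ) → ℂ} (hg : Integrable g) (hf : Integrable f) :
    ‖∫ y, (∑ k ∈ s, L.adjointScale a k g y) * f y‖ₑ ≤
      ∫⁻ x, ‖g x‖ₑ * ‖∑ k ∈ s with L.ε x ≤ (2 : ℝ) ^ k ∧ (2 : ℝ) ^ k ≤ L.υ x,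
        kernelOp (a k) f x‖ₑ := by
  have h1 : ∀ k, ∀ y, L.adjointScale a k g y * f y =
      ∫ x, a k x y * (L.cutoff k g x * f y) := by
    intro k y
    rw [adjointScale, ← integral_mul_const]
    simp only [mul_assoc]
  have h2 : ∀ k, ∀ x, L.cutoff k g x * kernelOp (a k) f x =
      ∫ y, a k x y * (L.cutoff k g x * f y) := by
    intro k x
    rw [kernelOp, ← integral_const_mul]
    congr 1; ext y; ring
  have hint := fun k => L.integrable_prod ha k hg hf
  have e : ∫ y, (∑ k ∈ s, L.adjointScale a k g y) * f y =
      ∫ x, ∑ k ∈ s, L.cutoff k g x * kernelOp (a k) f x := by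
    simp only [Finset.sum_mul, h1, h2]
    rw [integral_finsetSum _ fun k _ => (hint k).integral_prod_right,
      integral_finsetSum _ fun k _ => (hint k).integral_prod_left]
    refine Finset.sum_congr rfl fun k _ => ?_
    -- Fubini is legitimate because each single scale has a bounded kernel and both functions are
    -- integrable.
    exact (integral_integral_swap (f := fun x y => a k x y * (L.cutoff k g x * f y))
      (hint k)).symm
  rw [e]
  refine (enorm_integral_le_lintegral_enorm _).trans (lintegral_mono fun x => ?_)
  rw [L.sum_cutoff_mul s g (fun k => kernelOp (a k) f x) x]

theorem measurable_sum_adjointScale (ha : LocalKernel D κ a) (s : Finset ℤ)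
    (g : (Fin d → ℝ) → ℂ) : Measurable fun y => ∑ k ∈ s, L.adjointScale a k g y :=
  Finset.measurable_sum _ fun k _ => ha.transpose.measurable_kernelOp k _

/-- A crude bound for finite sums of adjoint terms. -/
theorem exists_enorm_sum_adjointScale_le (ha : LocalKernel D κ a) (s : Finset ℤ)
    {g : (Fin d → ℝ) → ℂ} (hg : Integrable g) :
    ∃ M : ℝ≥0, ∀ y, ‖∑ k ∈ s, L.adjointScale a k g y‖ₑ ≤ M := by
  have h : ∀ k, ∀ y, ‖L.adjointScale a k g y‖ₑ ≤
      (∫⁻ x, ‖g x‖ₑ) / ENNReal.ofReal (((2 : ℝ) ^ k) ^ d) := by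
    intro k y
    refine (ha.transpose.enorm_kernelOp_le k _ y).trans ?_
    rw [avg, D.volume_cubeAt]
    exact ENNReal.div_le_div_right ((setLIntegral_le_lintegral _ _).trans
      (lintegral_mono fun x => L.enorm_cutoff_le k g x)) _
  have ht : ∑ k ∈ s, (∫⁻ x, ‖g x‖ₑ) / ENNReal.ofReal (((2 : ℝ) ^ k) ^ d) ≠ ∞ := by
    refine (ENNReal.sum_lt_top.2 fun k _ => ENNReal.div_lt_top hg.2.ne ?_).ne
    rw [ne_eq, ENNReal.ofReal_eq_zero, not_le]
    positivity
  refine ⟨(∑ k ∈ s, (∫⁻ x, ‖g x‖ₑ) / ENNReal.ofReal (((2 : ℝ) ^ k) ^ d)).toNNReal, fun y => ?_⟩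
  rw [ENNReal.coe_toNNReal ht]
  exact (enorm_sum_le _ _).trans (Finset.sum_le_sum fun k _ => h k y)

end Linearization

/-! ### Sparse bounds for finite sums of adjoint terms. -/

theorem sparseSum_mono {ch : Cube d → Set (Cube d)} {c c' : Cube d → ℝ≥0∞}
    (h : ∀ P, c P ≤ c' P) (K : ℕ) (R : Cube d) (x : Fin d → ℝ) :
    sparseSum ch c K R x ≤ sparseSum ch c' K R x := by
  induction K generalizing R with
  | zero => exact le_rfl
  | succ K ih =>
    exact add_le_add (Set.indicator_le_indicator (h R)) (ENNReal.tsum_le_tsum fun P => ih P.1)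

/-- The constant in the sparse bounds. -/
def sparseConst (d : ℕ) (B : ℝ≥0) : ℝ≥0 := 33 + 2 * stopThreshold d B

open Classical in
/-- Testing the adjoint against its own powers: the sparse bound for the adjoint. -/
theorem exists_sparse_adjoint_le {D : DyadicGrid d} {κ : ℕ}
    {a : ℤ → (Fin d → ℝ) → (Fin d → ℝ) → ℂ} {B : ℝ≥0} (hB : KernelL2Bounded a B)
    (ha : LocalKernel D κ a) (hκ : 1 ≤ κ) (hd : 0 < d) (L : Linearization d) (b c : ℤ)
    {g : (Fin d → ℝ) → ℂ} (hg : Integrable g) {R : Cube d} (hR : R ∈ D.cubes)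
    (hgR : ∀ x ∉ R.toSet, g x = 0) {s : (Fin d → ℝ) → ℝ} (hs : AEMeasurable s volume)
    (hs0 : ∀ᵐ x, 0 < s x) (hst : weightMeasure s R.toSet ≠ ∞) {r : ℝ} (hr : 0 ≤ r) :
    ∃ (ch : Cube d → Set (Cube d)) (K : ℕ), IsSparse D ch ∧
      ∫⁻ y in R.toSet, ‖∑ k ∈ Finset.Icc b c, L.adjointScale a k g y‖ₑ *
        ‖∑ k ∈ Finset.Icc b c, L.adjointScale a k g y‖ₑ ^ r ∂(weightMeasure s) ≤
      sparseConst d B * κ * ∫⁻ x in R.toSet, ‖g x‖ₑ * sparseSum ch (fun P =>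
        (∫⁻ y in P.toSet, R.toSet.indicator
          (fun y => ‖∑ k ∈ Finset.Icc b c, L.adjointScale a k g y‖ₑ ^ r) y ∂(weightMeasure s)) /
          volume P.toSet) K R x := by
  set U : (Fin d → ℝ) → ℂ := fun y => ∑ k ∈ Finset.Icc b c, L.adjointScale a k g y with hU
  have hUm : Measurable U := L.measurable_sum_adjointScale ha _ g
  obtain ⟨M, hM⟩ := L.exists_enorm_sum_adjointScale_le ha (Finset.Icc b c) hg
  -- The extremal function for duality: $Uf=|U|^{1+r}s$ on $R$. Where $U=0$ the unimodular factor
  -- reads $0/0=0$, which is harmless there.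
  set f : (Fin d → ℝ) → ℂ := R.toSet.indicator fun y =>
    (starRingEnd ℂ) (U y) / ‖U y‖ * ((‖U y‖ ^ r * s y : ℝ) : ℂ) with hf
  have hfR : ∀ x ∉ R.toSet, f x = 0 := fun x hx => Set.indicator_of_notMem hx _
  have hfm : AEStronglyMeasurable f volume := by
    refine AEStronglyMeasurable.indicator (AEMeasurable.aestronglyMeasurable ?_)
      R.measurableSet_toSet
    have h1 : Measurable fun y => (starRingEnd ℂ) (U y) / ‖U y‖ := by
      refine Measurable.div (RCLike.continuous_conj.measurable.comp hUm) ?_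
      exact Complex.measurable_ofReal.comp hUm.norm
    refine h1.aemeasurable.mul (Complex.measurable_ofReal.comp_aemeasurable ?_)
    exact (hUm.norm.pow_const r).aemeasurable.mul hs
  have hfle : ∀ᵐ y, ‖f y‖ₑ ≤ R.toSet.indicator (fun y => ENNReal.ofReal (s y) * ‖U y‖ₑ ^ r) y := by
    filter_upwards [hs0] with y hy
    by_cases hyR : y ∈ R.toSet
    · rw [hf, Set.indicator_of_mem hyR, Set.indicator_of_mem hyR, enorm_mul]
      have h2 : ‖(((‖U y‖ ^ r * s y : ℝ)) : ℂ)‖ₑ = ENNReal.ofReal (s y) * ‖U y‖ₑ ^ r := by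
        rw [← ofReal_norm, Complex.norm_real, Real.norm_of_nonneg (by positivity),
          ENNReal.ofReal_mul (by positivity), mul_comm,
          ← ENNReal.ofReal_rpow_of_nonneg (norm_nonneg _) hr, ofReal_norm]
      rw [h2]
      refine mul_le_of_le_one_left zero_le ?_
      rw [← ofReal_norm, norm_div, RCLike.norm_conj, Complex.norm_real, norm_norm]
      exact ENNReal.ofReal_le_one.2 (div_self_le_one _)
    · rw [hfR y hyR, Set.indicator_of_notMem hyR]; simp
  have hUr : Measurable fun y => ‖U y‖ₑ ^ r := hUm.enorm.pow_const r
  have hfint : Integrable f := by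
    refine ⟨hfm, (lintegral_mono_ae hfle).trans_lt ?_⟩
    rw [lintegral_indicator R.measurableSet_toSet,
      ← setLIntegral_weightMeasure hs _ hUr.aemeasurable R.measurableSet_toSet]
    calc ∫⁻ y in R.toSet, ‖U y‖ₑ ^ r ∂(weightMeasure s)
        ≤ ∫⁻ _ in R.toSet, (M : ℝ≥0∞) ^ r ∂(weightMeasure s) :=
          lintegral_mono fun y => ENNReal.rpow_le_rpow (hM y) hr
      _ < ∞ := by
          rw [setLIntegral_const]
          exact ENNReal.mul_lt_top (ENNReal.rpow_lt_top_of_nonneg hr (by simp)) hst.lt_top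
  have havg : ∀ P : Cube d, avg f P ≤ (∫⁻ y in P.toSet, R.toSet.indicator
      (fun y => ‖U y‖ₑ ^ r) y ∂(weightMeasure s)) / volume P.toSet := by
    intro P
    refine ENNReal.div_le_div_right ?_ _
    rw [setLIntegral_weightMeasure hs _ (hUr.indicator R.measurableSet_toSet).aemeasurable
      P.measurableSet_toSet]
    refine lintegral_mono_ae (ae_restrict_of_ae ?_)
    filter_upwards [hfle] with y hy
    refine hy.trans (le_of_eq ?_)
    by_cases hyR : y ∈ R.toSet <;> simp [hyR]
  have hLHS : ∫⁻ y in R.toSet, ‖U y‖ₑ * ‖U y‖ₑ ^ r ∂(weightMeasure s) = ‖∫ y, U y * f y‖ₑ := by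
    have hpt : ∀ y, U y * f y = ((R.toSet.indicator (fun y => ‖U y‖ * (‖U y‖ ^ r * s y)) y : ℝ) : ℂ) := by
      intro y
      by_cases hyR : y ∈ R.toSet
      · rw [hf, Set.indicator_of_mem hyR, Set.indicator_of_mem hyR]
        by_cases h0 : U y = 0
        · simp [h0]
        · have hn : ((‖U y‖ : ℝ) : ℂ) ≠ 0 := by simpa using h0
          have hc : U y * (starRingEnd ℂ) (U y) = ((‖U y‖ : ℝ) : ℂ) ^ 2 := by
            rw [Complex.mul_conj, Complex.normSq_eq_norm_sq]; push_cast; rfl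
          rw [← mul_assoc, ← mul_div_assoc, hc, pow_two, mul_div_assoc, div_self hn, mul_one,
            ← Complex.ofReal_mul]
      · rw [hfR y hyR, Set.indicator_of_notMem hyR]; simp
    have hnn : 0 ≤ᵐ[volume]
        fun y => R.toSet.indicator (fun y => ‖U y‖ * (‖U y‖ ^ r * s y)) y := by
      filter_upwards [hs0] with y hy
      by_cases hyR : y ∈ R.toSet
      · rw [Set.indicator_of_mem hyR]
        simp only [Pi.zero_apply]
        positivity
      · rw [Set.indicator_of_notMem hyR]; rfl
    have hUf : Integrable fun y => U y * f y :=
      hfint.bdd_mul (c := M) hUm.aestronglyMeasurable (Eventually.of_forall fun y => by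
        have := hM y
        rwa [enorm_le_coe] at this)
    have hUf' : Integrable fun y => R.toSet.indicator (fun y => ‖U y‖ * (‖U y‖ ^ r * s y)) y := by
      simp only [hpt] at hUf
      exact hUf.re
    simp only [hpt]
    rw [integral_complex_ofReal, ← ofReal_norm (E := ℂ), Complex.norm_real,
      Real.norm_of_nonneg (integral_nonneg_of_ae hnn),
      ofReal_integral_eq_lintegral_ofReal hUf' hnn,
      setLIntegral_weightMeasure hs (fun y => ‖U y‖ₑ * ‖U y‖ₑ ^ r) (hUm.enorm.mul hUr).aemeasurable
        R.measurableSet_toSet,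
      ← lintegral_indicator R.measurableSet_toSet]
    refine lintegral_congr_ae ?_
    filter_upwards [hs0] with y hy
    by_cases hyR : y ∈ R.toSet
    · rw [Set.indicator_of_mem hyR, Set.indicator_of_mem hyR, ← mul_assoc,
        ENNReal.ofReal_mul (by positivity), ENNReal.ofReal_mul (by positivity),
        ← ENNReal.ofReal_rpow_of_nonneg (norm_nonneg _) hr, ofReal_norm]
      ring
    · rw [Set.indicator_of_notMem hyR, Set.indicator_of_notMem hyR]; simp
  -- The family is built from $f$, hence from $U$ and $r$. No scale below `b` occurs, so finitely
  -- many generations suffice.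
  refine ⟨stopCubes D κ a (stopThreshold d B) f, (R.scale - b).toNat + 1,
    isSparse_stopCubes hB ha hκ hd hfint.locallyIntegrable, ?_⟩
  rw [hLHS]
  refine (L.enorm_integral_adjoint_mul_le ha (Finset.Icc b c) hg hfint).trans ?_
  rw [← lintegral_const_mul', ← lintegral_indicator R.measurableSet_toSet]
  · refine lintegral_mono fun x => ?_
    by_cases hx : x ∈ R.toSet
    · rw [Set.indicator_of_mem hx, mul_left_comm]
      gcongr
      refine (enorm_sum_ordConnected_le (T := stopThreshold d B) ha hκ hd (R.scale - b).toNat hR hfR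
        hx _ ?_ ?_).trans ?_
      · refine ⟨fun i hi j hj l hl => ?_⟩
        simp only [Finset.coe_filter, Finset.mem_Icc, Set.mem_ofPred_eq] at hi hj ⊢
        refine ⟨⟨hi.1.1.trans hl.1, hl.2.trans hj.1.2⟩, hi.2.1.trans ?_, le_trans ?_ hj.2.2⟩
        · exact zpow_le_zpow_right₀ (by norm_num) hl.1
        · exact zpow_le_zpow_right₀ (by norm_num) hl.2
      · intro i hi
        have := (Finset.mem_Icc.1 (Finset.mem_filter.1 hi).1).1
        omega
      · rw [sparseConst]
        push_cast
        gcongr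
        exact sparseSum_mono havg _ _ _
    · rw [hgR x hx]; simp
  · exact ENNReal.mul_ne_top (by simp) (by simp)

/-- Absorption of the unknown norm, legitimate because it is known to be finite; this is why testing
is done on finite sums first. -/
theorem le_rpow_mul_of_le_mul_rpow {p q : ℝ} (hpq : p.HolderConjugate q) {X K Y : ℝ≥0∞}
    (hX : X ≠ ∞) (h : X ≤ K * (X ^ (1 / p) * Y ^ (1 / q))) : X ≤ K ^ q * Y := by
  rcases eq_or_ne X 0 with h0 | h0
  · simp [h0]
  have hq0 : 0 < q := hpq.symm.pos
  have hp0 : 0 < p := hpq.pos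
  have e : X = X ^ (1 / p) * X ^ (1 / q) := by
    rw [← ENNReal.rpow_add _ _ h0 hX, one_div, one_div, hpq.inv_add_inv_eq_one, ENNReal.rpow_one]
  have h1 : X ^ (1 / p) * X ^ (1 / q) ≤ X ^ (1 / p) * (K * Y ^ (1 / q)) := by
    rw [← e, mul_left_comm]; exact h
  have hx0 : X ^ (1 / p) ≠ 0 := by simp [h0, hX]
  have hxt : X ^ (1 / p) ≠ ∞ := ENNReal.rpow_ne_top_of_nonneg (by positivity) hX
  have h2 := (ENNReal.mul_le_mul_iff_right hx0 hxt).1 h1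
  have h3 := ENNReal.rpow_le_rpow h2 hq0.le
  rwa [ENNReal.mul_rpow_of_nonneg _ _ hq0.le, ← ENNReal.rpow_mul, ← ENNReal.rpow_mul,
    one_div_mul_cancel hq0.ne', ENNReal.rpow_one, ENNReal.rpow_one] at h3

theorem setLIntegral_mul_le_weightMeasure {w : (Fin d → ℝ) → ℝ} (hw : AEMeasurable w volume)
    {g : (Fin d → ℝ) → ℂ} (hgw : ∀ᵐ x, ‖g x‖ₑ ≤ ENNReal.ofReal (w x))
    {h : (Fin d → ℝ) → ℝ≥0∞} (hh : Measurable h) (E : Set (Fin d → ℝ)) :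
    ∫⁻ x in E, ‖g x‖ₑ * h x ≤ ∫⁻ x, h x ∂(weightMeasure w) := by
  rw [lintegral_weightMeasure hw h hh.aemeasurable]
  refine (setLIntegral_le_lintegral _ _).trans (lintegral_mono_ae ?_)
  filter_upwards [hgw] with x hx
  gcongr

theorem integrable_of_le_weight {w : (Fin d → ℝ) → ℝ} {g : (Fin d → ℝ) → ℂ}
    (hg : AEStronglyMeasurable g volume) (hgw : ∀ᵐ x, ‖g x‖ₑ ≤ ENNReal.ofReal (w x))
    {R : Cube d} (hgR : ∀ x ∉ R.toSet, g x = 0) (hR : weightMeasure w R.toSet ≠ ∞) :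
    Integrable g := by
  refine ⟨hg, lt_of_le_of_lt ?_ hR.lt_top⟩
  rw [weightMeasure_apply w R.measurableSet_toSet, ← lintegral_indicator R.measurableSet_toSet]
  refine lintegral_mono_ae ?_
  filter_upwards [hgw] with x hx
  by_cases hxR : x ∈ R.toSet
  · simpa [hxR] using hx
  · simp [hgR x hxR]

/-! ### Three weighted bounds for finite sums of adjoint terms. -/

section Testing

variable {D : DyadicGrid d} {κ : ℕ} {a : ℤ → (Fin d → ℝ) → (Fin d → ℝ) → ℂ} {B : ℝ≥0}

/-- The sparse bound for the `L¹(s)` norm of the adjoint. -/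
theorem exists_sparse_adjoint_one_le (hB : KernelL2Bounded a B)
    (ha : LocalKernel D κ a) (hκ : 1 ≤ κ) (hd : 0 < d) (L : Linearization d) (b c : ℤ)
    {g : (Fin d → ℝ) → ℂ} (hg : Integrable g) {R : Cube d} (hR : R ∈ D.cubes)
    (hgR : ∀ x ∉ R.toSet, g x = 0) {s : (Fin d → ℝ) → ℝ} (hs : AEMeasurable s volume)
    (hs0 : ∀ᵐ x, 0 < s x) (hst : weightMeasure s R.toSet ≠ ∞) :
    ∃ (ch : Cube d → Set (Cube d)) (K : ℕ), IsSparse D ch ∧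
      ∫⁻ y in R.toSet, ‖∑ k ∈ Finset.Icc b c, L.adjointScale a k g y‖ₑ ∂(weightMeasure s) ≤
      sparseConst d B * κ * ∫⁻ x in R.toSet, ‖g x‖ₑ * sparseSum ch (fun P =>
        weightMeasure s P.toSet / volume P.toSet) K R x := by
  obtain ⟨ch, K, hS, h⟩ := exists_sparse_adjoint_le hB ha hκ hd L b c hg hR hgR hs hs0 hst le_rfl
  refine ⟨ch, K, hS, ?_⟩
  simp only [ENNReal.rpow_zero, mul_one] at h
  refine h.trans (mul_le_mul' le_rfl (lintegral_mono fun x => mul_le_mul' le_rfl ?_))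
  refine sparseSum_mono (fun P => ENNReal.div_le_div_right ?_ _) K R x
  calc _ ≤ ∫⁻ y in P.toSet, 1 ∂(weightMeasure s) :=
        lintegral_mono fun y => Set.indicator_le_self' (fun _ _ => zero_le) y
    _ = _ := by simp

variable (d) in
/-- The direct testing bound for finite sums of adjoint terms. -/
theorem exists_lintegral_adjoint_rpow_le (hd : 0 < d) {p q : ℝ} (hpq : p.HolderConjugate q)
    (B : ℝ≥0) :
    ∃ C : ℝ≥0, ∀ (D : DyadicGrid d) (κ : ℕ) (a : ℤ → (Fin d → ℝ) → (Fin d → ℝ) → ℂ),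
      KernelL2Bounded a B → LocalKernel D κ a → 1 ≤ κ → ∀ w, IsApWeight w p →
      ∀ (L : Linearization d) (b c : ℤ) (g : (Fin d → ℝ) → ℂ), AEStronglyMeasurable g volume →
      ∀ R ∈ D.cubes, (∀ x ∉ R.toSet, g x = 0) → (∀ᵐ x, ‖g x‖ₑ ≤ ENNReal.ofReal (w x)) →
      ∫⁻ y in R.toSet, ‖∑ k ∈ Finset.Icc b c, L.adjointScale a k g y‖ₑ ^ q
        ∂(weightMeasure (dualWeight w p)) ≤
      (C * κ * apConst w p) ^ q * weightMeasure w R.toSet := by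
  obtain ⟨C, hC⟩ := exists_lintegral_sparseSum_conjExponent_le (d := d) hpq
  have hq0 : 0 < q := hpq.symm.pos
  have hp0 : 0 < p := hpq.pos
  refine ⟨sparseConst d B * C ^ (1 / q), fun D κ a hB ha hκ w hw L b c g hg R hR hgR hgw => ?_⟩
  have hp := hpq.lt
  have hgi := integrable_of_le_weight hg hgw hgR (hw.weight_ne_top hp R)
  set s := dualWeight w p
  have hs := aemeasurable_dualWeight p hw.meas
  have hst := hw.dual_ne_top hp R
  obtain ⟨ch, K, hS, h⟩ := exists_sparse_adjoint_le hB ha hκ hd L b c hgi hR hgR hs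
    (dualWeight_pos p hw.pos) hst hpq.symm.sub_one_pos.le
  set U : (Fin d → ℝ) → ℂ := fun y => ∑ k ∈ Finset.Icc b c, L.adjointScale a k g y with hU
  have hUm : Measurable U := L.measurable_sum_adjointScale ha _ g
  obtain ⟨M, hM⟩ := L.exists_enorm_sum_adjointScale_le ha (Finset.Icc b c) hgi
  set f : (Fin d → ℝ) → ℝ≥0∞ := R.toSet.indicator fun y => ‖U y‖ₑ ^ (q - 1) with hf
  have hfm : Measurable f := (hUm.enorm.pow_const _).indicator R.measurableSet_toSet
  set X := ∫⁻ y in R.toSet, ‖U y‖ₑ ^ q ∂(weightMeasure s) with hX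
  have hXt : X ≠ ∞ := by
    refine ((lintegral_mono fun y => ENNReal.rpow_le_rpow (hM y) hq0.le).trans_lt ?_).ne
    rw [setLIntegral_const]
    exact ENNReal.mul_lt_top (ENNReal.rpow_lt_top_of_nonneg hq0.le (by simp)) hst.lt_top
  have hpow : ∀ z : ℝ≥0∞, z * z ^ (q - 1) = z ^ q := by
    intro z
    nth_rw 1 [← ENNReal.rpow_one z]
    rw [← ENNReal.rpow_add_of_nonneg _ _ zero_le_one hpq.symm.sub_one_pos.le]
    congr 1; ring
  simp only [hpow] at h
  have hH : ∫⁻ x in R.toSet, ‖g x‖ₑ * sparseSum ch (fun P =>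
        (∫⁻ y in P.toSet, f y ∂(weightMeasure s)) / volume P.toSet) K R x ≤
      X ^ (1 / p) * (C * apConst w p ^ q * weightMeasure w R.toSet) ^ (1 / q) := by
    refine (setLIntegral_mul_le_weightMeasure hw.meas hgw (measurable_sparseSum hS _ K hR) _).trans
      ?_
    rw [lintegral_sparseSum hS _ _ K hR]
    -- Self-duality of positive sparse forms: $\sum_P\frac{w(P)}{|P|}\int_Pf\,ds$ is the integral of
    -- $f$ against the sparse function of $w$, to which the testing estimate applies.
    have e : ∀ P : Cube d, (∫⁻ y in P.toSet, f y ∂(weightMeasure s)) / volume P.toSet *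
        weightMeasure w P.toSet = weightMeasure w P.toSet / volume P.toSet *
          ((weightMeasure s).withDensity f) P.toSet := by
      intro P
      rw [withDensity_apply _ P.measurableSet_toSet, ENNReal.mul_div_right_comm.symm, mul_comm,
        ENNReal.mul_div_right_comm]
    simp only [e]
    rw [← lintegral_sparseSum hS _ _ K hR, lintegral_withDensity_eq_lintegral_mul _ hfm
      (measurable_sparseSum hS _ K hR)]
    refine (ENNReal.lintegral_mul_le_Lp_mul_Lq _ hpq hfm.aemeasurable
      (measurable_sparseSum hS _ K hR).aemeasurable).trans (mul_le_mul' (le_of_eq ?_)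
        (ENNReal.rpow_le_rpow (hC D ch hS _ _ _ (hw.apPair hp D) K R hR) (by positivity)))
    congr 1
    rw [hX, ← lintegral_indicator R.measurableSet_toSet]
    refine lintegral_congr fun y => ?_
    by_cases hy : y ∈ R.toSet
    · rw [hf, Set.indicator_of_mem hy, Set.indicator_of_mem hy, ← ENNReal.rpow_mul]
      congr 1
      have := hpq.mul_eq_add; linarith
    · rw [hf, Set.indicator_of_notMem hy, Set.indicator_of_notMem hy, ENNReal.zero_rpow_of_pos hp0]
  have h2 := le_rpow_mul_of_le_mul_rpow hpq hXt (h.trans (mul_le_mul' le_rfl hH))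
  refine h2.trans (le_of_eq ?_)
  rw [ENNReal.mul_rpow_of_nonneg _ _ hq0.le, ENNReal.mul_rpow_of_nonneg _ _ hq0.le,
    ENNReal.mul_rpow_of_nonneg _ _ hq0.le, ENNReal.coe_mul, ENNReal.mul_rpow_of_nonneg _ _ hq0.le,
    ENNReal.coe_rpow_of_nonneg _ (by positivity), ← ENNReal.rpow_mul (C : ℝ≥0∞),
    one_div_mul_cancel hq0.ne', ENNReal.rpow_one]
  ring

variable (d) in
/-- An `L¹` bound for finite sums of adjoint terms, that is small when the mass of `g` is. -/
theorem exists_lintegral_adjoint_le_mass (hd : 0 < d) {p q : ℝ} (hpq : p.HolderConjugate q)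
    (B : ℝ≥0) :
    ∃ C : ℝ≥0, ∀ (D : DyadicGrid d) (κ : ℕ) (a : ℤ → (Fin d → ℝ) → (Fin d → ℝ) → ℂ),
      KernelL2Bounded a B → LocalKernel D κ a → 1 ≤ κ → ∀ w, IsApWeight w p →
      ∀ (L : Linearization d) (b c : ℤ) (g : (Fin d → ℝ) → ℂ), AEStronglyMeasurable g volume →
      ∀ R ∈ D.cubes, (∀ x ∉ R.toSet, g x = 0) → (∀ᵐ x, ‖g x‖ₑ ≤ ENNReal.ofReal (w x)) →
      ∫⁻ y in R.toSet, ‖∑ k ∈ Finset.Icc b c, L.adjointScale a k g y‖ₑ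
        ∂(weightMeasure (dualWeight w p)) ≤
      C * κ * apConst w p ^ (q - 1) * ((∫⁻ x in R.toSet, ‖g x‖ₑ) ^ (1 / q) *
        weightMeasure (dualWeight w p) R.toSet ^ (1 / p)) := by
  obtain ⟨C, hC⟩ := exists_lintegral_sparseSum_conjExponent_le (d := d) hpq.symm
  have hq0 : 0 < q := hpq.symm.pos
  have hp0 : 0 < p := hpq.pos
  refine ⟨sparseConst d B * C ^ (1 / p), fun D κ a hB ha hκ w hw L b c g hg R hR hgR hgw => ?_⟩
  have hp := hpq.lt
  have hgi := integrable_of_le_weight hg hgw hgR (hw.weight_ne_top hp R)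
  set s := dualWeight w p
  have hs := aemeasurable_dualWeight p hw.meas
  obtain ⟨ch, K, hS, h⟩ := exists_sparse_adjoint_one_le hB ha hκ hd L b c hgi hR hgR hs
    (dualWeight_pos p hw.pos) (hw.dual_ne_top hp R)
  refine h.trans ?_
  set F := sparseSum ch (fun P => weightMeasure s P.toSet / volume P.toSet) K R
  have hF : Measurable F := measurable_sparseSum hS _ K hR
  have hgm : AEMeasurable (fun x => ‖g x‖ₑ) (volume.restrict R.toSet) := hg.enorm.restrict
  have hH : ∫⁻ x in R.toSet, ‖g x‖ₑ * F x ≤ (∫⁻ x in R.toSet, ‖g x‖ₑ) ^ (1 / q) *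
      (C * (apConst w p ^ (q - 1)) ^ p * weightMeasure s R.toSet) ^ (1 / p) := by
    -- Only part of $|g|$ is replaced by $w$: the factor $|g|^{1/q}$ keeps the mass of $g$, and
    -- $\int|g|F^p\le\int F^p\,dw$ is the dual testing estimate.
    have e : ∀ x, ‖g x‖ₑ * F x = ‖g x‖ₑ ^ (1 / q) * (‖g x‖ₑ * F x ^ p) ^ (1 / p) := by
      intro x
      rw [ENNReal.mul_rpow_of_nonneg _ _ (by positivity), ← ENNReal.rpow_mul (F x),
        mul_one_div_cancel hp0.ne', ENNReal.rpow_one, ← mul_assoc,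
        ← ENNReal.rpow_add_of_nonneg _ _ (by positivity) (by positivity), one_div, one_div,
        hpq.symm.inv_add_inv_eq_one, ENNReal.rpow_one]
    simp only [e]
    refine (ENNReal.lintegral_mul_norm_pow_le hgm (hgm.mul (hF.pow_const _).aemeasurable)
      (by positivity) (by positivity) ?_).trans (mul_le_mul' le_rfl
        (ENNReal.rpow_le_rpow ?_ (by positivity)))
    · rw [one_div, one_div, hpq.symm.inv_add_inv_eq_one]
    · exact (setLIntegral_mul_le_weightMeasure hw.meas hgw (hF.pow_const _) _).trans
        (hC D ch hS _ _ _ ((hw.apPair hp D).symm hpq) K R hR)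
  refine (mul_le_mul' le_rfl hH).trans (le_of_eq ?_)
  rw [ENNReal.mul_rpow_of_nonneg _ _ (by positivity), ENNReal.mul_rpow_of_nonneg _ _ (by positivity),
    ← ENNReal.rpow_mul _ p, mul_one_div_cancel hp0.ne', ENNReal.rpow_one, ENNReal.coe_mul,
    ENNReal.coe_rpow_of_nonneg _ (by positivity)]
  ring

variable (d) in
/-- The bound behind the nonstandard testing condition. -/
theorem exists_lintegral_adjoint_le_volume (hd : 0 < d) {p q : ℝ} (hpq : p.HolderConjugate q)
    (B : ℝ≥0) :
    ∃ C : ℝ≥0, ∀ (D : DyadicGrid d) (κ : ℕ) (a : ℤ → (Fin d → ℝ) → (Fin d → ℝ) → ℂ),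
      KernelL2Bounded a B → LocalKernel D κ a → 1 ≤ κ → ∀ w, IsApWeight w p →
      ∀ (L : Linearization d) (b c : ℤ) (g : (Fin d → ℝ) → ℂ), AEStronglyMeasurable g volume →
      ∀ R ∈ D.cubes, (∀ x ∉ R.toSet, g x = 0) → (∀ᵐ x, ‖g x‖ₑ ≤ ENNReal.ofReal (w x)) →
      ∫⁻ y in R.toSet, ‖∑ k ∈ Finset.Icc b c, L.adjointScale a k g y‖ₑ
        ∂(weightMeasure (dualWeight w p)) ≤
      C * κ * apConst w p ^ (q - 1) * ((volume R.toSet / weightMeasure w R.toSet) ^ (q - 1) *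
        weightMeasure w R.toSet) := by
  obtain ⟨C, hC⟩ := exists_sparseTotal_average_mul_le (d := d) hpq
  refine ⟨sparseConst d B * C, fun D κ a hB ha hκ w hw L b c g hg R hR hgR hgw => ?_⟩
  have hp := hpq.lt
  have hgi := integrable_of_le_weight hg hgw hgR (hw.weight_ne_top hp R)
  obtain ⟨ch, K, hS, h⟩ := exists_sparse_adjoint_one_le hB ha hκ hd L b c hgi hR hgR
    (aemeasurable_dualWeight p hw.meas) (dualWeight_pos p hw.pos) (hw.dual_ne_top hp R)
  refine h.trans ?_
  have h2 := setLIntegral_mul_le_weightMeasure hw.meas hgw (measurable_sparseSum hS (fun P =>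
    weightMeasure (dualWeight w p) P.toSet / volume P.toSet) K hR) R.toSet
  rw [lintegral_sparseSum hS _ _ K hR] at h2
  refine (mul_le_mul' le_rfl (h2.trans
    (hC D ch hS _ _ _ (hw.apPair hp D) hw.finite.ne K R hR))).trans (le_of_eq ?_)
  push_cast
  ring

end Testing

/-! ### The dyadic maximal function of $1/w$ relative to $w$. -/

/-- The dyadic maximal function of `1/w` with respect to the measure `w`, localized to `Q`. -/
def reciprocalMax (D : DyadicGrid d) (w : (Fin d → ℝ) → ℝ) (Q : Cube d) (x : Fin d → ℝ) :
    ℝ≥0∞ :=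
  ⨆ (R : Cube d) (_ : R ∈ D.cubes ∧ R.toSet ⊆ Q.toSet),
    R.toSet.indicator (fun _ => volume R.toSet / weightMeasure w R.toSet) x

theorem measurable_reciprocalMax (D : DyadicGrid d) (w : (Fin d → ℝ) → ℝ) (Q : Cube d) :
    Measurable (reciprocalMax D w Q) :=
  Measurable.biSup _ (D.countable_subset fun _ h => h.1)
    fun R _ => measurable_const.indicator R.measurableSet_toSet

/-- The union of the dyadic subcubes of `Q` with a given property is the disjoint union of the
maximal ones. -/
theorem DyadicGrid.exists_maximal_cubes (D : DyadicGrid d) (hd : 0 < d) {Q : Cube d}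
    (hQ : Q ∈ D.cubes) (good : Cube d → Prop) :
    ∃ M : Set (Cube d), (∀ P ∈ M, P ∈ D.cubes ∧ P.toSet ⊆ Q.toSet ∧ good P) ∧
      M.PairwiseDisjoint Cube.toSet ∧
      ∀ R ∈ D.cubes, R.toSet ⊆ Q.toSet → good R → ∀ x ∈ R.toSet, ∃ P ∈ M, x ∈ P.toSet := by
  let M : Set (Cube d) := {P | P ∈ D.cubes ∧ P.toSet ⊆ Q.toSet ∧ good P ∧
    ∀ P' ∈ D.cubes, P.toSet ⊂ P'.toSet → P'.toSet ⊆ Q.toSet → ¬ good P'}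
  have aux : ∀ P ∈ M, ∀ P' ∈ M, P.scale ≤ P'.scale → P ≠ P' → Disjoint P.toSet P'.toSet := by
    intro P hP P' hP' hle hne
    rw [Set.disjoint_left]
    intro x hx hx'
    rcases hle.eq_or_lt with h | h
    · exact hne (D.eq_of_mem hP.1 hP'.1 h hx hx')
    · exact hP.2.2.2 P' hP'.1 (D.ssubset_of_mem hd hP.1 hP'.1 h hx hx') hP'.2.1 hP'.2.2.1
  refine ⟨M, fun P hP => ⟨hP.1, hP.2.1, hP.2.2.1⟩, fun P hP P' hP' hne => ?_,
    fun R hR hRQ hg x hx => ?_⟩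
  · rcases le_total P.scale P'.scale with h | h
    · exact aux P hP P' hP' h hne
    · exact (aux P' hP' P hP h hne.symm).symm
  · have eR := D.cubeAt_scale_eq hR hx
    obtain ⟨i, ⟨h2, h3⟩, hmax⟩ := Int.exists_greatest_of_bdd
      (P := fun i => (D.cubeAt i x).toSet ⊆ Q.toSet ∧ good (D.cubeAt i x))
      ⟨Q.scale, fun z hz => by simpa using D.scale_le_of_subset hd (D.cubeAt_mem z x) hQ hz.1⟩
      ⟨R.scale, by rw [eR]; exact ⟨hRQ, hg⟩⟩
    refine ⟨D.cubeAt i x, ⟨D.cubeAt_mem i x, h2, h3, fun P' hP' hs hs' hg' => ?_⟩,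
      D.mem_cubeAt i x⟩
    have e := D.cubeAt_scale_eq hP' (hs.subset (D.mem_cubeAt i x))
    have h5 := hmax P'.scale (by rw [e]; exact ⟨hs', hg'⟩)
    have h6 := D.scale_lt_of_ssubset hd (D.cubeAt_mem i x) hP' hs
    simp only [DyadicGrid.scale_cubeAt] at h6
    omega

/-- The weak type bound for `reciprocalMax`. -/
theorem weightMeasure_lt_reciprocalMax_le {D : DyadicGrid d} (hd : 0 < d) {w : (Fin d → ℝ) → ℝ}
    (hm : AEMeasurable w volume) {Q : Cube d} (hQ : Q ∈ D.cubes)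
    (hW0 : ∀ R : Cube d, weightMeasure w R.toSet ≠ 0)
    (hWt : ∀ R : Cube d, weightMeasure w R.toSet ≠ ∞) {t : ℝ} (ht : 0 < t) :
    weightMeasure w {x | ENNReal.ofReal t < reciprocalMax D w Q x} ≤
      ENNReal.ofReal (2 / t) * volume (Q.toSet ∩ {x | w x < 2 / t}) := by
  obtain ⟨M, hM, hdisj, hcover⟩ := D.exists_maximal_cubes hd hQ
    fun R => ENNReal.ofReal t < volume R.toSet / weightMeasure w R.toSet
  have hcount : M.Countable := D.countable_subset fun P hP => (hM P hP).1
  set G := {x | w x < 2 / t} with hG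
  have hGm : NullMeasurableSet G volume := nullMeasurableSet_lt hm aemeasurable_const
  have hsub : {x | ENNReal.ofReal t < reciprocalMax D w Q x} ⊆ ⋃ P ∈ M, P.toSet := by
    intro x hx
    simp only [reciprocalMax, Set.mem_ofPred_eq, lt_iSup_iff] at hx
    obtain ⟨R, ⟨hR, hRQ⟩, hx⟩ := hx
    by_cases hxR : x ∈ R.toSet
    · rw [Set.indicator_of_mem hxR] at hx
      obtain ⟨P, hP, hxP⟩ := hcover R hR hRQ hx x hxR
      exact Set.mem_biUnion hP hxP
    · rw [Set.indicator_of_notMem hxR] at hx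
      simp at hx
  have hcube : ∀ P ∈ M, weightMeasure w P.toSet ≤ ENNReal.ofReal (2 / t) * volume (P.toSet ∩ G) := by
    intro P hP
    have ht' : ENNReal.ofReal t ≠ 0 := by simpa using ht
    have hlt : ENNReal.ofReal t * weightMeasure w P.toSet ≤ volume P.toSet := by
      have := (hM P hP).2.2.le
      rwa [ENNReal.le_div_iff_mul_le (Or.inl (hW0 P)) (Or.inl (hWt P))] at this
    have hsplit := measure_inter_add_sdiff₀ (μ := volume) P.toSet hGm
    -- Where $w\ge2/t$ volume is cheap in $w$-mass. The doubled level lets this part be absorbed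
    -- into $2w(P)$, so that only $\{w<2/t\}$ remains.
    have h1 : ENNReal.ofReal (2 / t) * volume (P.toSet \ G) ≤ weightMeasure w P.toSet := by
      rw [weightMeasure_apply w P.measurableSet_toSet, ← setLIntegral_const]
      calc ∫⁻ _ in P.toSet \ G, ENNReal.ofReal (2 / t)
          ≤ ∫⁻ x in P.toSet \ G, ENNReal.ofReal (w x) := by
            refine setLIntegral_mono_ae hm.ennreal_ofReal.restrict (Eventually.of_forall fun x hx => ?_)
            exact ENNReal.ofReal_le_ofReal (not_lt.1 hx.2)
        _ ≤ _ := lintegral_mono_set Set.sdiff_subset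
    have h2t : ENNReal.ofReal (2 / t) * ENNReal.ofReal t = 2 := by
      rw [← ENNReal.ofReal_mul (by positivity), div_mul_cancel₀ _ ht.ne']; simp
    have h2 : 2 * weightMeasure w P.toSet ≤
        ENNReal.ofReal (2 / t) * volume (P.toSet ∩ G) + weightMeasure w P.toSet := by
      calc 2 * weightMeasure w P.toSet
          = ENNReal.ofReal (2 / t) * (ENNReal.ofReal t * weightMeasure w P.toSet) := by
            rw [← mul_assoc, h2t]
        _ ≤ ENNReal.ofReal (2 / t) * volume P.toSet := mul_le_mul' le_rfl hlt
        _ = ENNReal.ofReal (2 / t) * volume (P.toSet ∩ G) +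
            ENNReal.ofReal (2 / t) * volume (P.toSet \ G) := by rw [← mul_add, hsplit]
        _ ≤ _ := add_le_add le_rfl h1
    rw [two_mul] at h2
    exact (ENNReal.add_le_add_iff_right (hWt P)).1 h2
  calc weightMeasure w {x | ENNReal.ofReal t < reciprocalMax D w Q x}
      ≤ weightMeasure w (⋃ P ∈ M, P.toSet) := measure_mono hsub
    _ ≤ ∑' P : M, weightMeasure w P.1.toSet := measure_biUnion_le _ hcount _
    _ ≤ ∑' P : M, ENNReal.ofReal (2 / t) * volume (P.1.toSet ∩ G) :=
        ENNReal.tsum_le_tsum fun P => hcube P.1 P.2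
    _ = ENNReal.ofReal (2 / t) * volume (⋃ P ∈ M, P.toSet ∩ G) := by
        rw [ENNReal.tsum_mul_left, measure_biUnion₀ hcount]
        · intro P hP P' hP' hne
          exact ((hdisj hP hP' hne).mono Set.inter_subset_left Set.inter_subset_left).aedisjoint
        · exact fun P _ => P.measurableSet_toSet.nullMeasurableSet.inter hGm
    _ ≤ _ := by
        refine mul_le_mul' le_rfl (measure_mono ?_)
        exact Set.iUnion₂_subset fun P hP => Set.inter_subset_inter_left _ (hM P hP).2.1

variable (d) in
/-- Doob's inequality for `reciprocalMax`. -/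
theorem exists_lintegral_reciprocalMax_le (hd : 0 < d) {p q : ℝ} (hpq : p.HolderConjugate q) :
    ∃ C : ℝ≥0, ∀ (D : DyadicGrid d) (w : (Fin d → ℝ) → ℝ), IsApWeight w p → ∀ Q ∈ D.cubes,
      ∫⁻ x, reciprocalMax D w Q x ^ q ∂(weightMeasure w) ≤
        C * weightMeasure (dualWeight w p) Q.toSet := by
  have hq0 : 0 < q := hpq.symm.pos
  have hq1 : 0 < q - 1 := hpq.symm.sub_one_pos
  refine ⟨(q * 2 * (2 ^ (q - 1) / (q - 1))).toNNReal, fun D w hw Q hQ => ?_⟩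
  have hp := hpq.lt
  have hweak := fun t => weightMeasure_lt_reciprocalMax_le (D := D) hd hw.meas hQ hw.weight_ne_zero
    (hw.weight_ne_top hp) (t := t)
  set M := reciprocalMax D w Q
  have hMm : Measurable M := measurable_reciprocalMax D w Q
  -- The layer-cake formula is applied to a real-valued function; the weak type bound as
  -- $t\to\infty$ excludes infinite values.
  have hfin : ∀ᵐ x ∂(weightMeasure w), M x ≠ ∞ := by
    have h1 : ∀ n : ℕ, weightMeasure w {x | M x = ∞} ≤
        ENNReal.ofReal (2 / (n + 1 : ℝ)) * volume Q.toSet := fun n =>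
      (measure_mono fun x hx => by
        simp only [Set.mem_ofPred_eq] at hx ⊢
        rw [hx]; exact ENNReal.ofReal_lt_top).trans ((hweak (n + 1) (by positivity)).trans
        (mul_le_mul' le_rfl (measure_mono Set.inter_subset_left)))
    have h2 : Tendsto (fun n : ℕ => ENNReal.ofReal (2 / (n + 1 : ℝ)) * volume Q.toSet) atTop
        (𝓝 (0 * volume Q.toSet)) := by
      refine ENNReal.Tendsto.mul_const ?_ (Or.inr Q.volume_ne_top)
      rw [← ENNReal.ofReal_zero]
      exact ENNReal.tendsto_ofReal (tendsto_const_div_atTop_nhds_zero_nat 2 |>.comp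
        (tendsto_add_atTop_nat 1) |>.congr fun n => by simp)
    rw [zero_mul] at h2
    have h3 := le_antisymm (ge_of_tendsto' h2 h1) zero_le
    simpa [ae_iff] using h3
  have hlhs : ∫⁻ x, M x ^ q ∂(weightMeasure w) =
      ∫⁻ x, ENNReal.ofReal ((M x).toReal ^ q) ∂(weightMeasure w) := by
    refine lintegral_congr_ae ?_
    filter_upwards [hfin] with x hx
    rw [← ENNReal.ofReal_rpow_of_nonneg ENNReal.toReal_nonneg hq0.le, ENNReal.ofReal_toReal hx]
  have hrhs : ∫⁻ x in Q.toSet, ENNReal.ofReal ((2 * (w x)⁻¹) ^ (q - 1)) =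
      ENNReal.ofReal (2 ^ (q - 1)) * weightMeasure (dualWeight w p) Q.toSet := by
    rw [weightMeasure_apply _ Q.measurableSet_toSet, ← lintegral_const_mul' _ _ (by simp)]
    refine lintegral_congr_ae (ae_restrict_of_ae ?_)
    filter_upwards [hw.pos] with x hx
    rw [← ENNReal.ofReal_mul (by positivity), Real.mul_rpow (by norm_num) (by positivity),
      dualWeight, hpq.conjExponent_eq.symm, Real.inv_rpow hx.le, ← Real.rpow_neg hx.le, neg_sub]
  have hwm : AEMeasurable (fun x => 2 * (w x)⁻¹) (volume.restrict Q.toSet) :=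
    (hw.meas.inv.const_mul 2).restrict
  have hlevel : ∀ t : ℝ, 0 < t → weightMeasure w {x | t < (M x).toReal} ≤
      ENNReal.ofReal (2 / t) * (volume.restrict Q.toSet) {x | t < 2 * (w x)⁻¹} := by
    intro t ht
    refine (measure_mono fun x (hx : t < (M x).toReal) => ?_).trans ((hweak t ht).trans
      (mul_le_mul' le_rfl ?_))
    · exact (ENNReal.ofReal_lt_ofReal_iff (ht.trans hx)).2 hx |>.trans_le ENNReal.ofReal_toReal_le
    · rw [Measure.restrict_apply₀' Q.measurableSet_toSet.nullMeasurableSet, Set.inter_comm]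
      refine measure_mono_ae ?_
      filter_upwards [hw.pos] with x hx hx2
      refine ⟨?_, hx2.2⟩
      have h3 : w x < 2 / t := hx2.1
      rw [lt_div_iff₀ ht] at h3
      change t < 2 * (w x)⁻¹
      rw [← div_eq_mul_inv, lt_div_iff₀ hx]
      linarith
  rw [hlhs, lintegral_rpow_eq_lintegral_meas_lt_mul _ (Eventually.of_forall fun x =>
    ENNReal.toReal_nonneg) hMm.ennreal_toReal.aemeasurable hq0]
  have hlc := lintegral_rpow_eq_lintegral_meas_lt_mul (volume.restrict Q.toSet)
    (ae_restrict_of_ae (hw.pos.mono fun x hx => by simp only [Pi.zero_apply]; positivity)) hwm hq1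
  rw [hrhs] at hlc
  set J := ∫⁻ t in Set.Ioi (0 : ℝ), (volume.restrict Q.toSet) {x | t < 2 * (w x)⁻¹} *
    ENNReal.ofReal (t ^ (q - 1 - 1)) with hJ
  -- The layer-cake formula for $(2/w)^{q-1}$ on $Q$, whose integral is $2^{q-1}\sigma(Q)$ because
  -- $\sigma=w^{1-q}$.
  have hJ2 : J = ENNReal.ofReal (2 ^ (q - 1) / (q - 1)) * weightMeasure (dualWeight w p) Q.toSet := by
    rw [ENNReal.ofReal_div_of_pos hq1, ← ENNReal.mul_div_right_comm, hlc, mul_comm,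
      ENNReal.mul_div_cancel_right (by simpa using hq1) (by simp)]
  calc _ ≤ ENNReal.ofReal q * (2 * J) := by
        refine mul_le_mul' le_rfl ?_
        rw [hJ, ← lintegral_const_mul' _ _ (by simp)]
        refine setLIntegral_mono' measurableSet_Ioi fun t (ht : 0 < t) => ?_
        refine (mul_le_mul' (hlevel t ht) le_rfl).trans (le_of_eq ?_)
        have e : ENNReal.ofReal (2 / t) * ENNReal.ofReal (t ^ (q - 1)) =
            2 * ENNReal.ofReal (t ^ (q - 1 - 1)) := by
          rw [← ENNReal.ofReal_mul (by positivity), Real.rpow_sub_one ht.ne' (q - 1),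
            ← ENNReal.ofReal_ofNat 2, ← ENNReal.ofReal_mul (by norm_num)]
          congr 1; ring
        rw [mul_right_comm, e]
        ring
    _ = _ := by
        rw [hJ2, ← mul_assoc, ← mul_assoc, ← ENNReal.ofReal_ofNat 2,
          ← ENNReal.ofReal_mul hq0.le, ← ENNReal.ofReal_mul (by positivity)]
        rfl

/-! ### Almost everywhere convergence of the adjoint series. -/

theorem avg_mono {f g : (Fin d → ℝ) → ℂ} (h : ∀ x, ‖f x‖ₑ ≤ ‖g x‖ₑ) (Q : Cube d) :
    avg f Q ≤ avg g Q :=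
  ENNReal.div_le_div_right (lintegral_mono h) _

namespace Linearization

variable (L : Linearization d) {D : DyadicGrid d} {κ : ℕ}
  {a : ℤ → (Fin d → ℝ) → (Fin d → ℝ) → ℂ} {g : (Fin d → ℝ) → ℂ}

/-- The part of `g` that lives where the lower truncation is at most `2^i`. -/
def restrictLower (i : ℤ) (g : (Fin d → ℝ) → ℂ) : (Fin d → ℝ) → ℂ :=
  Set.indicator {x | L.ε x ≤ (2 : ℝ) ^ i} g

theorem enorm_restrictLower_le (i : ℤ) (g : (Fin d → ℝ) → ℂ) (x : Fin d → ℝ) :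
    ‖L.restrictLower i g x‖ₑ ≤ ‖g x‖ₑ :=
  enorm_indicator_le_enorm_self _ _

theorem aestronglyMeasurable_restrictLower (i : ℤ) (hg : AEStronglyMeasurable g volume) :
    AEStronglyMeasurable (L.restrictLower i g) volume :=
  hg.indicator₀ (nullMeasurableSet_le L.ε_meas aemeasurable_const)

theorem integrable_restrictLower (i : ℤ) (hg : Integrable g) :
    Integrable (L.restrictLower i g) :=
  ⟨L.aestronglyMeasurable_restrictLower i hg.1,
    (lintegral_mono fun x => L.enorm_restrictLower_le i g x).trans_lt hg.2⟩

theorem enorm_restrictLower_mono {i j : ℤ} (hij : i ≤ j) (g : (Fin d → ℝ) → ℂ) (x : Fin d → ℝ) :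
    ‖L.restrictLower i g x‖ₑ ≤ ‖L.restrictLower j g x‖ₑ := by
  by_cases hx : L.ε x ≤ (2 : ℝ) ^ i
  · have hx' : L.ε x ≤ (2 : ℝ) ^ j := hx.trans (zpow_le_zpow_right₀ (by norm_num) hij)
    rw [restrictLower, restrictLower, Set.indicator_of_mem (by exact hx),
      Set.indicator_of_mem (by exact hx')]
  · rw [restrictLower, Set.indicator_of_notMem (by exact hx)]; simp

theorem eventually_restrictLower_eq_zero (g : (Fin d → ℝ) → ℂ) (x : Fin d → ℝ) :
    ∀ᶠ i : ℤ in atBot, L.restrictLower i g x = 0 := by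
  filter_upwards [tendsto_two_zpow_atBot.eventually (gt_mem_nhds (L.ε_pos x))] with i hi
  exact Set.indicator_of_notMem (by simpa using hi) _

theorem adjointScale_congr (ha : LocalKernel D κ a) {k : ℤ} {g' : (Fin d → ℝ) → ℂ}
    {y : Fin d → ℝ}
    (h : ∀ x ∈ (D.cubeAt k y).toSet, L.ε x ≤ (2 : ℝ) ^ k → g x = g' x) :
    L.adjointScale a k g y = L.adjointScale a k g' y := by
  refine integral_congr_ae (Eventually.of_forall fun x => ?_)
  by_cases hx : x ∈ (D.cubeAt k y).toSet
  · simp only [L.cutoff_congr k (h x hx)]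
  · rw [D.mem_cubeAt_iff] at hx
    simp [ha.zero k x y hx]

theorem enorm_adjointScale_le (ha : LocalKernel D κ a) (k : ℤ) (g : (Fin d → ℝ) → ℂ)
    (y : Fin d → ℝ) : ‖L.adjointScale a k g y‖ₑ ≤ avg (L.restrictLower k g) (D.cubeAt k y) := by
  have h : L.adjointScale a k g y = L.adjointScale a k (L.restrictLower k g) y :=
    L.adjointScale_congr ha fun x _ hx => (Set.indicator_of_mem (by exact hx) g).symm
  rw [h]
  exact (ha.transpose.enorm_kernelOp_le k _ y).trans (avg_mono (L.enorm_cutoff_le k _) _)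

theorem sum_enorm_adjointScale_le (ha : LocalKernel D κ a) (hd : 0 < d) {Q : Cube d}
    (hQ : Q ∈ D.cubes) (hg : ∀ x ∉ Q.toSet, g x = 0) (y : Fin d → ℝ)
    (s : Finset ℤ) (hs : ∀ k ∈ s, Q.scale + 1 ≤ k) :
    ∑ k ∈ s, ‖L.adjointScale a k g y‖ₑ ≤ avg g Q :=
  (Finset.sum_le_sum fun k _ => (L.enorm_adjointScale_le ha k g y).trans
    (avg_mono (L.enorm_restrictLower_le k g) _)).trans (D.sum_avg_cubeAt_le hd hQ hg y s hs)

/-- Fix $i$ with $\epsilon(y)>2^i$. For $k\le i$ the averages are dominated by those of the fixed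
function `L.restrictLower i g`, which tend to its value $0$ at $y$ by differentiation. -/
theorem ae_tendsto_avg_restrictLower (D : DyadicGrid d) (hg : Integrable g) :
    ∀ᵐ y, Tendsto (fun k : ℤ => avg (L.restrictLower k g) (D.cubeAt k y)) atBot (𝓝 0) := by
  have h : ∀ᵐ y, ∀ i : ℤ, Tendsto (fun k : ℤ => avg (L.restrictLower i g) (D.cubeAt k y)) atBot
      (𝓝 ‖L.restrictLower i g y‖ₑ) :=
    ae_all_iff.2 fun i => D.ae_tendsto_avg (L.integrable_restrictLower i hg).locallyIntegrable
  filter_upwards [h] with y hy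
  obtain ⟨i, hi⟩ := (L.eventually_restrictLower_eq_zero g y).exists
  have h1 := hy i
  rw [hi, enorm_zero] at h1
  refine tendsto_of_tendsto_of_tendsto_of_le_of_le' tendsto_const_nhds h1
    (Eventually.of_forall fun _ => zero_le) ?_
  filter_upwards [eventually_le_atBot i] with k hk
  exact avg_mono (L.enorm_restrictLower_mono hk g) _

theorem tendsto_lintegral_restrictLower (hg : Integrable g) (E : Set (Fin d → ℝ)) :
    Tendsto (fun i : ℤ => ∫⁻ x in E, ‖L.restrictLower i g x‖ₑ) atBot (𝓝 0) := by
  have h := tendsto_lintegral_filter_of_dominated_convergence' (μ := volume.restrict E)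
    (l := atBot) (F := fun (i : ℤ) x => ‖L.restrictLower i g x‖ₑ) (f := fun _ => 0)
    (fun x => ‖g x‖ₑ)
    (Eventually.of_forall fun i => (L.aestronglyMeasurable_restrictLower i hg.1).enorm.restrict)
    (Eventually.of_forall fun i => Eventually.of_forall fun x => L.enorm_restrictLower_le i g x)
    ((setLIntegral_le_lintegral _ _).trans_lt hg.2).ne
    (Eventually.of_forall fun x => ?_)
  · simpa using h
  · refine tendsto_const_nhds.congr' ?_
    filter_upwards [L.eventually_restrictLower_eq_zero g x] with i hi
    rw [hi, enorm_zero]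

/-- A bound for the `L¹(s)` norms of finite sums of adjoint terms by the mass of the function. -/
def AdjointMassBound (D : DyadicGrid d) (a : ℤ → (Fin d → ℝ) → (Fin d → ℝ) → ℂ)
    (w s : (Fin d → ℝ) → ℝ) (p q : ℝ) (K : ℝ≥0∞) : Prop :=
  ∀ (b c : ℤ) (g : (Fin d → ℝ) → ℂ), AEStronglyMeasurable g volume →
    ∀ R ∈ D.cubes, (∀ x ∉ R.toSet, g x = 0) → (∀ᵐ x, ‖g x‖ₑ ≤ ENNReal.ofReal (w x)) →
    ∫⁻ y in R.toSet, ‖∑ k ∈ Finset.Icc b c, L.adjointScale a k g y‖ₑ ∂(weightMeasure s) ≤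
      K * ((∫⁻ x in R.toSet, ‖g x‖ₑ) ^ (1 / q) * weightMeasure s R.toSet ^ (1 / p))

variable {L} {w s : (Fin d → ℝ) → ℝ} {p q : ℝ} {K : ℝ≥0∞}

/-- On $P$, scales up to $i\le$ `P.scale` depend only on $g$ at points of $P$ where
$\epsilon\le2^i$. The mass bound therefore becomes small as $i\to-\infty$. -/
theorem AdjointMassBound.lintegral_low_le (h : L.AdjointMassBound D a w s p q K)
    (ha : LocalKernel D κ a) (hg : AEStronglyMeasurable g volume)
    (hgw : ∀ᵐ x, ‖g x‖ₑ ≤ ENNReal.ofReal (w x)) {P : Cube d} (hP : P ∈ D.cubes) {i : ℤ}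
    (hi : i ≤ P.scale) (m : ℤ) :
    ∫⁻ y in P.toSet, ‖∑ k ∈ Finset.Icc m i, L.adjointScale a k g y‖ₑ ∂(weightMeasure s) ≤
      K * ((∫⁻ x in P.toSet, ‖L.restrictLower i g x‖ₑ) ^ (1 / q) *
        weightMeasure s P.toSet ^ (1 / p)) := by
  have h1 := h m i (P.toSet.indicator (L.restrictLower i g))
    ((L.aestronglyMeasurable_restrictLower i hg).indicator P.measurableSet_toSet) P hP
    (fun x hx => Set.indicator_of_notMem hx _) (by
      filter_upwards [hgw] with x hx
      exact (enorm_indicator_le_enorm_self _ _).trans ((L.enorm_restrictLower_le i g x).trans hx))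
  have e1 : ∫⁻ x in P.toSet, ‖P.toSet.indicator (L.restrictLower i g) x‖ₑ =
      ∫⁻ x in P.toSet, ‖L.restrictLower i g x‖ₑ :=
    setLIntegral_congr_fun P.measurableSet_toSet fun x hx => by
      simp only [Set.indicator_of_mem hx]
  rw [e1] at h1
  refine le_trans (le_of_eq ?_) h1
  refine setLIntegral_congr_fun P.measurableSet_toSet fun y hy => ?_
  refine congrArg _ (Finset.sum_congr rfl fun k hk => L.adjointScale_congr ha fun x hx hε => ?_)
  have hki := (Finset.mem_Icc.1 hk).2
  have hxP : x ∈ P.toSet :=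
    D.subset_of_mem (D.cubeAt_mem k y) hP (by simpa using hki.trans hi) (D.mem_cubeAt k y) hy hx
  have hε' : L.ε x ≤ (2 : ℝ) ^ i := hε.trans (zpow_le_zpow_right₀ (by norm_num) hki)
  rw [Set.indicator_of_mem hxP, restrictLower, Set.indicator_of_mem (by exact hε')]

end Linearization

theorem lintegral_enorm_mul_weight {s : (Fin d → ℝ) → ℝ} (hs : AEMeasurable s volume)
    (hs0 : ∀ᵐ x, 0 < s x) {f : (Fin d → ℝ) → ℂ} (hf : Measurable f) {E : Set (Fin d → ℝ)}
    (hE : MeasurableSet E) :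
    ∫⁻ x in E, ‖f x * (s x : ℂ)‖ₑ = ∫⁻ x in E, ‖f x‖ₑ ∂(weightMeasure s) := by
  rw [setLIntegral_weightMeasure hs _ hf.enorm.aemeasurable hE]
  refine lintegral_congr_ae (ae_restrict_of_ae ?_)
  filter_upwards [hs0] with x hx
  rw [enorm_mul, mul_comm, ← ofReal_norm (s x : ℂ), Complex.norm_real, Real.norm_of_nonneg hx.le]

theorem avg_weight {s : (Fin d → ℝ) → ℝ} (hs0 : ∀ᵐ x, 0 < s x) (P : Cube d) :
    avg (fun x => (s x : ℂ)) P = weightMeasure s P.toSet / volume P.toSet := by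
  rw [avg, weightMeasure_apply s P.measurableSet_toSet]
  congr 1
  refine lintegral_congr_ae (ae_restrict_of_ae ?_)
  filter_upwards [hs0] with x hx
  rw [← ofReal_norm (s x : ℂ), Complex.norm_real, Real.norm_of_nonneg hx.le]

namespace Linearization

variable {L : Linearization d} {D : DyadicGrid d} {κ : ℕ}
  {a : ℤ → (Fin d → ℝ) → (Fin d → ℝ) → ℂ} {g : (Fin d → ℝ) → ℂ}
  {w s : (Fin d → ℝ) → ℝ} {p q : ℝ} {K : ℝ≥0∞}

/-- The sums of adjoint terms converge in `L¹` with respect to the dual weight. -/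
theorem AdjointMassBound.exists_limit (h : L.AdjointMassBound D a w s p q K) (hK : K ≠ ∞)
    (hp : 0 < p) (hq : 0 < q) (ha : LocalKernel D κ a) (hg : Integrable g)
    (hgw : ∀ᵐ x, ‖g x‖ₑ ≤ ENNReal.ofReal (w x)) (hs : AEMeasurable s volume)
    (hs0 : ∀ᵐ x, 0 < s x) {Q : Cube d} (hQ : Q ∈ D.cubes) (hst : weightMeasure s Q.toSet ≠ ∞) :
    ∃ (G : (Fin d → ℝ) → ℂ) (m : ℕ → ℤ), IntegrableOn G Q.toSet ∧ Tendsto m atTop atBot ∧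
      Tendsto (fun N => ∫⁻ x in Q.toSet,
        ‖(∑ k ∈ Finset.Icc (m N) Q.scale, L.adjointScale a k g x) * (s x : ℂ) - G x‖ₑ) atTop
        (𝓝 0) := by
  set V : ℤ → (Fin d → ℝ) → ℂ := fun m x => ∑ k ∈ Finset.Icc m Q.scale, L.adjointScale a k g x
  have hVm : ∀ m, Measurable (V m) := fun m => L.measurable_sum_adjointScale ha _ g
  set e : ℤ → ℝ≥0∞ := fun i => K * ((∫⁻ x in Q.toSet, ‖L.restrictLower i g x‖ₑ) ^ (1 / q) *
    weightMeasure s Q.toSet ^ (1 / p)) with he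
  have he0 : Tendsto e atBot (𝓝 0) := by
    have h1 := ((L.tendsto_lintegral_restrictLower hg Q.toSet).ennrpow_const (1 / q))
    rw [ENNReal.zero_rpow_of_pos (by positivity)] at h1
    have h2 := ENNReal.Tendsto.const_mul (a := K) (ENNReal.Tendsto.mul_const
      (b := weightMeasure s Q.toSet ^ (1 / p)) h1
      (Or.inr (ENNReal.rpow_ne_top_of_nonneg (by positivity) hst))) (Or.inr hK)
    rw [zero_mul, mul_zero] at h2
    exact h2
  have hlow : ∀ i ≤ Q.scale, ∀ m, ∫⁻ y in Q.toSet, ‖∑ k ∈ Finset.Icc m i,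
      L.adjointScale a k g y‖ₑ ∂(weightMeasure s) ≤ e i :=
    fun i hi m => h.lintegral_low_le ha hg.1 hgw hQ hi m
  have het : ∀ i, e i ≠ ∞ := fun i => by
    refine ENNReal.mul_ne_top hK (ENNReal.mul_ne_top (ENNReal.rpow_ne_top_of_nonneg
      (by positivity) ?_) (ENNReal.rpow_ne_top_of_nonneg (by positivity) hst))
    exact ((setLIntegral_le_lintegral _ _).trans_lt (L.integrable_restrictLower i hg).2).ne
  have hmem : ∀ m, MemLp (fun x => V m x * (s x : ℂ)) 1 (volume.restrict Q.toSet) := by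
    intro m
    rw [memLp_one_iff_integrable]
    refine ⟨(hVm m).aestronglyMeasurable.mul
      (Complex.measurable_ofReal.comp_aemeasurable hs).aestronglyMeasurable.restrict, ?_⟩
    rw [HasFiniteIntegral, lintegral_enorm_mul_weight hs hs0 (hVm m) Q.measurableSet_toSet]
    exact (hlow _ le_rfl m).trans_lt (het _).lt_top
  have hcau : ∀ b c, b ≤ c → c ≤ Q.scale →
      ∫⁻ x in Q.toSet, ‖V b x * (s x : ℂ) - V c x * (s x : ℂ)‖ₑ ≤ e (c - 1) := by
    intro b c hbc hc
    have e1 : ∀ x, V b x * (s x : ℂ) - V c x * (s x : ℂ) =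
        (∑ k ∈ Finset.Icc b (c - 1), L.adjointScale a k g x) * (s x : ℂ) := by
      intro x
      have := sum_Icc_eq_add (fun k => L.adjointScale a k g x) (i := b) (j := c - 1)
        (k := Q.scale) (by omega) (by omega)
      rw [sub_add_cancel] at this
      simp only [V]
      rw [this]; ring
    simp only [e1]
    rw [lintegral_enorm_mul_weight hs hs0 (L.measurable_sum_adjointScale ha _ g)
      Q.measurableSet_toSet]
    exact hlow _ (by omega) b
  -- A subsequence with Cauchy errors below $2^{-N}$, the rate under which completeness of $L^1$
  -- produces a limit.
  obtain ⟨φ, hφ, hφP⟩ := extraction_forall_of_eventually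
    (P := fun N k => ∀ i : ℤ, i ≤ -(k : ℤ) → e i < (1 / 2 : ℝ≥0∞) ^ N ∧ i ≤ Q.scale) (by
    intro N
    have h1 : ∀ᶠ i in atBot, e i < (1 / 2 : ℝ≥0∞) ^ N ∧ i ≤ Q.scale :=
      (he0.eventually (gt_mem_nhds (ENNReal.pow_pos (by simp) _))).and (eventually_le_atBot _)
    obtain ⟨i₀, hi₀⟩ := eventually_atBot.1 h1
    filter_upwards [eventually_ge_atTop (-i₀).toNat] with k hk i hi
    exact hi₀ i (by omega))
  obtain ⟨G, hG, hlim⟩ := Lp.cauchy_complete_eLpNorm le_rfl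
    (f := fun N x => V (-(φ N : ℤ)) x * (s x : ℂ)) (B := fun N => (1 / 2 : ℝ≥0∞) ^ N)
    (fun N => hmem _) (by rw [ENNReal.tsum_geometric]; simp) (by
    intro N n m hn hm
    rw [eLpNorm_one_eq_lintegral_enorm]
    have key : ∀ n m : ℕ, N ≤ n → n ≤ m → ∫⁻ x in Q.toSet,
        ‖V (-(φ m : ℤ)) x * (s x : ℂ) - V (-(φ n : ℤ)) x * (s x : ℂ)‖ₑ < (1 / 2 : ℝ≥0∞) ^ N := by
      intro n m hn hm
      have h1 : φ n ≤ φ m := hφ.monotone hm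
      have h2 : φ N ≤ φ n := hφ.monotone hn
      exact (hcau _ _ (by omega) (hφP N _ (by omega)).2).trans_lt (hφP N _ (by omega)).1
    rcases le_total n m with hnm | hnm
    · refine lt_of_eq_of_lt ?_ (key n m hn hnm)
      exact lintegral_congr fun x => enorm_sub_rev _ _
    · exact key m n hm hnm)
  refine ⟨G, fun N => -(φ N : ℤ), memLp_one_iff_integrable.1 hG, ?_, ?_⟩
  · exact tendsto_neg_atTop_atBot.comp (tendsto_natCast_atTop_atTop.comp hφ.tendsto_atTop)
  · simp only [eLpNorm_one_eq_lintegral_enorm] at hlim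
    exact hlim

/-- Comparison of the sums of adjoint terms with the averages of their limit. -/
theorem AdjointMassBound.enorm_mul_sub_le (h : L.AdjointMassBound D a w s p q K)
    (ha : LocalKernel D κ a) (hg : Integrable g)
    (hgw : ∀ᵐ x, ‖g x‖ₑ ≤ ENNReal.ofReal (w x)) (hs : AEMeasurable s volume)
    (hs0 : ∀ᵐ x, 0 < s x) {Q : Cube d} (hQ : Q ∈ D.cubes)
    {G : (Fin d → ℝ) → ℂ} {m : ℕ → ℤ} (hG : IntegrableOn G Q.toSet) (hm : Tendsto m atTop atBot)
    (hlim : Tendsto (fun N => ∫⁻ x in Q.toSet,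
        ‖(∑ k ∈ Finset.Icc (m N) Q.scale, L.adjointScale a k g x) * (s x : ℂ) - G x‖ₑ) atTop
        (𝓝 0)) {y : Fin d → ℝ} (hy : y ∈ Q.toSet) {j : ℤ} (hj : j + κ + 1 ≤ Q.scale)
    (hsi : IntegrableOn (fun x => (s x : ℂ)) (D.cubeAt j y).toSet) :
    ‖(∑ k ∈ Finset.Icc (j + κ + 1) Q.scale, L.adjointScale a k g y) *
        (∫ x in (D.cubeAt j y).toSet, (s x : ℂ)) - ∫ x in (D.cubeAt j y).toSet, G x‖ₑ ≤
      (∑ k ∈ Finset.Icc (j + 1) (j + κ), avg (L.restrictLower k g) (D.cubeAt k y)) *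
        weightMeasure s (D.cubeAt j y).toSet +
      K * ((∫⁻ x in (D.cubeAt j y).toSet, ‖L.restrictLower j g x‖ₑ) ^ (1 / q) *
        weightMeasure s (D.cubeAt j y).toSet ^ (1 / p)) := by
  set V : ℤ → (Fin d → ℝ) → ℂ := fun m x => ∑ k ∈ Finset.Icc m Q.scale, L.adjointScale a k g x
    with hV
  set P := D.cubeAt j y with hP
  have hPm := P.measurableSet_toSet
  have hPQ : P.toSet ⊆ Q.toSet := D.subset_of_mem (D.cubeAt_mem j y) hQ
    (by rw [DyadicGrid.scale_cubeAt]; omega) (D.mem_cubeAt j y) hy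
  set n := j + κ + 1 with hn
  set A := ∑ k ∈ Finset.Icc (j + 1) (j + κ), avg (L.restrictLower k g) (D.cubeAt k y) with hA
  have hconst : ∀ z ∈ P.toSet, V n z = V n y := by
    intro z hz
    refine Finset.sum_congr rfl fun k hk => ?_
    exact ha.transpose.kernelOp_congr (j := j) (Finset.mem_Icc.1 hk).1 _ (D.mem_cubeAt_iff.1 hz)
  -- Relative to $P$ the scales split in three: those above $j+\kappa$ are constant on $P$, the next
  -- $\kappa$ are bounded by averages, and those up to $j$ are small in $L^1(s)$.
  have hdiff : ∀ i ≤ j + 1, ∀ z ∈ P.toSet, ‖V n z - V i z‖ₑ ≤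
      A + ‖∑ k ∈ Finset.Icc i j, L.adjointScale a k g z‖ₑ := by
    intro i hi z hz
    have e1 := sum_Icc_eq_add (fun k => L.adjointScale a k g z) (i := i) (j := j)
        (k := Q.scale) (by omega) (by omega)
    have e2 := sum_Icc_eq_add (fun k => L.adjointScale a k g z) (i := j + 1) (j := j + κ)
        (k := Q.scale) (by omega) (by omega)
    have e3 : V n z - V i z = -(∑ k ∈ Finset.Icc (j + 1) (j + κ), L.adjointScale a k g z +
        ∑ k ∈ Finset.Icc i j, L.adjointScale a k g z) := by
      simp only [hV]
      rw [e1, e2]; ring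
    rw [e3, enorm_neg]
    refine (enorm_add_le _ _).trans (add_le_add ((enorm_sum_le _ _).trans
      (Finset.sum_le_sum fun k hk => ?_)) le_rfl)
    refine (L.enorm_adjointScale_le ha k g z).trans (le_of_eq ?_)
    rw [D.cubeAt_mono (by linarith [(Finset.mem_Icc.1 hk).1] : j ≤ k) (D.mem_cubeAt_iff.1 hz)]
  have hbound : ∀ i ≤ j + 1, ‖V n y * (∫ x in P.toSet, (s x : ℂ)) - ∫ x in P.toSet, G x‖ₑ ≤
      (A * weightMeasure s P.toSet +
      K * ((∫⁻ x in P.toSet, ‖L.restrictLower j g x‖ₑ) ^ (1 / q) *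
        weightMeasure s P.toSet ^ (1 / p))) + ∫⁻ x in Q.toSet, ‖V i x * (s x : ℂ) - G x‖ₑ := by
    intro i hi
    rw [← integral_const_mul, ← integral_sub (hsi.const_mul _) (hG.mono_set hPQ)]
    refine (enorm_integral_le_lintegral_enorm _).trans ?_
    have hVm : ∀ i, Measurable (V i) := fun i => L.measurable_sum_adjointScale ha _ g
    calc ∫⁻ x in P.toSet, ‖V n y * (s x : ℂ) - G x‖ₑ
        ≤ ∫⁻ x in P.toSet, (‖(V n x - V i x) * (s x : ℂ)‖ₑ + ‖V i x * (s x : ℂ) - G x‖ₑ) := by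
          refine setLIntegral_mono' hPm fun x hx => ?_
          rw [← hconst x hx]
          refine le_trans (le_of_eq ?_) (enorm_add_le _ _)
          congr 1; ring
      _ = (∫⁻ x in P.toSet, ‖(V n x - V i x) * (s x : ℂ)‖ₑ) +
            ∫⁻ x in P.toSet, ‖V i x * (s x : ℂ) - G x‖ₑ := by
          refine lintegral_add_left' ?_ _
          exact (((hVm n).sub (hVm i)).aemeasurable.mul
            (Complex.measurable_ofReal.comp_aemeasurable hs).restrict).enorm
      _ ≤ _ := by
          refine add_le_add ?_ (lintegral_mono_set hPQ)
          rw [lintegral_enorm_mul_weight (f := fun x => V n x - V i x) hs hs0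
            ((hVm n).sub (hVm i)) hPm]
          refine (setLIntegral_mono' hPm fun z hz => hdiff i hi z hz).trans ?_
          rw [lintegral_add_left measurable_const, setLIntegral_const]
          refine add_le_add le_rfl ?_
          exact h.lintegral_low_le ha hg.1 hgw (D.cubeAt_mem j y) (by simp) i
  -- The lower end of the sum tends to $-\infty$ along `m`, which removes the distance to $G$.
  have hlim' := hlim.const_add (A * weightMeasure s P.toSet +
      K * ((∫⁻ x in P.toSet, ‖L.restrictLower j g x‖ₑ) ^ (1 / q) *
        weightMeasure s P.toSet ^ (1 / p)))
  rw [add_zero] at hlim'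
  refine ge_of_tendsto hlim' ?_
  filter_upwards [hm.eventually (eventually_le_atBot (j + 1))] with N hN
  exact hbound _ hN

end Linearization

theorem rpow_mul_rpow_div {b c v : ℝ≥0∞} (hv0 : v ≠ 0) (hvt : v ≠ ∞) {p q : ℝ}
    (hpq : p.HolderConjugate q) :
    b ^ (1 / q) * c ^ (1 / p) / v = (b / v) ^ (1 / q) * (c / v) ^ (1 / p) := by
  have hq : (0 : ℝ) ≤ 1 / q := one_div_nonneg.2 hpq.symm.nonneg
  have hp : (0 : ℝ) ≤ 1 / p := one_div_nonneg.2 hpq.nonneg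
  have e : v = v ^ (1 / q) * v ^ (1 / p) := by
    rw [← ENNReal.rpow_add _ _ hv0 hvt, one_div, one_div, hpq.symm.inv_add_inv_eq_one,
      ENNReal.rpow_one]
  rw [ENNReal.div_rpow_of_nonneg _ _ hq, ENNReal.div_rpow_of_nonneg _ _ hp]
  nth_rw 1 [e]
  exact ENNReal.mul_div_mul_comm (Or.inr (ENNReal.rpow_ne_top_of_nonneg hp hvt))
    (Or.inl (ENNReal.rpow_ne_top_of_nonneg hq hvt))

namespace Linearization

variable {L : Linearization d} {D : DyadicGrid d} {κ : ℕ}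
  {a : ℤ → (Fin d → ℝ) → (Fin d → ℝ) → ℂ} {g : (Fin d → ℝ) → ℂ}
  {w s : (Fin d → ℝ) → ℝ} {p q : ℝ} {K : ℝ≥0∞}

/-- Inside the cube, the lower scales of the adjoint series converge almost everywhere. -/
theorem AdjointMassBound.ae_tendsto_low (h : L.AdjointMassBound D a w s p q K) (hK : K ≠ ∞)
    (hpq : p.HolderConjugate q) (ha : LocalKernel D κ a) (hg : Integrable g)
    (hgw : ∀ᵐ x, ‖g x‖ₑ ≤ ENNReal.ofReal (w x)) (hs : AEMeasurable s volume)
    (hs0 : ∀ᵐ x, 0 < s x) (hst : ∀ Q : Cube d, weightMeasure s Q.toSet ≠ ∞) {Q : Cube d}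
    (hQ : Q ∈ D.cubes) :
    ∀ᵐ y, y ∈ Q.toSet → ∃ l : ℂ, Tendsto (fun n : ℤ => ∑ k ∈ Finset.Icc n Q.scale,
      L.adjointScale a k g y) atBot (𝓝 l) := by
  have hq0 := hpq.symm.pos
  have hp0 := hpq.pos
  obtain ⟨G, m, hG, hm, hlim⟩ := h.exists_limit hK hp0 hq0 ha hg hgw hs hs0 hQ (hst Q)
  have hsl := locallyIntegrable_of_weightMeasure hs hs0 hst
  have hGi : Integrable (Q.toSet.indicator G) := (integrable_indicator_iff Q.measurableSet_toSet).2 hG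
  filter_upwards [hs0, D.ae_tendsto_average hsl, D.ae_tendsto_avg hsl,
    D.ae_tendsto_average hGi.locallyIntegrable, L.ae_tendsto_avg_restrictLower D hg]
    with y hy0 hsA hsavg hGA hgA hyQ
  set V : ℤ → ℂ := fun n => ∑ k ∈ Finset.Icc n Q.scale, L.adjointScale a k g y with hV
  set sA : ℤ → ℂ := fun j => ⨍ x in (D.cubeAt j y).toSet, (s x : ℂ)
  set GA : ℤ → ℂ := fun j => ⨍ x in (D.cubeAt j y).toSet, Q.toSet.indicator G x
  have hs_ne : (s y : ℂ) ≠ 0 := by exact_mod_cast hy0.ne'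
  set E : ℤ → ℝ≥0∞ := fun j =>
    (∑ i ∈ Finset.Icc 1 (κ : ℤ), avg (L.restrictLower (j + i) g) (D.cubeAt (j + i) y)) *
      avg (fun x => (s x : ℂ)) (D.cubeAt j y) +
    K * (avg (L.restrictLower j g) (D.cubeAt j y) ^ (1 / q) *
      avg (fun x => (s x : ℂ)) (D.cubeAt j y) ^ (1 / p)) with hE
  have hE0 : Tendsto E atBot (𝓝 0) := by
    have h1 : Tendsto (fun j : ℤ => ∑ i ∈ Finset.Icc 1 (κ : ℤ),
        avg (L.restrictLower (j + i) g) (D.cubeAt (j + i) y)) atBot (𝓝 0) := by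
      have := tendsto_finsetSum (Finset.Icc 1 (κ : ℤ)) fun i _ =>
        hgA.comp (tendsto_atBot_add_const_right atBot i tendsto_id)
      simpa using this
    have h2 := ENNReal.Tendsto.mul h1 (Or.inr enorm_ne_top) hsavg (Or.inr ENNReal.zero_ne_top)
    have h3 := hgA.ennrpow_const (1 / q)
    rw [ENNReal.zero_rpow_of_pos (by positivity)] at h3
    have h4 := ENNReal.Tendsto.mul h3 (Or.inr (ENNReal.rpow_ne_top_of_nonneg (by positivity)
      enorm_ne_top)) (hsavg.ennrpow_const (1 / p)) (Or.inr ENNReal.zero_ne_top)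
    have h5 := h2.add (ENNReal.Tendsto.const_mul (a := K) h4 (Or.inr hK))
    rw [zero_mul, zero_mul, mul_zero, add_zero] at h5
    exact h5
  -- Division by $|P|$ turns every term into an average over cubes that shrink to $y$, and each
  -- product on the right has a factor that tends to $0$.
  have hmain : ∀ j : ℤ, j + κ + 1 ≤ Q.scale → ‖V (j + κ + 1) * sA j - GA j‖ₑ ≤ E j := by
    intro j hj
    set P := D.cubeAt j y with hP
    have hv0 := P.volume_ne_zero
    have hvt := P.volume_ne_top
    have hPQ : P.toSet ⊆ Q.toSet := D.subset_of_mem (D.cubeAt_mem j y) hQ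
      (by rw [DyadicGrid.scale_cubeAt]; omega) (D.mem_cubeAt j y) hyQ
    have h1 := h.enorm_mul_sub_le ha hg hgw hs hs0 hQ hG hm hlim hyQ hj
      (integrableOn_cube hsl P)
    have hGP : ∫ x in P.toSet, Q.toSet.indicator G x = ∫ x in P.toSet, G x :=
      setIntegral_congr_fun P.measurableSet_toSet fun x hx => Set.indicator_of_mem (hPQ hx) G
    have e1 : V (j + κ + 1) * sA j - GA j = ((volume.real P.toSet)⁻¹ : ℝ) •
        (V (j + κ + 1) * (∫ x in P.toSet, (s x : ℂ)) - ∫ x in P.toSet, G x) := by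
      simp only [sA, GA, setAverage_eq, hGP, smul_sub, ← hP]
      rw [mul_smul_comm]
    have e2 : ‖((volume.real P.toSet)⁻¹ : ℝ)‖ₑ = (volume P.toSet)⁻¹ := by
      rw [← ofReal_norm, Real.norm_of_nonneg (by positivity), measureReal_def,
        ENNReal.ofReal_inv_of_pos (ENNReal.toReal_pos hv0 hvt), ENNReal.ofReal_toReal hvt]
    have e3 : ∑ i ∈ Finset.Icc 1 (κ : ℤ), avg (L.restrictLower (j + i) g) (D.cubeAt (j + i) y) =
        ∑ k ∈ Finset.Icc (j + 1) (j + κ), avg (L.restrictLower k g) (D.cubeAt k y) := by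
      rw [← Finset.sum_image (s := Finset.Icc 1 (κ : ℤ)) (g := fun i => j + i)
        (f := fun k => avg (L.restrictLower k g) (D.cubeAt k y)) (by simp),
        Finset.image_add_left_Icc]
    rw [e1, enorm_smul, e2, mul_comm, ← div_eq_mul_inv]
    refine (ENNReal.div_le_div_right h1 _).trans (le_of_eq ?_)
    rw [ENNReal.add_div, mul_div_assoc, mul_div_assoc, rpow_mul_rpow_div hv0 hvt hpq,
      ← avg_weight hs0]
    simp only [hE, e3]
    rfl
  have hprod : Tendsto (fun j : ℤ => V (j + κ + 1) * sA j) atBot (𝓝 (Q.toSet.indicator G y)) := by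
    have h1 : Tendsto (fun j : ℤ => V (j + κ + 1) * sA j - GA j) atBot (𝓝 0) := by
      rw [tendsto_zero_iff_enorm_tendsto_zero]
      refine tendsto_of_tendsto_of_tendsto_of_le_of_le' tendsto_const_nhds hE0
        (Eventually.of_forall fun _ => zero_le) ?_
      filter_upwards [eventually_le_atBot (Q.scale - κ - 1)] with j hj
      exact hmain j (by omega)
    simpa using h1.add hGA
  -- The averages of $s$ tend to $s(y)>0$, so the sums themselves converge, with limit $G(y)/s(y)$.
  have hquot : Tendsto (fun j : ℤ => V (j + κ + 1)) atBot
      (𝓝 (Q.toSet.indicator G y / (s y : ℂ))) := by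
    refine (hprod.div hsA hs_ne).congr' ?_
    filter_upwards [hsA.eventually (isOpen_ne.mem_nhds hs_ne)] with j hj
    exact mul_div_cancel_right₀ _ hj
  refine ⟨_, (hquot.comp (tendsto_atBot_add_const_right atBot (-(κ : ℤ) - 1) tendsto_id)).congr
    fun n => ?_⟩
  simp only [Function.comp_apply, id]
  congr 1
  ring

/-- The adjoint series converges almost everywhere. -/
theorem AdjointMassBound.ae_exists_tendsto (h : L.AdjointMassBound D a w s p q K) (hK : K ≠ ∞)
    (hd : 0 < d) (hpq : p.HolderConjugate q) (ha : LocalKernel D κ a) (hg : Integrable g)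
    (hgw : ∀ᵐ x, ‖g x‖ₑ ≤ ENNReal.ofReal (w x)) (hs : AEMeasurable s volume)
    (hs0 : ∀ᵐ x, 0 < s x) (hst : ∀ Q : Cube d, weightMeasure s Q.toSet ≠ ∞) {Q : Cube d}
    (hQ : Q ∈ D.cubes) (hgQ : ∀ x ∉ Q.toSet, g x = 0) :
    ∀ᵐ y, ∃ l : ℂ, Tendsto (fun N : ℕ => ∑ k ∈ Finset.Icc (-(N : ℤ)) N,
      L.adjointScale a k g y) atTop (𝓝 l) := by
  filter_upwards [h.ae_tendsto_low hK hpq ha hg hgw hs hs0 hst hQ] with y hy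
  have hlow : ∃ l : ℂ, Tendsto (fun n : ℤ => ∑ k ∈ Finset.Icc n Q.scale,
      L.adjointScale a k g y) atBot (𝓝 l) := by
    by_cases hyQ : y ∈ Q.toSet
    · exact hy hyQ
    -- Off $Q$, a cube that contains $y$ and is no larger than $Q$ is disjoint from $Q$, so the low
    -- terms vanish.
    · refine ⟨0, tendsto_const_nhds.congr fun n => (Finset.sum_eq_zero fun k hk => ?_).symm⟩
      have e : L.adjointScale a k g y = L.adjointScale a k 0 y := by
        refine L.adjointScale_congr ha fun x hx _ => hgQ x fun hxQ => hyQ ?_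
        exact D.subset_of_mem (D.cubeAt_mem k y) hQ (by simpa using (Finset.mem_Icc.1 hk).2) hx hxQ
          (D.mem_cubeAt k y)
      rw [e]
      simp [adjointScale, cutoff]
  have hhigh : ∃ l : ℂ, Tendsto (fun N : ℤ => ∑ k ∈ Finset.Icc (Q.scale + 1) N,
      L.adjointScale a k g y) atTop (𝓝 l) := by
    -- Above $Q$ the series converges absolutely, its sum of norms being at most one average of
    -- $|g|$ over $Q$.
    have hsum : Summable fun n : ℕ => L.adjointScale a (Q.scale + 1 + n) g y := by
      refine Summable.of_enorm ?_
      refine ne_top_of_le_ne_top (avg_ne_top hg.locallyIntegrable Q) ?_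
      rw [ENNReal.tsum_eq_iSup_sum]
      refine iSup_le fun t => ?_
      rw [← Finset.sum_image (s := t) (g := fun n : ℕ => Q.scale + 1 + (n : ℤ))
        (f := fun k => ‖L.adjointScale a k g y‖ₑ) (by intro x _ y _ hxy; simpa using hxy)]
      refine L.sum_enorm_adjointScale_le ha hd hQ hgQ y _ fun k hk => ?_
      obtain ⟨n, -, rfl⟩ := Finset.mem_image.1 hk
      omega
    refine ⟨_, (hsum.hasSum.tendsto_sum_nat.comp
      (f := fun N : ℤ => (N - Q.scale).toNat) (x := atTop) ?_).congr fun N => ?_⟩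
    · refine tendsto_atTop.2 fun b => ?_
      filter_upwards [eventually_ge_atTop (Q.scale + b)] with N hN
      omega
    · simp only [Function.comp_apply]
      rw [← Finset.sum_image (s := Finset.range (N - Q.scale).toNat)
        (g := fun n : ℕ => Q.scale + 1 + (n : ℤ))
        (f := fun k => L.adjointScale a k g y) (by intro x _ y _ hxy; simpa using hxy)]
      congr 1
      ext k
      simp only [Finset.mem_image, Finset.mem_range, Finset.mem_Icc]
      refine ⟨?_, fun hk => ⟨(k - Q.scale - 1).toNat, by omega, by omega⟩⟩
      rintro ⟨n, hn, rfl⟩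
      omega
  obtain ⟨l, hl⟩ := hlow
  obtain ⟨l', hl'⟩ := hhigh
  refine ⟨l + l', ((hl.comp (tendsto_neg_atTop_atBot.comp tendsto_natCast_atTop_atTop)).add
    (hl'.comp tendsto_natCast_atTop_atTop)).congr' ?_⟩
  filter_upwards [eventually_ge_atTop Q.scale.natAbs] with N hN
  simp only [Function.comp_apply]
  exact (sum_Icc_eq_add _ (by omega) (by omega)).symm

end Linearization

/-! ### Test functions, passage to the limit, and the conclusion. -/

section TestFun

variable {w : (Fin d → ℝ) → ℝ} {φ : (Fin d → ℝ) → ℂ}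

theorem testFun_eq_zero (R : Cube d) (φ : (Fin d → ℝ) → ℂ) (w : (Fin d → ℝ) → ℝ) :
    ∀ x ∉ R.toSet, testFun R φ w x = 0 :=
  fun _ hx => Set.indicator_of_notMem hx _

theorem aestronglyMeasurable_testFun (R : Cube d) (hφ : AEMeasurable φ volume)
    (hw : AEMeasurable w volume) : AEStronglyMeasurable (testFun R φ w) volume :=
  (hφ.mul (Complex.measurable_ofReal.comp_aemeasurable hw)).aestronglyMeasurable.indicator
    R.measurableSet_toSet

theorem enorm_testFun_le (R : Cube d) (hφ : ∀ᵐ x, ‖φ x‖ ≤ 1) (hw : ∀ᵐ x, 0 < w x) :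
    ∀ᵐ x, ‖testFun R φ w x‖ₑ ≤ ENNReal.ofReal (w x) := by
  filter_upwards [hφ, hw] with x h1 h2
  refine (enorm_indicator_le_enorm_self _ _).trans ?_
  rw [← ofReal_norm, norm_mul, Complex.norm_real, Real.norm_of_nonneg h2.le]
  exact ENNReal.ofReal_le_ofReal (mul_le_of_le_one_left h2.le h1)

end TestFun

theorem lintegral_enorm_rpow_le_of_tendsto {α : Type*} [MeasurableSpace α] {μ : Measure α}
    {F : ℕ → α → ℂ} {f : α → ℂ} (hF : ∀ N, Measurable (F N))
    (h : ∀ᵐ y ∂μ, Tendsto (fun N => F N y) atTop (𝓝 (f y))) (r : ℝ) {X : ℝ≥0∞}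
    (hX : ∀ N, ∫⁻ y, ‖F N y‖ₑ ^ r ∂μ ≤ X) : ∫⁻ y, ‖f y‖ₑ ^ r ∂μ ≤ X := by
  calc ∫⁻ y, ‖f y‖ₑ ^ r ∂μ = ∫⁻ y, liminf (fun N => ‖F N y‖ₑ ^ r) atTop ∂μ := by
        refine lintegral_congr_ae ?_
        filter_upwards [h] with y hy
        exact ((hy.enorm).ennrpow_const r).liminf_eq.symm
    _ ≤ liminf (fun N => ∫⁻ y, ‖F N y‖ₑ ^ r ∂μ) atTop :=
        lintegral_liminf_le fun N => (hF N).enorm.pow_const r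
    _ ≤ liminf (fun _ : ℕ => X) atTop := liminf_le_liminf (Eventually.of_forall hX)
    _ = X := liminf_const X

end HaarShift

theorem lemma10p1 (d : ℕ) (hd : 0 < d) (p : ℝ) (hp : 1 < p) (B : ℝ≥0) :
    ∃ C : ℝ≥0, ∀ (D : HaarShift.DyadicGrid d) (m n : ℕ) (S : HaarShift.GeneralizedShift D m n),
      S.L2Bounded B →
      ∀ w : (Fin d → ℝ) → ℝ, HaarShift.IsApWeight w p →
      ∀ (L : HaarShift.Linearization d) (φ : (Fin d → ℝ) → ℂ), AEMeasurable φ volume →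
      (∀ᵐ x ∂(volume : Measure (Fin d → ℝ)), ‖φ x‖ ≤ 1) →
      ∀ Q ∈ D.cubes,
        (∀ᵐ y ∂(volume : Measure (Fin d → ℝ)),
          L.AdjointConverges S (HaarShift.testFun Q φ w) y) ∧
        eLpNorm (Set.indicator Q.toSet (L.adjoint S (HaarShift.testFun Q φ w)))
            (ENNReal.ofReal p.conjExponent)
            (HaarShift.weightMeasure (HaarShift.dualWeight w p)) ≤
          C * (HaarShift.complexity m n : ℝ≥0∞) * HaarShift.apConst w p *
            HaarShift.weightMeasure w Q.toSet ^ (1 / p.conjExponent) ∧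
        eLpNorm (HaarShift.nonstandardTesting S L p w φ Q) (ENNReal.ofReal p)
            (HaarShift.weightMeasure w) ≤
          C * (HaarShift.complexity m n : ℝ≥0∞) * HaarShift.apConst w p ^ (1 / (p - 1)) *
            HaarShift.weightMeasure (HaarShift.dualWeight w p) Q.toSet ^ (1 / p) := by
  set q := p.conjExponent with hq
  have hpq : p.HolderConjugate q := Real.HolderConjugate.conjExponent hp
  have hp0 := hpq.pos
  have hq0 := hpq.symm.pos
  have hq1 := hpq.symm.sub_one_pos
  have hq1p : 1 / (p - 1) = q - 1 := by
    have h1 := hpq.mul_eq_add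
    have h2 := hpq.sub_one_ne_zero
    rw [div_eq_iff h2]; linarith
  have hqp : (q - 1) * p = q := by
    have h1 := hpq.mul_eq_add; linarith
  obtain ⟨C₁, hC₁⟩ := HaarShift.exists_lintegral_adjoint_le_mass d hd hpq B
  obtain ⟨C₂, hC₂⟩ := HaarShift.exists_lintegral_adjoint_rpow_le d hd hpq B
  obtain ⟨C₃, hC₃⟩ := HaarShift.exists_lintegral_adjoint_le_volume d hd hpq B
  obtain ⟨C₄, hC₄⟩ := HaarShift.exists_lintegral_reciprocalMax_le d hd hpq
  refine ⟨C₂ + C₃ * C₄ ^ (1 / p), fun D m n S hS w hw L φ hφ hφ1 Q hQ => ?_⟩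
  set κ := HaarShift.complexity m n with hκ
  have hκ1 : 1 ≤ κ := le_max_right _ _
  have ha : HaarShift.LocalKernel D κ S.scaleKernel := S.localKernel_scaleKernel
    ((le_max_left _ _).trans (le_max_left _ _)) ((le_max_right _ _).trans (le_max_left _ _))
  have hB := hS.kernelL2Bounded
  have hs := HaarShift.aemeasurable_dualWeight p hw.meas
  have hs0 := HaarShift.dualWeight_pos p hw.pos
  have hA := hw.finite.ne
  have hgm := fun R => HaarShift.aestronglyMeasurable_testFun R hφ hw.meas
  have hgR := fun R => HaarShift.testFun_eq_zero R φ w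
  have hgw := fun R => HaarShift.enorm_testFun_le R hφ1 hw.pos
  have hconv : ∀ R ∈ D.cubes, ∀ᵐ y, L.AdjointConverges S (HaarShift.testFun R φ w) y := by
    intro R hR
    -- The mass bound is used only for convergence, so its constant does not enter `C`.
    have hmass : L.AdjointMassBound D S.scaleKernel w (HaarShift.dualWeight w p) p q
        (C₁ * κ * HaarShift.apConst w p ^ (q - 1)) :=
      fun b c g hg R hR hgR hgw => hC₁ D κ _ hB ha hκ1 w hw L b c g hg R hR hgR hgw
    have := hmass.ae_exists_tendsto (ENNReal.mul_ne_top (ENNReal.mul_ne_top (by simp) (by simp))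
      (ENNReal.rpow_ne_top_of_nonneg hq1.le hA)) hd hpq ha
      (HaarShift.integrable_of_le_weight (hgm R) (hgw R) (hgR R) (hw.weight_ne_top hp R)) (hgw R)
      hs hs0 (hw.dual_ne_top hp) hR (hgR R)
    filter_upwards [this] with y ⟨l, hl⟩
    exact ⟨l, hl.congr fun N => (L.adjointPartial_eq_sum S N _ y).symm⟩
  have hfatou : ∀ R ∈ D.cubes, ∀ (r : ℝ) (X : ℝ≥0∞),
      (∀ N : ℕ, ∫⁻ y in R.toSet, ‖∑ k ∈ Finset.Icc (-(N : ℤ)) N, L.adjointScale S.scaleKernel k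
        (HaarShift.testFun R φ w) y‖ₑ ^ r ∂(HaarShift.weightMeasure (HaarShift.dualWeight w p)) ≤
          X) →
      ∫⁻ y in R.toSet, ‖L.adjoint S (HaarShift.testFun R φ w) y‖ₑ ^ r
        ∂(HaarShift.weightMeasure (HaarShift.dualWeight w p)) ≤ X := by
    intro R hR r X hX
    refine HaarShift.lintegral_enorm_rpow_le_of_tendsto
      (fun N => L.measurable_sum_adjointScale ha _ _) (ae_restrict_of_ae ?_) r hX
    filter_upwards [(HaarShift.weightMeasure_absolutelyContinuous _).ae_le (hconv R hR)] with y hy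
    exact (tendsto_nhds_limUnder hy).congr fun N => L.adjointPartial_eq_sum S N _ y
  refine ⟨hconv Q hQ, ?_, ?_⟩
  · rw [eLpNorm_eq_lintegral_rpow_enorm_toReal (by simpa using hq0) (by simp),
      ENNReal.toReal_ofReal hq0.le]
    have h1 := hfatou Q hQ q _ fun N => hC₂ D κ _ hB ha hκ1 w hw L _ _ _ (hgm Q) Q hQ (hgR Q) (hgw Q)
    have e : ∀ y, ‖Q.toSet.indicator (L.adjoint S (HaarShift.testFun Q φ w)) y‖ₑ ^ q =
        Q.toSet.indicator (fun y => ‖L.adjoint S (HaarShift.testFun Q φ w) y‖ₑ ^ q) y := by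
      intro y
      by_cases hy : y ∈ Q.toSet
      · simp [hy]
      · simp [hy, hq0]
    simp only [e]
    rw [lintegral_indicator Q.measurableSet_toSet]
    refine (ENNReal.rpow_le_rpow h1 (by positivity)).trans ?_
    rw [ENNReal.mul_rpow_of_nonneg _ _ (by positivity), ← ENNReal.rpow_mul,
      mul_one_div_cancel hq0.ne', ENNReal.rpow_one]
    gcongr
    exact le_self_add
  · rw [eLpNorm_eq_lintegral_rpow_enorm_toReal (by simpa using hp0) (by simp),
      ENNReal.toReal_ofReal hp0.le, hq1p]
    set M := HaarShift.reciprocalMax D w Q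
    -- The factor $w(R)$ in the $L^1(\sigma)$ bound cancels $w(R)^{-1}$ and leaves the power $q-1$
    -- of $|R|/w(R)$.
    have hpt : ∀ x, HaarShift.nonstandardTesting S L p w φ Q x ≤
        C₃ * κ * HaarShift.apConst w p ^ (q - 1) * M x ^ (q - 1) := by
      intro x
      refine iSup₂_le fun R hR => ?_
      by_cases hx : x ∈ R.toSet
      · rw [Set.indicator_of_mem hx]
        have h1 := hfatou R hR.1 1 _ fun N => by
          simpa only [ENNReal.rpow_one] using
            hC₃ D κ _ hB ha hκ1 w hw L _ _ _ (hgm R) R hR.1 (hgR R) (hgw R)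
        simp only [ENNReal.rpow_one] at h1
        have hM : volume R.toSet / HaarShift.weightMeasure w R.toSet ≤ M x := by
          refine le_trans (le_of_eq ?_) (le_iSup₂_of_le R hR le_rfl)
          rw [Set.indicator_of_mem hx]
        refine (mul_le_mul' le_rfl h1).trans ?_
        rw [mul_left_comm, mul_comm (_ ^ (q - 1)) (HaarShift.weightMeasure w R.toSet), ← mul_assoc (_⁻¹),
          ENNReal.inv_mul_cancel (hw.weight_ne_zero R) (hw.weight_ne_top hp R), one_mul]
        exact mul_le_mul' le_rfl (ENNReal.rpow_le_rpow hM hq1.le)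
      · rw [Set.indicator_of_notMem hx]; exact zero_le
    have hint : ∫⁻ x, ‖HaarShift.nonstandardTesting S L p w φ Q x‖ₑ ^ p
        ∂(HaarShift.weightMeasure w) ≤ (C₃ * κ * HaarShift.apConst w p ^ (q - 1)) ^ p *
          (C₄ * HaarShift.weightMeasure (HaarShift.dualWeight w p) Q.toSet) := by
      refine le_trans ?_ (mul_le_mul' le_rfl (hC₄ D w hw Q hQ))
      rw [← lintegral_const_mul _ ((HaarShift.measurable_reciprocalMax D w Q).pow_const q)]
      refine lintegral_mono fun x => ?_
      rw [enorm_eq_self]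
      -- Since $(q-1)p=q$, the $p$-th power produces the $q$-th power of the maximal function, as
      -- Doob's inequality requires.
      refine (ENNReal.rpow_le_rpow (hpt x) hp0.le).trans (le_of_eq ?_)
      rw [ENNReal.mul_rpow_of_nonneg _ _ hp0.le, ← ENNReal.rpow_mul, hqp]
    refine (ENNReal.rpow_le_rpow hint (by positivity)).trans ?_
    rw [ENNReal.mul_rpow_of_nonneg _ _ (by positivity), ← ENNReal.rpow_mul,
      mul_one_div_cancel hp0.ne', ENNReal.rpow_one, ENNReal.mul_rpow_of_nonneg _ _ (by positivity),
      ← ENNReal.coe_rpow_of_nonneg _ (by positivity)]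
    calc _ = ((C₃ * C₄ ^ (1 / p) : ℝ≥0) : ℝ≥0∞) * κ * HaarShift.apConst w p ^ (q - 1) *
          HaarShift.weightMeasure (HaarShift.dualWeight w p) Q.toSet ^ (1 / p) := by
          push_cast; ring
      _ ≤ _ := by gcongr; exact le_add_self

end
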